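/- Let $\delta>0$. On the phase space $P=\{(r_1,v,l)\in\mathbb R^3 : r_1>0,\ l\ge 0\}$ consider the system $$r_1' = v+2\delta r_1 l^3,\qquad v' = -\frac{r_1-1}{r_1^3}-2\delta v l^3,\qquad l'=-\delta l^4,$$ and put $H(r_1,v)=\frac12 v^2+\frac{(r_1-1)^2}{2r_1^2}$. For each $p\in P$ there is a unique solution $t\mapsto\phi_t(p)=(r_1(t),v(t),l(t))\in P$ with $\phi_0(p)=p$; it exists for all $t\ge 0$, and the limit $H_\infty(p):=\lim_{t\to\infty}H(r_1(t),v(t))$ exists. For $h\in(0,\frac12)$ let $\Gamma_1(h)=\{(r_1,v,0)\in P : H(r_1,v)=h\}$ (a periodic orbit) and let $W^s(\Gamma_1(h))=\{p\in P : \operatorname{dist}(\phi_t(p),\Gamma_1(h))\to 0 \text{ as } t\to\infty\}$ be its stable set. Then, for every $h\in(0,\frac12)$: 1. $W^s(\Gamma_1(h))=\{p\in P : H_\infty(p)=h\}$. 2. For every integer $k\ge 1$ there is an open neighbourhood $N=N(k,h)$ of $\Gamma_1(h)$ in $\mathbb R^3$ such that $W^s(\Gamma_1(h))\cap N$ is a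 $C^k$ two-dimensional embedded submanifold of the half-space $\{l\ge 0\}$, $C^k$ up to its boundary $\Gamma_1(h)$ and transverse to $\{l=0\}$ there. That is, around each of its points there is a $C^k$ diffeomorphism between open subsets of $\mathbb R^3$ which respects $\{l\ge 0\}$ and straightens $W^s(\Gamma_1(h))\cap N$ to the part of a coordinate plane $\{y_1=0\}$ in that half-space. 3. The dependence on $h$ is $C^k$: there is $\varepsilon>0$ with $(h-\varepsilon,h+\varepsilon)\subset(0,\frac12)$ such that around each point of each $W^s(\Gamma_1(h'))\cap N$, $|h'-h|<\varepsilon$, there are such straightening diffeomorphisms for all nearby parameter values, which together with their inverses are jointly $C^k$ in the parameter and the point. -/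

import Mathlib

open Set Filter Topology

noncomputable section

namespace KeplerDrag

/-- The `(r₁, v, l)`-space. -/
abbrev Space := ℝ × ℝ × ℝ

/-- The phase space: `r₁ > 0` and `l ≥ 0` (`l` is the magnitude of the angular momentum); the
limiting value `l = 0` is included. -/
def phaseSpace : Set Space := {p | 0 < p.1 ∧ 0 ≤ p.2.2}

/-- The vector field of the rescaled Kepler problem with linear drag `δ`. -/
def vectorField (δ : ℝ) (p : Space) : Space :=
  (p.2.1 + 2 * δ * p.1 * p.2.2 ^ 3,
   -((p.1 - 1) / p.1 ^ 3) - 2 * δ * p.2.1 * p.2.2 ^ 3,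
   -δ * p.2.2 ^ 4)

/-- The Hamiltonian of the limiting system on `l = 0`, as a function of `(r₁, v)`. -/
def hamiltonian (r₁ v : ℝ) : ℝ := v ^ 2 / 2 + (r₁ - 1) ^ 2 / (2 * r₁ ^ 2)

/-- `γ` restricted to `[0, ∞)` is a solution in the phase space, starting at `p`. -/
def IsForwardSolution (δ : ℝ) (p : Space) (γ : ℝ → Space) : Prop :=
  γ 0 = p ∧ ∀ t : ℝ, 0 ≤ t →
    γ t ∈ phaseSpace ∧ HasDerivWithinAt γ (vectorField δ (γ t)) (Ici 0) t

open Classical in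
/-- The forward flow: the value at time `t ≥ 0` of the solution starting at `p` (and `p` itself
if there were no solution on `[0, ∞)`). -/
def flow (δ t : ℝ) (p : Space) : Space :=
  if hp : ∃ γ : ℝ → Space, IsForwardSolution δ p γ then Classical.choose hp t else p

/-- The limiting Hamiltonian: the limit of the Hamiltonian along the flow as `t → ∞`. -/
def hamiltonianLimit (δ : ℝ) (p : Space) : ℝ :=
  limUnder atTop (fun t : ℝ => hamiltonian (flow δ t p).1 (flow δ t p).2.1)

/-- The orbit `Γ₁(h)`: the level set `H = h` within the part `l = 0` of the phase space. -/
def periodicOrbit (h : ℝ) : Set Space :=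
  {p | p ∈ phaseSpace ∧ p.2.2 = 0 ∧ hamiltonian p.1 p.2.1 = h}

/-- The stable set of `A`: the points of the phase space whose forward orbit tends to `A`. -/
def stableSet (δ : ℝ) (A : Set Space) : Set Space :=
  {p | p ∈ phaseSpace ∧ Tendsto (fun t : ℝ => Metric.infDist (flow δ t p) A) atTop (𝓝 0)}

/-- `S` is a `C^k` two-dimensional embedded submanifold of the half-space `{l ≥ 0}`, with boundary
`S ∩ {l = 0}` (and transverse to `{l = 0}`): around each of its points there is a `C^k`
diffeomorphism `e` between open subsets of three-space which respects the half-space `{l ≥ 0}` and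
maps `S` to the part of the coordinate plane `{y₁ = 0}` in that half-space. -/
def IsCkSurface (k : ℕ) (S : Set Space) : Prop :=
  ∀ p₀ ∈ S, ∃ e : OpenPartialHomeomorph Space Space,
    p₀ ∈ e.source ∧ ContDiffOn ℝ k e e.source ∧ ContDiffOn ℝ k e.symm e.target ∧
    ∀ p ∈ e.source,
      (0 ≤ (e p).2.2 ↔ 0 ≤ p.2.2) ∧
      (p ∈ S ↔ 0 ≤ p.2.2 ∧ (e p).1 = 0)

/-- The surfaces `S h`, for `h` in the open set `J`, depend in a `C^k` way on `h`: around each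
point of each of them they have straightening diffeomorphisms (as in `IsCkSurface`) that exist for
all nearby parameters and are jointly `C^k` in the parameter and the point, together with their
inverses. -/
def IsCkFamilyOfSurfaces (k : ℕ) (J : Set ℝ) (S : ℝ → Set Space) : Prop :=
  ∀ h₀ ∈ J, ∀ p₀ ∈ S h₀, ∃ e : OpenPartialHomeomorph (ℝ × Space) (ℝ × Space),
    (h₀, p₀) ∈ e.source ∧ ContDiffOn ℝ k e e.source ∧ ContDiffOn ℝ k e.symm e.target ∧
    ∀ z ∈ e.source,
      z.1 ∈ J ∧ (e z).1 = z.1 ∧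
      (0 ≤ (e z).2.2.2 ↔ 0 ≤ z.2.2.2) ∧
      (z.2 ∈ S z.1 ↔ 0 ≤ z.2.2.2 ∧ (e z).2.1 = 0)

end KeplerDrag

end

/-!
The heart of the matter is a smoothness statement: the limiting Hamiltonian `H∞` extends across
`{l = 0}` to a function of class `C^k`, for every `k`.
Given this, the rest is soft: `W^s(Γ₁(h))` is the level set `H∞ = h`, since near the circle `H = h`
the distance to it is controlled by `|H - h|` and `l` (`stableSet_periodicOrbit`); on `{l = 0}` the
extension is `H`, which has no critical point on `H = h` for `0 < h < 1 / 2`; and the inverse function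
theorem straightens all the level sets simultaneously.

For the smoothness put `w = 1 - 1 / r₁`, `a = w + i v`, `b = w - i v`, `n = l⁻³` and use the time `s`
with `ds = r₁⁻² dt`. The system becomes the rotation `a' = -i a`, `b' = i b`, perturbed at order
`n⁻¹`, with `n' = 3 δ / q²` and `q = 1 - (a + b) / 2 = 1 / r₁`; it is holomorphic, and
`H = a b / 2`. Averaging gives a formal integral `∑ j, n⁻ʲ F j(a, b)` with `F 0 = a b / 2`. At each
order the homological equation is solvable because the part of the drag term which acts on
rotation invariant functions is a total derivative along the rotations, and the remaining mean
can be cancelled since `n` itself drifts (`IsAveragingDomain.exists_formalIntegral`).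

On a thin complex neighbourhood of a circle `|a| = ρ`, `b = conj a`, and for `Re n` large, the
complex solutions exist for all times and stay near the circle, by an adiabatic invariant, while
`Re n` grows linearly (`exists_confinement`). Hence `a b / 2` converges along them, the limit is
holomorphic, and the partial sums of the formal integral approximate it with an error of order
`(Re n)⁻ᴺ = O(|l|³ᴺ)`, uniformly on the complex neighbourhood (`exists_holomorphic_limit`). In the
variable `l` this neighbourhood contains a disc of radius proportional to `l` around each `l > 0`, so
by Cauchy's estimates the remainder is flat at `l = 0` and extends by zero as a `C^k` function
(`contDiffOn_zero_extension`), while the partial sums are polynomials in `l³`. On real points the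
complex limit is `H∞`, because the real flow is a time change of the complex one
(`hamiltonianLimit_eq_of_complexSolution`).

The global existence of the real flow and of its limiting Hamiltonian are obtained from monotone
quantities: `l` decays explicitly, `(H - 1 / 2) / l²` is nonincreasing, and `H + 2 δ l³ r₁ v` is
monotone up to a multiple of `l`.
-/

noncomputable section

namespace KeplerDrag

open Metric MeasureTheory

/-! ### Complex analysis in normed spaces -/

section Holomorphic

variable {E F : Type*} [NormedAddCommGroup E] [NormedSpace ℂ E]
  [NormedAddCommGroup F] [NormedSpace ℂ F]

/-- Cauchy's estimate for the Fréchet derivative at the centre of a ball. -/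
theorem norm_fderiv_le_of_bounded_on_ball {f : E → F} {x : E} {R M : ℝ} (hR : 0 < R)
    (hd : DifferentiableOn ℂ f (ball x R)) (hM : ∀ y ∈ ball x R, ‖f y‖ ≤ M) :
    ‖fderiv ℂ f x‖ ≤ 2 * M / R := by
  refine Complex.norm_fderiv_le_div_of_mapsTo_ball hd (fun y hy => ?_) hR
  rw [mem_closedBall, dist_eq_norm]
  calc ‖f y - f x‖ ≤ ‖f y‖ + ‖f x‖ := norm_sub_le _ _
    _ ≤ M + M := add_le_add (hM y hy) (hM x (mem_ball_self hR))
    _ = 2 * M := by ring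

/-- Second order Taylor estimate for a bounded holomorphic map, a form of Schwarz's lemma. -/
theorem norm_taylor_two_le_of_bounded_on_ball {f : E → F} {x w : E} {R M : ℝ} (hw : ‖w‖ < R)
    (hd : DifferentiableOn ℂ f (ball x R)) (hM : ∀ y ∈ ball x R, ‖f y‖ ≤ M) :
    ‖f (x + w) - f x - fderiv ℂ f x w‖ ≤ 4 * M / R ^ 2 * ‖w‖ ^ 2 := by
  have hR : 0 < R := (norm_nonneg w).trans_lt hw
  have hder := norm_fderiv_le_of_bounded_on_ball hR hd hM
  set h : E → F := fun y => f y - f x - fderiv ℂ f x (y - x) with hh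
  have hx0 : h x = 0 := by simp [hh]
  have hdh : DifferentiableOn ℂ h (ball x R) :=
    (hd.sub_const _).sub ((fderiv ℂ f x).differentiable.comp
      (differentiable_id.sub_const x)).differentiableOn
  have hmaps : MapsTo h (ball x R) (closedBall (h x) (4 * M)) := by
    intro y hy
    rw [hx0, mem_closedBall_zero_iff]
    have h1 : ‖fderiv ℂ f x (y - x)‖ ≤ 2 * M := by
      calc ‖fderiv ℂ f x (y - x)‖ ≤ ‖fderiv ℂ f x‖ * ‖y - x‖ := ContinuousLinearMap.le_opNorm _ _
        _ ≤ 2 * M / R * R := by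
          have : ‖y - x‖ ≤ R := by rw [← dist_eq_norm]; exact (mem_ball.1 hy).le
          exact mul_le_mul hder this (norm_nonneg _) ((norm_nonneg _).trans hder)
        _ = 2 * M := by field_simp
    calc ‖h y‖ ≤ ‖f y - f x‖ + ‖fderiv ℂ f x (y - x)‖ := norm_sub_le _ _
      _ ≤ (‖f y‖ + ‖f x‖) + 2 * M := add_le_add (norm_sub_le _ _) h1
      _ ≤ (M + M) + 2 * M := by
        gcongr
        · exact hM y hy
        · exact hM x (mem_ball_self hR)
      _ = 4 * M := by ring
  have hlo : (fun y => h y - h x) =o[𝓝 x] fun y => (‖y - x‖ : ℝ) ^ 1 := by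
    have := (hd.differentiableAt (ball_mem_nhds x hR)).hasFDerivAt.isLittleO
    rw [hx0]
    simpa [hh] using this.norm_right
  have hz : x + w ∈ ball x R := by simpa [mem_ball, dist_eq_norm] using hw
  have hlo' : (fun y => h y - h x) =o[𝓝 x] fun y => ((y - x : E)) := by
    simpa using hlo
  have key := Complex.dist_le_mul_div_pow_of_mapsTo_ball_of_isLittleO (n := 1) hdh hmaps
    (by simpa using hlo) hz
  rw [hx0, dist_zero_right] at key
  have e1 : h (x + w) = f (x + w) - f x - fderiv ℂ f x w := by simp [hh]
  rw [e1] at key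
  refine key.trans (le_of_eq ?_)
  simp [dist_eq_norm]
  ring

/-- A quadratic estimate for the remainder gives differentiability. -/
theorem hasFDerivAt_of_norm_sub_le_sq {𝕜 E F : Type*} [NontriviallyNormedField 𝕜]
    [NormedAddCommGroup E] [NormedSpace 𝕜 E] [NormedAddCommGroup F] [NormedSpace 𝕜 F]
    {g : E → F} {A : E →L[𝕜] F} {x : E} {R C : ℝ} (hR : 0 < R)
    (h : ∀ w : E, ‖w‖ < R → ‖g (x + w) - g x - A w‖ ≤ C * ‖w‖ ^ 2) : HasFDerivAt g A x := by
  rw [hasFDerivAt_iff_isLittleO_nhds_zero]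
  have h1 : (fun w : E => g (x + w) - g x - A w) =O[𝓝 0] fun w => ‖w‖ ^ 2 := by
    refine Asymptotics.IsBigO.of_bound C ?_
    filter_upwards [ball_mem_nhds (0 : E) hR] with w hw
    simpa using h w (by simpa using hw)
  refine h1.trans_isLittleO ?_
  have := Asymptotics.isLittleO_norm_pow_id (E' := E) (n := 2) one_lt_two
  exact this

/-- Weierstrass' theorem: a uniform limit of holomorphic maps is holomorphic. -/
theorem differentiableAt_of_norm_sub_le [CompleteSpace F] {f : ℕ → E → F} {g : E → F} {x : E}
    {R : ℝ} (hR : 0 < R) {u : ℕ → ℝ} (hu : Tendsto u atTop (𝓝 0))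
    (hd : ∀ n, DifferentiableOn ℂ (f n) (ball x R))
    (hfg : ∀ n, ∀ y ∈ ball x R, ‖f n y - g y‖ ≤ u n) : DifferentiableAt ℂ g x := by
  have hxb := mem_ball_self (x := x) hR
  have hdx : ∀ n, DifferentiableAt ℂ (f n) x := fun n =>
    (hd n).differentiableAt (ball_mem_nhds x hR)
  have hdiff : ∀ m n, ∀ y ∈ ball x R, ‖f m y - f n y‖ ≤ u m + u n := fun m n y hy => by
    calc ‖f m y - f n y‖ = ‖(f m y - g y) - (f n y - g y)‖ := by rw [sub_sub_sub_cancel_right]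
      _ ≤ ‖f m y - g y‖ + ‖f n y - g y‖ := norm_sub_le _ _
      _ ≤ u m + u n := add_le_add (hfg m y hy) (hfg n y hy)
  have hcauchy : CauchySeq (fun n => fderiv ℂ (f n) x) := by
    rw [Metric.cauchySeq_iff']
    intro ε hε
    have hu' : Tendsto (fun n => 2 * (u n + u n) / R) atTop (𝓝 0) := by
      simpa using ((hu.add hu).const_mul 2).div_const R
    have hev : ∀ᶠ n in atTop, 4 * u n / R < ε / 2 := by
      have hu' : Tendsto (fun n => 4 * u n / R) atTop (𝓝 0) := by
        simpa using (hu.const_mul 4).div_const R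
      exact hu'.eventually (gt_mem_nhds (half_pos hε))
    obtain ⟨N, hN⟩ := eventually_atTop.1 hev
    refine ⟨N, fun n hn => ?_⟩
    rw [dist_eq_norm, ← fderiv_fun_sub (hdx n) (hdx N)]
    refine (norm_fderiv_le_of_bounded_on_ball hR ((hd n).sub (hd N)) (hdiff n N)).trans_lt ?_
    have h1 := hN n hn
    have h2 := hN N le_rfl
    have : 2 * (u n + u N) / R = (4 * u n / R + 4 * u N / R) / 2 := by ring
    linarith
  obtain ⟨A, hA⟩ := cauchySeq_tendsto_of_complete hcauchy
  obtain ⟨B, hB⟩ := hu.bddAbove_range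
  have hB' : ∀ n, u n ≤ B := fun n => hB ⟨n, rfl⟩
  have hlim : ∀ y ∈ ball x R, Tendsto (fun n => f n y) atTop (𝓝 (g y)) := fun y hy => by
    rw [tendsto_iff_norm_sub_tendsto_zero]
    exact squeeze_zero (fun _ => norm_nonneg _) (fun n => hfg n y hy) hu
  have hg : HasFDerivAt (fun y => g y - f 0 y) (A - fderiv ℂ (f 0) x) x := by
    refine hasFDerivAt_of_norm_sub_le_sq (C := 4 * (B + B) / R ^ 2) hR fun w hw => ?_
    have hwb : x + w ∈ ball x R := by simpa [mem_ball, dist_eq_norm] using hw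
    have hn : ∀ n, ‖(f n (x + w) - f 0 (x + w)) - (f n x - f 0 x)
        - (fderiv ℂ (f n) x - fderiv ℂ (f 0) x) w‖ ≤ 4 * (B + B) / R ^ 2 * ‖w‖ ^ 2 := fun n => by
      rw [← fderiv_fun_sub (hdx n) (hdx 0)]
      exact norm_taylor_two_le_of_bounded_on_ball hw ((hd n).sub (hd 0))
        (fun y hy => (hdiff n 0 y hy).trans (add_le_add (hB' n) (hB' 0)))
    refine le_of_tendsto' (x := atTop) (Tendsto.norm ?_) hn
    refine (((hlim _ hwb).sub tendsto_const_nhds).sub ((hlim _ hxb).sub tendsto_const_nhds)).sub ?_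
    exact ((ContinuousLinearMap.apply ℂ F w).continuous.tendsto _).comp
      (hA.sub tendsto_const_nhds)
  have := hg.differentiableAt.fun_add (hdx 0)
  simpa using this

/-- The derivative of a holomorphic map in a fixed direction is holomorphic, being a locally
uniform limit of difference quotients. -/
theorem DifferentiableOn.fderiv_apply_complex [CompleteSpace F] {f : E → F} {U : Set E}
    (hU : IsOpen U) (hf : DifferentiableOn ℂ f U) (v : E) :
    DifferentiableOn ℂ (fun x => fderiv ℂ f x v) U := by
  intro x hx
  refine DifferentiableAt.differentiableWithinAt ?_
  have hb : ∀ᶠ y in 𝓝 x, ‖f y‖ < ‖f x‖ + 1 :=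
    (hf.differentiableAt (hU.mem_nhds hx)).continuousAt.norm.eventually
      (gt_mem_nhds (lt_add_one _))
  obtain ⟨R, hR, hball⟩ := Metric.eventually_nhds_iff_ball.1 (hb.and (hU.mem_nhds hx))
  set M := ‖f x‖ + 1
  have hV : 0 < ‖v‖ + 1 := by positivity
  -- the increments `c n • v` are shorter than a quarter of the radius
  set c : ℕ → ℝ := fun n => R / (4 * (‖v‖ + 1)) * (1 / ((n : ℝ) + 1)) with hc
  have hcpos : ∀ n, 0 < c n := fun n => by positivity
  have hc0 : Tendsto c atTop (𝓝 0) := by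
    simpa [hc] using (tendsto_one_div_add_atTop_nhds_zero_nat (𝕜 := ℝ)).const_mul
      (R / (4 * (‖v‖ + 1)))
  have hcv : ∀ n, ‖(c n : ℂ) • v‖ < R / 2 := fun n => by
    rw [norm_smul, Complex.norm_real, Real.norm_of_nonneg (hcpos n).le]
    have h1 : 1 / ((n : ℝ) + 1) ≤ 1 := by
      rw [div_le_one (by positivity)]; linarith [n.cast_nonneg (α := ℝ)]
    calc c n * ‖v‖ ≤ R / (4 * (‖v‖ + 1)) * 1 * (‖v‖ + 1) := by
          simp only [hc]; gcongr; linarith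
      _ = R / 4 := by field_simp
      _ < R / 2 := by linarith
  refine differentiableAt_of_norm_sub_le (half_pos hR) (F := F)
    (f := fun n y => (c n : ℂ)⁻¹ • (f (y + (c n : ℂ) • v) - f y))
    (u := fun n => 4 * M / (R / 2) ^ 2 * ‖v‖ ^ 2 * c n) (by simpa using hc0.const_mul _) ?_ ?_
  · intro n y hy
    have h1 : y + (c n : ℂ) • v ∈ ball x R := by
      rw [mem_ball, dist_eq_norm] at *
      calc ‖y + (c n : ℂ) • v - x‖ = ‖(y - x) + (c n : ℂ) • v‖ := by congr 1; abel
        _ ≤ ‖y - x‖ + ‖(c n : ℂ) • v‖ := norm_add_le _ _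
        _ < R := by linarith [hcv n]
    have h2 : y ∈ ball x R := ball_subset_ball (by linarith) hy
    have d1 := hf.differentiableAt (hU.mem_nhds (hball _ h1).2)
    have d2 := hf.differentiableAt (hU.mem_nhds (hball _ h2).2)
    have d3 : DifferentiableAt ℂ (fun y => f (y + (c n : ℂ) • v)) y :=
      DifferentiableAt.comp y d1 (differentiableAt_id.add_const _)
    exact ((d3.sub d2).const_smul _).differentiableWithinAt
  · intro n y hy
    have hsub : ball y (R / 2) ⊆ ball x R := fun z hz => by
      rw [mem_ball] at *
      linarith [dist_triangle z y x]
    have hq := norm_taylor_two_le_of_bounded_on_ball (hcv n)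
      (fun z hz => (hf.differentiableAt
        (hU.mem_nhds (hball _ (hsub hz)).2)).differentiableWithinAt)
      (fun z hz => (hball _ (hsub hz)).1.le)
    have hcn : (c n : ℂ) ≠ 0 := by exact_mod_cast (hcpos n).ne'
    have e1 : (c n : ℂ)⁻¹ • (f (y + (c n : ℂ) • v) - f y) - fderiv ℂ f y v
        = (c n : ℂ)⁻¹ • (f (y + (c n : ℂ) • v) - f y - fderiv ℂ f y ((c n : ℂ) • v)) := by
      rw [map_smul, smul_sub _ _ ((c n : ℂ) • _), smul_smul, inv_mul_cancel₀ hcn, one_smul]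
    rw [e1, norm_smul, norm_inv, Complex.norm_real, Real.norm_of_nonneg (hcpos n).le]
    rw [norm_smul, Complex.norm_real, Real.norm_of_nonneg (hcpos n).le] at hq
    calc (c n)⁻¹ * _ ≤ (c n)⁻¹ * (4 * M / (R / 2) ^ 2 * (c n * ‖v‖) ^ 2) :=
          mul_le_mul_of_nonneg_left hq (inv_pos.2 (hcpos n)).le
      _ = _ := by
        have := (hcpos n).ne'
        field_simp

/-- The derivative of a holomorphic map on an open subset of a finite-dimensional space is
holomorphic. -/
theorem DifferentiableOn.fderiv_complex [FiniteDimensional ℂ E] [CompleteSpace F] {f : E → F}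
    {U : Set E} (hU : IsOpen U) (hf : DifferentiableOn ℂ f U) :
    DifferentiableOn ℂ (fderiv ℂ f) U := by
  classical
  let b := Module.finBasis ℂ E
  let coord : ∀ i, E →L[ℂ] ℂ := fun i => LinearMap.toContinuousLinearMap (b.coord i)
  have hrep : ∀ L : E →L[ℂ] F, L = ∑ i, (coord i).smulRight (L (b i)) := fun L => by
    ext w
    conv_lhs => rw [← b.sum_repr w, map_sum]
    simp [coord]
  have : fderiv ℂ f = fun x => ∑ i, (coord i).smulRight (fderiv ℂ f x (b i)) :=
    funext fun x => hrep _
  rw [this]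
  refine DifferentiableOn.fun_sum fun i _ => ?_
  exact (ContinuousLinearMap.smulRightL ℂ E F (coord i)).differentiable.comp_differentiableOn
    (DifferentiableOn.fderiv_apply_complex hU hf (b i))

/-- Osgood's lemma: a holomorphic map on an open subset of a finite-dimensional space is smooth. -/
theorem DifferentiableOn.contDiffOn_complex {E F : Type} [NormedAddCommGroup E] [NormedSpace ℂ E]
    [NormedAddCommGroup F] [NormedSpace ℂ F] [FiniteDimensional ℂ E] [CompleteSpace F] {f : E → F}
    {U : Set E} (hU : IsOpen U) (hf : DifferentiableOn ℂ f U) (k : ℕ) : ContDiffOn ℂ k f U := by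
  induction k generalizing F with
  | zero => exact contDiffOn_zero.2 hf.continuousOn
  | succ k ih =>
    rw [Nat.cast_succ, contDiffOn_succ_iff_fderiv_of_isOpen hU]
    exact ⟨hf, fun h => by simp at h, ih (DifferentiableOn.fderiv_complex hU hf)⟩

/-- An integral depending holomorphically and boundedly on a parameter is holomorphic. -/
theorem differentiableAt_intervalIntegral [CompleteSpace F] {g : ℝ → E → F} {a b : ℝ} (hab : a ≤ b)
    {x : E} {R M : ℝ} (hR : 0 < R) (hd : ∀ s ∈ Icc a b, DifferentiableOn ℂ (g s) (ball x R))
    (hM : ∀ s ∈ Icc a b, ∀ y ∈ ball x R, ‖g s y‖ ≤ M)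
    (hc : ∀ y ∈ ball x R, ContinuousOn (fun s => g s y) (Icc a b)) :
    DifferentiableAt ℂ (fun y => ∫ s in a..b, g s y) x := by
  have hxb := mem_ball_self (x := x) hR
  have hdx : ∀ s ∈ Icc a b, DifferentiableAt ℂ (g s) x := fun s hs =>
    (hd s hs).differentiableAt (ball_mem_nhds x hR)
  have hfd : ∀ s ∈ Icc a b, ∀ w, ‖fderiv ℂ (g s) x w‖ ≤ 2 * M / R * ‖w‖ := fun s hs w =>
    (ContinuousLinearMap.le_opNorm _ _).trans (mul_le_mul_of_nonneg_right
      (norm_fderiv_le_of_bounded_on_ball hR (hd s hs) (hM s hs)) (norm_nonneg _))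
  have huIoc : uIoc a b = Ioc a b := uIoc_of_le hab
  have hgi : ∀ y ∈ ball x R, IntervalIntegrable (fun s => g s y) volume a b := fun y hy =>
    (hc y hy).intervalIntegrable_of_Icc hab
  have hint : ∀ w, IntervalIntegrable (fun s => fderiv ℂ (g s) x w) volume a b := fun w => by
    rw [intervalIntegrable_iff, huIoc]
    refine ⟨?_, .restrict_of_bounded (C := 2 * M / R * ‖w‖) (by simp) ?_⟩
    -- the derivative is measurable in `s`, as a limit of difference quotients
    · set c : ℕ → ℂ := fun n => (((n : ℝ) + 1) * (‖w‖ + 1) / R : ℝ) with hcdef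
      have hcn : ∀ n, ‖c n‖ = ((n : ℝ) + 1) * (‖w‖ + 1) / R := fun n => by
        rw [hcdef, Complex.norm_real, Real.norm_of_nonneg (by positivity)]
      have hcinf : Tendsto (fun n => ‖c n‖) atTop atTop := by
        simp_rw [hcn]
        exact ((tendsto_natCast_atTop_atTop.atTop_add tendsto_const_nhds).atTop_mul_const
          (by positivity)).atTop_div_const hR
      have hmem : ∀ n, x + (c n)⁻¹ • w ∈ ball x R := fun n => by
        rw [mem_ball, dist_eq_norm, add_sub_cancel_left, norm_smul, norm_inv, hcn]
        have h1 : (1 : ℝ) ≤ (n : ℝ) + 1 := by linarith [n.cast_nonneg (α := ℝ)]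
        rw [inv_div, div_mul_eq_mul_div, div_lt_iff₀ (by positivity)]
        have : ‖w‖ < (↑n + 1) * (‖w‖ + 1) := by nlinarith [norm_nonneg w]
        exact mul_lt_mul_of_pos_left this hR
      refine aestronglyMeasurable_of_tendsto_ae (u := atTop)
        (f := fun n s => c n • (g s (x + (c n)⁻¹ • w) - g s x)) ?_ ?_
      · intro n
        refine ContinuousOn.aestronglyMeasurable ?_ measurableSet_Ioc
        exact (((hc _ (hmem n)).sub (hc _ hxb)).const_smul (c n)).mono Ioc_subset_Icc_self
      · filter_upwards [ae_restrict_mem measurableSet_Ioc] with s hs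
        exact (hdx s (Ioc_subset_Icc_self hs)).hasFDerivAt.lim w hcinf
    · filter_upwards [ae_restrict_mem measurableSet_Ioc] with s hs
      exact hfd s (Ioc_subset_Icc_self hs) w
  let A : E →ₗ[ℂ] F :=
    { toFun := fun w => ∫ s in a..b, fderiv ℂ (g s) x w
      map_add' := fun v w => by
        simp_rw [map_add]
        exact intervalIntegral.integral_add (hint v) (hint w)
      map_smul' := fun c w => by
        simp_rw [map_smul]
        exact intervalIntegral.integral_smul c _ }
  let A' : E →L[ℂ] F := A.mkContinuous (2 * M / R * |b - a|) fun w => by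
    have := intervalIntegral.norm_integral_le_of_norm_le_const (a := a) (b := b)
      (f := fun s => fderiv ℂ (g s) x w) (C := 2 * M / R * ‖w‖)
      (fun s hs => hfd s (Ioc_subset_Icc_self (huIoc ▸ hs)) w)
    calc ‖A w‖ ≤ _ := this
      _ = _ := by ring
  refine HasFDerivAt.differentiableAt (f' := A') ?_
  refine hasFDerivAt_of_norm_sub_le_sq (C := 4 * M / R ^ 2 * |b - a|) hR fun w hw => ?_
  have hwb : x + w ∈ ball x R := by simpa [mem_ball, dist_eq_norm] using hw
  have e1 : (∫ s in a..b, g s (x + w)) - (∫ s in a..b, g s x) - A' w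
      = ∫ s in a..b, (g s (x + w) - g s x - fderiv ℂ (g s) x w) := by
    rw [intervalIntegral.integral_sub ((hgi _ hwb).sub (hgi _ hxb)) (hint w),
      intervalIntegral.integral_sub (hgi _ hwb) (hgi _ hxb)]
    rfl
  rw [e1]
  refine (intervalIntegral.norm_integral_le_of_norm_le_const (C := 4 * M / R ^ 2 * ‖w‖ ^ 2)
    fun s hs => ?_).trans (le_of_eq (by ring))
  have hs' := Ioc_subset_Icc_self (huIoc ▸ hs)
  exact norm_taylor_two_le_of_bounded_on_ball hw (hd s hs') (hM s hs')

end Holomorphic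

/-! ### Flat extension by zero -/

section FlatExtension

open Classical in
/-- A function on a real space that, on the half-space `{lam > 0}`, is the restriction of a
holomorphic function of size `lam ^ M` on complex balls of radius comparable to `lam`, extends
by zero to a function of class `C^k` with `k + 2 ≤ M`: by Cauchy's estimate every derivative costs
one power of `lam`. -/
theorem contDiffOn_zero_extension {E : Type} {X : Type*} [NormedAddCommGroup X] [NormedSpace ℝ X]
    [NormedAddCommGroup E] [NormedSpace ℂ E] [FiniteDimensional ℂ E]
    (ι : X →L[ℝ] E) (lam : X →L[ℝ] ℝ) {W : Set X} (hW : IsOpen W) (k : ℕ) :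
    ∀ {F : Type} [NormedAddCommGroup F] [NormedSpace ℂ F] [CompleteSpace F] (P : E → F)
      (M : ℕ) (θ C : ℝ), k + 2 ≤ M → 0 < θ →
      (∀ x ∈ W, 0 < lam x → DifferentiableOn ℂ P (ball (ι x) (θ * lam x)) ∧
        ∀ y ∈ ball (ι x) (θ * lam x), ‖P y‖ ≤ C * lam x ^ M) →
      ContDiffOn ℝ k (fun x => if 0 < lam x then P (ι x) else 0) W := by
  -- at `lam x = 0` the quadratic bound alone gives the zero derivative, so the derivative is the
  -- zero extension of `fderiv ℂ P`
  have main : ∀ {F : Type} [NormedAddCommGroup F] [NormedSpace ℂ F] (P : E → F)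
      (M : ℕ) (θ C : ℝ), 2 ≤ M → 0 < θ →
      (∀ x ∈ W, 0 < lam x → DifferentiableOn ℂ P (ball (ι x) (θ * lam x)) ∧
        ∀ y ∈ ball (ι x) (θ * lam x), ‖P y‖ ≤ C * lam x ^ M) →
      ∀ x ∈ W, HasFDerivAt (fun x => if 0 < lam x then P (ι x) else 0)
        (if 0 < lam x then ((fderiv ℂ P (ι x)).restrictScalars ℝ).comp ι else 0) x := by
    intro F _ _ P M θ C hM hθ hP x hx
    rcases lt_trichotomy (lam x) 0 with h | h | h
    · rw [if_neg h.not_gt]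
      refine (hasFDerivAt_const (0 : F) x).congr_of_eventuallyEq ?_
      filter_upwards [lam.continuous.continuousAt.eventually (gt_mem_nhds h)] with y hy
      rw [if_neg (not_lt.2 (le_of_lt hy))]
    · rw [if_neg h.not_gt]
      have h1 : ∀ᶠ y in 𝓝 x, |lam y| < 1 :=
        lam.continuous.abs.continuousAt.eventually (gt_mem_nhds (by simp [h]))
      have hev : ∀ᶠ y in 𝓝 x, y ∈ W ∧ |lam y| < 1 := (hW.eventually_mem hx).and h1
      obtain ⟨r, hr, hball⟩ := Metric.eventually_nhds_iff_ball.1 hev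
      refine hasFDerivAt_of_norm_sub_le_sq (R := r) (C := |C| * ‖lam‖ ^ 2) hr fun w hw => ?_
      simp only [h, lt_irrefl, if_false, sub_zero, _root_.zero_apply]
      split_ifs with hpos
      · obtain ⟨hyW, hy1⟩ := hball (x + w) (by simpa [mem_ball, dist_eq_norm] using hw)
        have hl : lam (x + w) ≤ ‖lam‖ * ‖w‖ := by
          rw [map_add, h, zero_add]
          exact (le_abs_self _).trans (lam.le_opNorm w)
        have hb := (hP _ hyW hpos).2 (ι (x + w)) (mem_ball_self (by positivity))
        rw [abs_of_pos hpos] at hy1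
        calc ‖P (ι (x + w))‖ ≤ C * lam (x + w) ^ M := hb
          _ ≤ |C| * lam (x + w) ^ 2 := by
            refine mul_le_mul (le_abs_self C) ?_ (by positivity) (abs_nonneg C)
            exact pow_le_pow_of_le_one hpos.le hy1.le hM
          _ ≤ |C| * (‖lam‖ * ‖w‖) ^ 2 := by gcongr
          _ = _ := by ring
      · rw [norm_zero]; positivity
    · rw [if_pos h]
      have hd := ((hP x hx h).1.differentiableAt
        (ball_mem_nhds _ (by positivity))).hasFDerivAt.restrictScalars ℝ
      refine (hd.comp x ι.hasFDerivAt).congr_of_eventuallyEq ?_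
      filter_upwards [lam.continuous.continuousAt.eventually (lt_mem_nhds h)] with y hy
      rw [if_pos hy]
      rfl
  induction k with
  | zero =>
    intro F _ _ _ P M θ C hM hθ hP
    exact contDiffOn_zero.2 fun x hx =>
      (main P M θ C (by omega) hθ hP x hx).continuousAt.continuousWithinAt
  | succ k ih =>
    intro F _ _ _ P M θ C hM hθ hP
    have hder := main P M θ C (by omega) hθ hP
    rw [Nat.cast_succ, contDiffOn_succ_iff_fderiv_of_isOpen hW]
    refine ⟨fun x hx => (hder x hx).differentiableAt.differentiableWithinAt,
      fun h => by simp at h, ?_⟩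
    let T : (E →L[ℂ] F) →L[ℝ] (X →L[ℝ] F) :=
      ((ContinuousLinearMap.compL ℝ X E F).flip ι).comp
        (ContinuousLinearMap.restrictScalarsL ℂ E F ℝ ℝ)
    -- Cauchy's estimate on half the radius: the exponent drops by one
    have key := ih (fderiv ℂ P) (M - 1) (θ / 2) (2 * C / (θ / 2)) (by omega) (half_pos hθ) ?_
    · refine (T.contDiff.comp_contDiffOn key).congr fun x hx => ?_
      rw [(hder x hx).fderiv]
      simp only [Function.comp]
      split_ifs
      · rfl
      · simp
    · intro x hx hl
      obtain ⟨hPd, hPb⟩ := hP x hx hl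
      have hle : θ / 2 * lam x ≤ θ * lam x := by nlinarith
      refine ⟨(DifferentiableOn.fderiv_complex isOpen_ball hPd).mono (ball_subset_ball hle),
        fun y hy => ?_⟩
      have hsub : ball y (θ / 2 * lam x) ⊆ ball (ι x) (θ * lam x) := fun z hz => by
        rw [mem_ball] at *
        linarith [dist_triangle z y (ι x)]
      refine (norm_fderiv_le_of_bounded_on_ball (by positivity) (hPd.mono hsub)
        fun z hz => hPb z (hsub hz)).trans (le_of_eq ?_)
      obtain ⟨m, rfl⟩ : ∃ m, M = m + 1 := ⟨M - 1, by omega⟩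
      rw [Nat.add_sub_cancel, pow_succ]
      field_simp

end FlatExtension

/-! ### Ordinary differential equations -/

section ODE

/-- `γ` solves the autonomous equation `x' = V x` on `[0, T]` and stays in `O`. -/
def IsSolutionOn {E : Type*} [NormedAddCommGroup E] [NormedSpace ℝ E] (V : E → E) (O : Set E)
    (T : ℝ) (γ : ℝ → E) : Prop :=
  ∀ t ∈ Icc 0 T, γ t ∈ O ∧ HasDerivWithinAt γ (V (γ t)) (Icc 0 T) t

/-- `γ` solves the autonomous equation `x' = V x` on `[0, ∞)` and stays in `O`. -/
def IsGlobalSolution {E : Type*} [NormedAddCommGroup E] [NormedSpace ℝ E] (V : E → E) (O : Set E)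
    (γ : ℝ → E) : Prop :=
  ∀ t, 0 ≤ t → γ t ∈ O ∧ HasDerivWithinAt γ (V (γ t)) (Ici 0) t

variable {E : Type*} [NormedAddCommGroup E] [NormedSpace ℝ E] {V : E → E} {O : Set E} {T : ℝ}
  {γ f g : ℝ → E}

theorem IsSolutionOn.continuousOn (h : IsSolutionOn V O T γ) : ContinuousOn γ (Icc 0 T) :=
  fun t ht => (h t ht).2.continuousWithinAt

theorem IsSolutionOn.mono (h : IsSolutionOn V O T γ) {S : ℝ} (hS : S ≤ T) :
    IsSolutionOn V O S γ := fun t ht =>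
  ⟨(h t ⟨ht.1, ht.2.trans hS⟩).1, (h t ⟨ht.1, ht.2.trans hS⟩).2.mono (Icc_subset_Icc_right hS)⟩

theorem IsGlobalSolution.isSolutionOn (h : IsGlobalSolution V O γ) (T : ℝ) :
    IsSolutionOn V O T γ := fun t ht =>
  ⟨(h t ht.1).1, (h t ht.1).2.mono Icc_subset_Ici_self⟩

theorem IsGlobalSolution.shift (h : IsGlobalSolution V O γ) {s : ℝ} (hs : 0 ≤ s) :
    IsGlobalSolution V O (fun t => γ (s + t)) := fun t ht => by
  refine ⟨(h (s + t) (by positivity)).1, ?_⟩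
  have h1 := (h (s + t) (by positivity)).2
  have h2 : HasDerivWithinAt (fun t => s + t) 1 (Ici 0) t :=
    ((hasDerivAt_id t).const_add s).hasDerivWithinAt
  simpa [Function.comp_def] using h1.scomp t h2
    (fun u (hu : 0 ≤ u) => show (0 : ℝ) ≤ s + u by positivity)

/-- Uniqueness for `x' = θ(t) V(x)` with `V` of class `C^1` on an open set. -/
theorem eqOn_of_hasDerivWithinAt_smul (hO : IsOpen O) (hV : ContDiffOn ℝ 1 V O) {θ : ℝ → ℝ}
    (hθ : ContinuousOn θ (Icc 0 T))
    (hf : ∀ t ∈ Icc 0 T, f t ∈ O ∧ HasDerivWithinAt f (θ t • V (f t)) (Icc 0 T) t)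
    (hg : ∀ t ∈ Icc 0 T, g t ∈ O ∧ HasDerivWithinAt g (θ t • V (g t)) (Icc 0 T) t)
    (h0 : f 0 = g 0) : EqOn f g (Icc 0 T) := by
  have hfc : ContinuousOn f (Icc 0 T) := fun t ht => (hf t ht).2.continuousWithinAt
  have hgc : ContinuousOn g (Icc 0 T) := fun t ht => (hg t ht).2.continuousWithinAt
  set K := f '' Icc 0 T ∪ g '' Icc 0 T with hK
  have hKc : IsCompact K := (isCompact_Icc.image_of_continuousOn hfc).union
    (isCompact_Icc.image_of_continuousOn hgc)
  have hKO : K ⊆ O := by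
    rintro _ (⟨t, ht, rfl⟩ | ⟨t, ht, rfl⟩)
    exacts [(hf t ht).1, (hg t ht).1]
  have hloc : LocallyLipschitzOn K V := fun x hx => by
    obtain ⟨L, t, ht, hL⟩ :=
      (hV.contDiffAt (hO.mem_nhds (hKO hx))).exists_lipschitzOnWith
    exact ⟨L, t, mem_nhdsWithin_of_mem_nhds ht, hL⟩
  obtain ⟨L, hL⟩ := hloc.exists_lipschitzOnWith_of_compact hKc
  obtain ⟨B, hB⟩ := isCompact_Icc.exists_bound_of_continuousOn hθ
  have hlip : ∀ t ∈ Ico 0 T, LipschitzOnWith (Real.toNNReal B * L) (fun x => θ t • V x) K := by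
    intro t ht
    have hBt := hB t (Ico_subset_Icc_self ht)
    refine LipschitzOnWith.of_dist_le_mul fun x hx y hy => ?_
    rw [dist_smul₀]
    have h1 := hL.dist_le_mul x hx y hy
    have hB0 : 0 ≤ B := (norm_nonneg _).trans hBt
    rw [NNReal.coe_mul, Real.coe_toNNReal B hB0, mul_assoc]
    exact mul_le_mul hBt h1 dist_nonneg hB0
  refine ODE_solution_unique_of_mem_Icc_right (v := fun t x => θ t • V x) (s := fun _ => K) hlip
    hfc ?_ ?_ hgc ?_ ?_ h0
  · exact fun t ht => (hf t (Ico_subset_Icc_self ht)).2.mono_of_mem_nhdsWithin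
      (Icc_mem_nhdsGE_of_mem ht)
  · exact fun t ht => Or.inl ⟨t, Ico_subset_Icc_self ht, rfl⟩
  · exact fun t ht => (hg t (Ico_subset_Icc_self ht)).2.mono_of_mem_nhdsWithin
      (Icc_mem_nhdsGE_of_mem ht)
  · exact fun t ht => Or.inr ⟨t, Ico_subset_Icc_self ht, rfl⟩

theorem IsSolutionOn.eqOn (hO : IsOpen O) (hV : ContDiffOn ℝ 1 V O) (hf : IsSolutionOn V O T f)
    (hg : IsSolutionOn V O T g) (h0 : f 0 = g 0) : EqOn f g (Icc 0 T) :=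
  eqOn_of_hasDerivWithinAt_smul hO hV (θ := fun _ => 1) continuousOn_const
    (fun t ht => by simpa using hf t ht) (fun t ht => by simpa using hg t ht) h0

/-- The Picard–Lindelöf theorem on a closed ball, with the solution staying in the ball. -/
theorem exists_solution_mem_closedBall [CompleteSpace E] {x : E} {R M ε : ℝ} {L : NNReal}
    (hε : 0 ≤ ε) (hR : 0 ≤ R) (hL : LipschitzOnWith L V (closedBall x R))
    (hM : ∀ y ∈ closedBall x R, ‖V y‖ ≤ M) (hMε : M * ε ≤ R) :
    ∃ γ : ℝ → E, γ 0 = x ∧ IsSolutionOn V (closedBall x R) ε γ := by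
  have hM0 : 0 ≤ M := (norm_nonneg _).trans (hM x (mem_closedBall_self hR))
  lift R to NNReal using hR
  lift M to NNReal using hM0
  obtain ⟨t₀, ht₀⟩ : ∃ t₀ : Icc (0 : ℝ) ε, (t₀ : ℝ) = 0 := ⟨⟨0, le_rfl, hε⟩, rfl⟩
  have hpl : IsPicardLindelof (fun _ => V) t₀ x R 0 M L :=
    IsPicardLindelof.of_time_independent hM hL (by
      rw [ht₀, sub_zero, sub_self, max_eq_left hε]
      simpa using hMε)
  have hx : x ∈ closedBall x ((0 : NNReal) : ℝ) := by simp
  obtain ⟨α, hα⟩ := ODE.FunSpace.exists_isFixedPt_next hpl hx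
  refine ⟨α.compProj, ?_, fun t ht => ⟨?_, ?_⟩⟩
  · have h1 : α.compProj t₀ = x := by
      rw [ODE.FunSpace.compProj_val, ← hα, ODE.FunSpace.next_apply₀]
    rwa [ht₀] at h1
  · exact α.compProj_mem_closedBall hpl.mul_max_le
  · apply ODE.hasDerivWithinAt_picard_Icc t₀.2
      hpl.continuousOn_uncurry α.continuous_compProj.continuousOn
      (fun _ _ => α.compProj_mem_closedBall hpl.mul_max_le) x ht |>.congr_of_mem _ ht
    intro t' ht'
    nth_rw 1 [← hα]
    rw [ODE.FunSpace.compProj_of_mem ht', ODE.FunSpace.next_apply]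

/-- Concatenation of two solutions. -/
theorem IsSolutionOn.concat {τ ε : ℝ} (hτ : 0 ≤ τ) (hε : 0 ≤ ε) (hf : IsSolutionOn V O τ f)
    (hg : IsSolutionOn V O ε g) (h0 : g 0 = f τ) :
    IsSolutionOn V O (τ + ε) (fun t => if t ≤ τ then f t else g (t - τ)) := by
  set γ : ℝ → E := fun t => if t ≤ τ then f t else g (t - τ) with hγ
  have e1 : ∀ t ∈ Icc 0 τ, γ t = f t := fun t ht => if_pos ht.2
  have e2 : ∀ t ∈ Icc τ (τ + ε), γ t = g (t - τ) := fun t ht => by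
    rcases ht.1.eq_or_lt with h | h
    · subst h; simp [hγ, h0]
    · exact if_neg h.not_ge
  have d1 : ∀ t ∈ Icc 0 τ, γ t ∈ O ∧ HasDerivWithinAt γ (V (γ t)) (Icc 0 τ) t := fun t ht => by
    rw [e1 t ht]
    exact ⟨(hf t ht).1, (hf t ht).2.congr_of_mem e1 ht⟩
  have d2 : ∀ t ∈ Icc τ (τ + ε), γ t ∈ O ∧ HasDerivWithinAt γ (V (γ t)) (Icc τ (τ + ε)) t := by
    intro t ht
    rw [e2 t ht]
    have ht' : t - τ ∈ Icc 0 ε := ⟨by linarith [ht.1], by linarith [ht.2]⟩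
    refine ⟨(hg _ ht').1, HasDerivWithinAt.congr_of_mem ?_ e2 ht⟩
    have h2 : HasDerivWithinAt (fun t => t - τ) 1 (Icc τ (τ + ε)) t :=
      ((hasDerivAt_id t).sub_const τ).hasDerivWithinAt
    simpa [Function.comp_def] using (hg _ ht').2.scomp t h2
      (fun u hu => show u - τ ∈ Icc 0 ε from ⟨by linarith [hu.1], by linarith [hu.2]⟩)
  intro t ht
  rcases lt_trichotomy t τ with h | h | h
  · have hm : t ∈ Icc 0 τ := ⟨ht.1, h.le⟩
    refine ⟨(d1 t hm).1, (d1 t hm).2.mono_of_mem_nhdsWithin ?_⟩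
    have : Iic τ ∈ 𝓝 t := Iic_mem_nhds h
    filter_upwards [self_mem_nhdsWithin, mem_nhdsWithin_of_mem_nhds this] with u hu hu'
    exact ⟨hu.1, hu'⟩
  · subst h
    have hm : t ∈ Icc 0 t := ⟨ht.1, le_rfl⟩
    have hm' : t ∈ Icc t (t + ε) := ⟨le_rfl, by linarith⟩
    refine ⟨(d1 t hm).1, ?_⟩
    have := (d1 t hm).2.union (d2 t hm').2
    rwa [Icc_union_Icc_eq_Icc hτ (by linarith)] at this
  · have hm : t ∈ Icc τ (τ + ε) := ⟨h.le, ht.2⟩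
    refine ⟨(d2 t hm).1, (d2 t hm).2.mono_of_mem_nhdsWithin ?_⟩
    have : Ici τ ∈ 𝓝 t := Ici_mem_nhds h
    filter_upwards [self_mem_nhdsWithin, mem_nhdsWithin_of_mem_nhds this] with u hu hu'
    exact ⟨hu', hu.2⟩

/-- A solution confined a priori to compact subsets of the domain on bounded time intervals
exists for all time. -/
theorem exists_isGlobalSolution [ProperSpace E] [CompleteSpace E] (hO : IsOpen O)
    (hV : ContDiffOn ℝ 1 V O) {p : E} (hp : p ∈ O)
    (hK : ∀ T : ℝ, 0 ≤ T → ∃ K ⊆ O, IsCompact K ∧ ∀ τ ∈ Icc 0 T, ∀ γ : ℝ → E, γ 0 = p →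
      IsSolutionOn V O τ γ → γ τ ∈ K) :
    ∃ γ : ℝ → E, γ 0 = p ∧ IsGlobalSolution V O γ := by
  have hfin : ∀ T : ℝ, 0 ≤ T → ∃ γ : ℝ → E, γ 0 = p ∧ IsSolutionOn V O T γ := by
    intro T hT
    obtain ⟨K, hKO, hKc, hap⟩ := hK T hT
    obtain ⟨R, hR, hthick⟩ := hKc.exists_cthickening_subset_open hO hKO
    obtain ⟨M, hM⟩ := (hKc.cthickening (r := R)).exists_bound_of_continuousOn
      (hV.continuousOn.mono hthick)
    set ε := R / (|M| + 1) with hε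
    have hεpos : 0 < ε := by positivity
    have hstep : ∀ x ∈ K, ∃ γ : ℝ → E, γ 0 = x ∧ IsSolutionOn V O ε γ := by
      intro x hx
      have hsub : closedBall x R ⊆ cthickening R K := closedBall_subset_cthickening hx R
      obtain ⟨L, hL⟩ := (hV.mono (hsub.trans hthick)).exists_lipschitzOnWith one_ne_zero
        (convex_closedBall x R) (isCompact_closedBall x R)
      obtain ⟨γ, h0, hγ⟩ := exists_solution_mem_closedBall hεpos.le hR.le hL
        (fun y hy => (hM y (hsub hy)).trans (le_abs_self M)) (by
          rw [hε, mul_div_assoc', div_le_iff₀ (by positivity)]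
          nlinarith [abs_nonneg M])
      exact ⟨γ, h0, fun t ht => ⟨hthick (hsub (hγ t ht).1), (hγ t ht).2⟩⟩
    -- the time step `ε` is uniform over `K`, so `T` is reached after finitely many steps
    have hind : ∀ n : ℕ, ∃ γ : ℝ → E, γ 0 = p ∧ IsSolutionOn V O (min (n * ε) T) γ := by
      intro n
      induction n with
      | zero =>
        refine ⟨fun t => p + t • V p, by simp, fun t ht => ?_⟩
        simp only [Nat.cast_zero, zero_mul, min_eq_left hT] at ht
        obtain rfl : t = 0 := le_antisymm ht.2 ht.1
        simp only [zero_smul, add_zero]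
        refine ⟨hp, HasDerivAt.hasDerivWithinAt ?_⟩
        simpa using ((hasDerivAt_id (0 : ℝ)).smul_const (V p)).const_add p
      | succ n ih =>
        obtain ⟨γ, h0, hγ⟩ := ih
        rcases le_total T (n * ε) with h | h
        · refine ⟨γ, h0, ?_⟩
          rw [min_eq_right h] at hγ
          exact hγ.mono (min_le_right _ _)
        · rw [min_eq_left h] at hγ
          have hn : 0 ≤ n * ε := by positivity
          obtain ⟨γ', h0', hγ'⟩ := hstep _ (hap _ ⟨hn, h⟩ γ h0 hγ)
          refine ⟨_, ?_, (hγ.concat hn hεpos.le hγ' h0').mono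
            ((min_le_left _ _).trans (le_of_eq (by push_cast; ring)))⟩
          simpa [hn] using h0
    obtain ⟨n, hn⟩ := exists_nat_ge (T / ε)
    obtain ⟨γ, h0, hγ⟩ := hind n
    rw [min_eq_right ((div_le_iff₀ hεpos).1 hn)] at hγ
    exact ⟨γ, h0, hγ⟩
  choose γ h0 hγ using fun n : ℕ => hfin (n : ℝ) n.cast_nonneg
  have hcons : ∀ m n : ℕ, ∀ t : ℝ, 0 ≤ t → t ≤ m → t ≤ n → γ m t = γ n t := by
    intro m n t ht hm hn
    exact ((hγ m).mono hm).eqOn hO hV ((hγ n).mono hn) ((h0 m).trans (h0 n).symm) ⟨ht, le_rfl⟩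
  -- the solutions on `[0, n]` are consistent and glue to a global one
  refine ⟨fun t => γ ⌈t⌉₊ t, by simpa using h0 0, fun t ht => ?_⟩
  set m := ⌈t⌉₊ + 1 with hm
  have htm : t < m := by
    rw [hm]; push_cast; linarith [Nat.le_ceil t]
  have heq : ∀ u ∈ Icc (0 : ℝ) m, γ ⌈u⌉₊ u = γ m u := fun u hu =>
    hcons _ _ u hu.1 (Nat.le_ceil u) hu.2
  have hmem : t ∈ Icc (0 : ℝ) m := ⟨ht, htm.le⟩
  have hd := (hγ m t hmem)
  simp only [heq t hmem]
  have hd' : HasDerivWithinAt (fun t => γ ⌈t⌉₊ t) (V (γ m t)) (Icc 0 (m : ℝ)) t :=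
    hd.2.congr_of_mem heq hmem
  refine ⟨hd.1, hd'.mono_of_mem_nhdsWithin ?_⟩
  filter_upwards [self_mem_nhdsWithin, mem_nhdsWithin_of_mem_nhds (Iic_mem_nhds htm)] with u hu hu'
  exact ⟨hu, hu'⟩

end ODE

/-! ### Holomorphic dependence on initial values -/

section HolomorphicFlow

variable {E : Type} [NormedAddCommGroup E] [NormedSpace ℂ E] {V : E → E} {O : Set E}

/-- The Picard iterates of `x' = V x`, as functions of the initial value and of time. -/
def picardIterate (V : E → E) : ℕ → E → ℝ → E
  | 0, x, _ => x
  | n + 1, x, s => x + ∫ σ in (0 : ℝ)..s, V (picardIterate V n x σ)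

/-- Short-time solutions depend holomorphically on the initial value, as uniform limits of the
Picard iterates. -/
theorem differentiableAt_shortTime_solution [CompleteSpace E] {x₀ : E} {R M ε : ℝ}
    (hR : 0 < R) (hV : DifferentiableOn ℂ V (ball x₀ R)) (hM : ∀ y ∈ ball x₀ R, ‖V y‖ ≤ M)
    (hMε : M * ε ≤ R / 8) {Φ : E → ℝ → E} (h0 : ∀ x ∈ ball x₀ (R / 4), Φ x 0 = x)
    (hΦ : ∀ x ∈ ball x₀ (R / 4), IsSolutionOn V (ball x₀ (R / 2)) ε (Φ x))
    {s : ℝ} (hs : s ∈ Icc 0 ε) : DifferentiableAt ℂ (fun x => Φ x s) x₀ := by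
  have hM0 : 0 ≤ M := (norm_nonneg _).trans (hM x₀ (mem_ball_self hR))
  have hsub : ball x₀ (R / 2) ⊆ ball x₀ R := ball_subset_ball (by linarith)
  have hVc : ContinuousOn V (ball x₀ (R / 2)) := hV.continuousOn.mono hsub
  set X := picardIterate V with hX
  have hXval : ∀ n, ∀ x ∈ ball x₀ (R / 4), (∀ σ ∈ Icc 0 ε, X n x σ ∈ ball x₀ (R / 2)) ∧
      ContinuousOn (X n x) (Icc 0 ε) := by
    intro n
    induction n with
    | zero =>
      intro x hx
      exact ⟨fun σ _ => ball_subset_ball (by linarith) hx, continuousOn_const⟩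
    | succ n ih =>
      intro x hx
      obtain ⟨hm, hc⟩ := ih x hx
      have hcV : ContinuousOn (fun σ => V (X n x σ)) (Icc 0 ε) := hVc.comp hc hm
      refine ⟨fun σ hσ => ?_, ?_⟩
      · have hb : ‖∫ u in (0 : ℝ)..σ, V (X n x u)‖ ≤ M * |σ - 0| :=
          intervalIntegral.norm_integral_le_of_norm_le_const fun u hu => by
            rw [uIoc_of_le hσ.1] at hu
            exact hM _ (hsub (hm u ⟨hu.1.le, hu.2.trans hσ.2⟩))
        rw [sub_zero, abs_of_nonneg hσ.1] at hb
        have : M * σ ≤ M * ε := mul_le_mul_of_nonneg_left hσ.2 hM0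
        rw [mem_ball, dist_eq_norm] at *
        calc ‖X (n + 1) x σ - x₀‖ = ‖(x - x₀) + ∫ u in (0 : ℝ)..σ, V (X n x u)‖ := by
              congr 1; simp only [hX, picardIterate]; abel
          _ ≤ ‖x - x₀‖ + ‖∫ u in (0 : ℝ)..σ, V (X n x u)‖ := norm_add_le _ _
          _ < R / 2 := by linarith
      · rcases le_or_gt 0 ε with hε | hε
        · have := intervalIntegral.continuousOn_primitive_interval (μ := volume) (a := 0) (b := ε)
            (f := fun σ => V (X n x σ)) (by
              rw [uIcc_of_le hε]; exact hcV.integrableOn_Icc)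
          rw [uIcc_of_le hε] at this
          exact continuousOn_const.add this
        · rw [Icc_eq_empty hε.not_ge]; exact continuousOn_empty _
  have hXd : ∀ n, ∀ σ ∈ Icc 0 ε, DifferentiableOn ℂ (fun x => X n x σ) (ball x₀ (R / 4)) := by
    intro n
    induction n with
    | zero => exact fun σ _ => differentiableOn_id
    | succ n ih =>
      intro σ hσ x hx
      obtain ⟨r, hr, hball⟩ := Metric.isOpen_iff.1 isOpen_ball x hx
      refine DifferentiableAt.differentiableWithinAt ?_
      have hσs : Icc 0 σ ⊆ Icc 0 ε := Icc_subset_Icc_right hσ.2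
      have := differentiableAt_intervalIntegral (g := fun u y => V (X n y u)) hσ.1 (x := x)
        (M := M) hr
        (fun u hu => hV.comp ((ih u (hσs hu)).mono hball)
          (fun y hy => hsub ((hXval n y (hball hy)).1 u (hσs hu))))
        (fun u hu y hy => hM _ (hsub ((hXval n y (hball hy)).1 u (hσs hu))))
        (fun y hy => (hVc.comp (hXval n y (hball hy)).2 (hXval n y (hball hy)).1).mono hσs)
      exact differentiableAt_id.add this
  have hlip : LipschitzOnWith (Real.toNNReal (4 * M / R)) V (ball x₀ (R / 2)) := by
    refine (convex_ball x₀ (R / 2)).lipschitzOnWith_of_nnnorm_fderiv_le (𝕜 := ℂ)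
      (fun y hy => hV.differentiableAt (isOpen_ball.mem_nhds (hsub hy))) fun y hy => ?_
    rw [← NNReal.coe_le_coe, coe_nnnorm, Real.coe_toNNReal _ (by positivity)]
    have hb : ball y (R / 2) ⊆ ball x₀ R := fun z hz => by
      rw [mem_ball] at *
      linarith [dist_triangle z y x₀]
    refine (norm_fderiv_le_of_bounded_on_ball (half_pos hR) (hV.mono hb)
      (fun z hz => hM z (hb hz))).trans (le_of_eq ?_)
    field_simp
    ring
  -- the smallness of `ε` makes the Picard operator a contraction by the factor `1 / 2`
  have hconv : ∀ n, ∀ x ∈ ball x₀ (R / 4), ∀ σ ∈ Icc 0 ε, ‖X n x σ - Φ x σ‖ ≤ R * (1 / 2) ^ n := by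
    intro n
    induction n with
    | zero =>
      intro x hx σ hσ
      have h1 := (hXval 0 x hx).1 σ hσ
      have h2 := (hΦ x hx σ hσ).1
      rw [mem_ball] at h1 h2
      rw [← dist_eq_norm, pow_zero, mul_one]
      linarith [dist_triangle_right (X 0 x σ) (Φ x σ) x₀]
    | succ n ih =>
      intro x hx σ hσ
      have hσs : Icc 0 σ ⊆ Icc 0 ε := Icc_subset_Icc_right hσ.2
      have hsol := (hΦ x hx).mono hσ.2
      have hcΦ : ContinuousOn (fun u => V (Φ x u)) (Icc 0 σ) :=
        hVc.comp hsol.continuousOn fun u hu => (hsol u hu).1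
      have hcX : ContinuousOn (fun u => V (X n x u)) (Icc 0 σ) :=
        (hVc.comp (hXval n x hx).2 (hXval n x hx).1).mono hσs
      have hFTC : ∫ u in (0 : ℝ)..σ, V (Φ x u) = Φ x σ - Φ x 0 := by
        refine intervalIntegral.integral_eq_sub_of_hasDerivAt_of_le hσ.1 hsol.continuousOn
          (fun u hu => ?_) (hcΦ.intervalIntegrable_of_Icc hσ.1)
        exact (hsol u (Ioo_subset_Icc_self hu)).2.hasDerivAt (Icc_mem_nhds hu.1 hu.2)
      have e1 : X (n + 1) x σ - Φ x σ = ∫ u in (0 : ℝ)..σ, (V (X n x u) - V (Φ x u)) := by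
        rw [intervalIntegral.integral_sub (hcX.intervalIntegrable_of_Icc hσ.1)
          (hcΦ.intervalIntegrable_of_Icc hσ.1), hFTC, h0 x hx]
        simp only [hX, picardIterate]
        abel
      rw [e1]
      refine (intervalIntegral.norm_integral_le_of_norm_le_const
        (C := 4 * M / R * (R * (1 / 2) ^ n)) fun u hu => ?_).trans ?_
      · rw [uIoc_of_le hσ.1] at hu
        have hu' : u ∈ Icc 0 ε := ⟨hu.1.le, hu.2.trans hσ.2⟩
        have := hlip.dist_le_mul _ ((hXval n x hx).1 u hu') _ (hΦ x hx u hu').1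
        rw [Real.coe_toNNReal _ (by positivity), dist_eq_norm, dist_eq_norm] at this
        exact this.trans (mul_le_mul_of_nonneg_left (ih x hx u hu') (by positivity))
      · rw [sub_zero, abs_of_nonneg hσ.1]
        have hMσ : M * σ ≤ R / 8 := (mul_le_mul_of_nonneg_left hσ.2 hM0).trans hMε
        calc 4 * M / R * (R * (1 / 2) ^ n) * σ = (4 * (M * σ)) * (1 / 2) ^ n := by field_simp
          _ ≤ (4 * (R / 8)) * (1 / 2) ^ n := by gcongr
          _ = R * (1 / 2) ^ (n + 1) := by ring
  refine differentiableAt_of_norm_sub_le (R := R / 4) (by positivity) (f := fun n x => X n x s)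
    (u := fun n => R * (1 / 2) ^ n) ?_ (fun n => hXd n s hs) (fun n x hx => hconv n x hx s hs)
  simpa using (tendsto_pow_atTop_nhds_zero_of_lt_one (r := (1 / 2 : ℝ)) (by norm_num)
    (by norm_num)).const_mul R

/-- The flow of a holomorphic vector field is holomorphic in the initial value. -/
theorem differentiableOn_flow [FiniteDimensional ℂ E] (hO : IsOpen O)
    (hV : DifferentiableOn ℂ V O) {D : Set E} (hD : IsOpen D) {ψ : E → ℝ → E}
    (h0 : ∀ p ∈ D, ψ p 0 = p) (hψ : ∀ p ∈ D, IsGlobalSolution V O (ψ p)) {T : ℝ} (hT : 0 ≤ T) :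
    DifferentiableOn ℂ (fun p => ψ p T) D := by
  intro p₀ hp₀
  refine DifferentiableAt.differentiableWithinAt ?_
  have : CompleteSpace E := FiniteDimensional.complete ℂ E
  have : ProperSpace E := FiniteDimensional.proper ℂ E
  have hV1 : ContDiffOn ℝ 1 V O :=
    ((DifferentiableOn.contDiffOn_complex hO hV 1).restrict_scalars ℝ)
  set K := ψ p₀ '' Icc 0 T
  have hKc : IsCompact K :=
    isCompact_Icc.image_of_continuousOn ((hψ p₀ hp₀).isSolutionOn T).continuousOn
  have hKO : K ⊆ O := by
    rintro _ ⟨t, ht, rfl⟩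
    exact ((hψ p₀ hp₀) t ht.1).1
  obtain ⟨R, hR, hthick⟩ := hKc.exists_cthickening_subset_open hO hKO
  obtain ⟨M, hM⟩ := (hKc.cthickening (r := R)).exists_bound_of_continuousOn
    (hV.continuousOn.mono hthick)
  set ε := R / (8 * (|M| + 1)) with hε
  have hεpos : 0 < ε := by positivity
  have hMε : |M| * ε ≤ R / 8 := by
    rw [hε, mul_div_assoc', div_le_div_iff₀ (by positivity) (by norm_num)]
    nlinarith [abs_nonneg M]
  -- by the semigroup property the time `T` map is a composition of maps over times at most `ε`
  have hind : ∀ n : ℕ, ∀ t ∈ Icc 0 T, t ≤ n * ε → DifferentiableAt ℂ (fun p => ψ p t) p₀ := by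
    intro n
    induction n with
    | zero =>
      intro t ht htn
      obtain rfl : t = 0 := le_antisymm (by simpa using htn) ht.1
      refine differentiableAt_id.congr_of_eventuallyEq ?_
      filter_upwards [hD.mem_nhds hp₀] with p hp using h0 p hp
    | succ n ih =>
      intro t ht htn
      set s := min t ε with hs
      set t' := t - s with ht'
      have hs0 : 0 ≤ s := le_min ht.1 hεpos.le
      have ht'0 : 0 ≤ t' := sub_nonneg.2 (min_le_left _ _)
      have ht'T : t' ≤ T := (sub_le_self _ hs0).trans ht.2
      have ht'n : t' ≤ n * ε := by
        rcases le_total t ε with h | h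
        · rw [ht', hs, min_eq_left h, sub_self]; positivity
        · rw [ht', hs, min_eq_right h]; push_cast at htn; linarith
      have hd := ih t' ⟨ht'0, ht'T⟩ ht'n
      set x₀ := ψ p₀ t' with hx₀
      have hx₀K : x₀ ∈ K := ⟨t', ⟨ht'0, ht'T⟩, rfl⟩
      have hsub : ball x₀ R ⊆ cthickening R K :=
        ball_subset_closedBall.trans (closedBall_subset_cthickening hx₀K R)
      have hMb : ∀ y ∈ ball x₀ R, ‖V y‖ ≤ |M| := fun y hy =>
        (hM y (hsub hy)).trans (le_abs_self M)
      have hloc : ∀ x ∈ ball x₀ (R / 4), ∃ γ : ℝ → E, γ 0 = x ∧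
          IsSolutionOn V (ball x₀ (R / 2)) ε γ := by
        intro x hx
        have hsub2 : closedBall x (R / 8) ⊆ ball x₀ (R / 2) := fun y hy => by
          rw [mem_ball, mem_closedBall] at *
          linarith [dist_triangle y x x₀]
        have hsub3 : closedBall x (R / 8) ⊆ ball x₀ R :=
          hsub2.trans (ball_subset_ball (by linarith))
        obtain ⟨L, hL⟩ := (hV1.mono ((hsub3.trans hsub).trans hthick)).exists_lipschitzOnWith
          one_ne_zero (convex_closedBall x _) (isCompact_closedBall x _)
        obtain ⟨γ, hγ0, hγ⟩ := exists_solution_mem_closedBall hεpos.le (by positivity) hL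
          (fun y hy => hMb y (hsub3 hy)) hMε
        exact ⟨γ, hγ0, fun u hu => ⟨hsub2 (hγ u hu).1, (hγ u hu).2⟩⟩
      choose! Φ hΦ0 hΦ using hloc
      have hshort := differentiableAt_shortTime_solution hR
        (hV.mono (hsub.trans hthick)) hMb hMε hΦ0 hΦ (s := s) ⟨hs0, min_le_right _ _⟩
      have hcomp : DifferentiableAt ℂ (fun p => Φ (ψ p t') s) p₀ :=
        DifferentiableAt.comp (g := fun x => Φ x s) p₀ hshort hd
      refine hcomp.congr_of_eventuallyEq ?_
      filter_upwards [hD.mem_nhds hp₀,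
        hd.continuousAt.preimage_mem_nhds (ball_mem_nhds x₀ (by positivity : 0 < R / 4))]
        with p hp hpb
      have h1 := ((hψ p hp).shift ht'0).isSolutionOn s
      have h2 : IsSolutionOn V O s (Φ (ψ p t')) := fun u hu =>
        ⟨hthick (hsub (ball_subset_ball (by linarith)
          (((hΦ _ hpb).mono (min_le_right t ε)) u hu).1)),
          (((hΦ _ hpb).mono (min_le_right t ε)) u hu).2⟩
      have := h1.eqOn hO hV1 h2 (by simp [hΦ0 _ hpb]) ⟨hs0, le_rfl⟩
      simpa [ht'] using this
  obtain ⟨n, hn⟩ := exists_nat_ge (T / ε)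
  exact hind n T ⟨hT, le_rfl⟩ ((div_le_iff₀ hεpos).1 hn)

end HolomorphicFlow

/-! ### The real flow and the limiting Hamiltonian -/

section RealFlow

variable {δ : ℝ}

theorem contDiffOn_vectorField (δ : ℝ) (n : ℕ) :
    ContDiffOn ℝ n (vectorField δ) {p | 0 < p.1} := by
  have h : ∀ p ∈ {p : Space | 0 < p.1}, p.1 ^ 3 ≠ 0 := fun p hp => pow_ne_zero _ (ne_of_gt hp)
  unfold vectorField
  refine ContDiffOn.prodMk (by fun_prop) (ContDiffOn.prodMk ?_ (by fun_prop))
  exact ((ContDiffOn.div (by fun_prop) (by fun_prop) h).neg).sub (by fun_prop)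

theorem isOpen_fst_pos : IsOpen {p : Space | 0 < p.1} := isOpen_lt continuous_const continuous_fst

/-- The three scalar equations contained in `γ' = vectorField δ γ`. -/
theorem hasDerivWithinAt_components {γ : ℝ → Space} {S : Set ℝ} {t : ℝ}
    (h : HasDerivWithinAt γ (vectorField δ (γ t)) S t) :
    HasDerivWithinAt (fun t => (γ t).1) ((γ t).2.1 + 2 * δ * (γ t).1 * (γ t).2.2 ^ 3) S t ∧
    HasDerivWithinAt (fun t => (γ t).2.1)
      (-(((γ t).1 - 1) / (γ t).1 ^ 3) - 2 * δ * (γ t).2.1 * (γ t).2.2 ^ 3) S t ∧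
    HasDerivWithinAt (fun t => (γ t).2.2) (-δ * (γ t).2.2 ^ 4) S t := by
  refine ⟨?_, ?_, ?_⟩
  · exact (ContinuousLinearMap.fst ℝ ℝ (ℝ × ℝ)).hasFDerivAt.comp_hasDerivWithinAt t h
  · exact ((ContinuousLinearMap.fst ℝ ℝ ℝ).comp
      (ContinuousLinearMap.snd ℝ ℝ (ℝ × ℝ))).hasFDerivAt.comp_hasDerivWithinAt t h
  · exact ((ContinuousLinearMap.snd ℝ ℝ ℝ).comp
      (ContinuousLinearMap.snd ℝ ℝ (ℝ × ℝ))).hasFDerivAt.comp_hasDerivWithinAt t h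

/-- Explicit solution of the equation `l' = -δ l⁴` for the angular momentum. -/
theorem angularMomentum_eq (hδ : 0 < δ) {T l₀ : ℝ} {l : ℝ → ℝ} (hl₀ : 0 < l₀)
    (hl : ∀ t ∈ Icc 0 T, HasDerivWithinAt l (-δ * l t ^ 4) (Icc 0 T) t) (h0 : l 0 = l₀) :
    ∀ t ∈ Icc 0 T, l t = (1 / l₀ ^ 3 + 3 * δ * t) ^ (-(1 / 3) : ℝ) := by
  have hV : ContDiffOn ℝ 1 (fun x : ℝ => -δ * x ^ 4) univ := by fun_prop
  have hpos : ∀ t ∈ Icc 0 T, 0 < 1 / l₀ ^ 3 + 3 * δ * t := fun t ht => by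
    have := ht.1
    positivity
  refine IsSolutionOn.eqOn isOpen_univ hV (fun t ht => ⟨mem_univ _, hl t ht⟩)
    (fun t ht => ⟨mem_univ _, ?_⟩) ?_
  · have h1 : HasDerivAt (fun t => 1 / l₀ ^ 3 + 3 * δ * t) (3 * δ) t := by
      simpa using ((hasDerivAt_id t).const_mul (3 * δ)).const_add (1 / l₀ ^ 3)
    have h2 := (h1.rpow_const (p := (-(1 / 3) : ℝ)) (Or.inl (hpos t ht).ne')).hasDerivWithinAt
      (s := Icc 0 T)
    refine h2.congr_deriv ?_
    rw [← Real.rpow_natCast ((1 / l₀ ^ 3 + 3 * δ * t) ^ (-(1 / 3) : ℝ)) 4,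
      ← Real.rpow_mul (hpos t ht).le,
      show (-(1 / 3) - 1 : ℝ) = -(1 / 3) * ((4 : ℕ) : ℝ) by norm_num]
    ring
  · rw [h0, mul_zero, add_zero, one_div, Real.inv_rpow (by positivity), ← Real.rpow_natCast,
      ← Real.rpow_mul hl₀.le]
    norm_num
    rw [Real.rpow_neg_one, inv_inv]

theorem angularMomentum_eq_zero {T : ℝ} {l : ℝ → ℝ}
    (hl : ∀ t ∈ Icc 0 T, HasDerivWithinAt l (-δ * l t ^ 4) (Icc 0 T) t) (h0 : l 0 = 0) :
    ∀ t ∈ Icc 0 T, l t = 0 := by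
  have hV : ContDiffOn ℝ 1 (fun x : ℝ => -δ * x ^ 4) univ := by fun_prop
  refine IsSolutionOn.eqOn (g := fun _ => 0) isOpen_univ hV (fun t ht => ⟨mem_univ _, hl t ht⟩)
    (fun t ht => ⟨mem_univ _, ?_⟩) h0
  simpa using hasDerivWithinAt_const t (Icc 0 T) (0 : ℝ)

theorem angularMomentum_bounds (hδ : 0 < δ) {T l₀ : ℝ} {l : ℝ → ℝ} (hl₀ : 0 ≤ l₀)
    (hl : ∀ t ∈ Icc 0 T, HasDerivWithinAt l (-δ * l t ^ 4) (Icc 0 T) t) (h0 : l 0 = l₀) :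
    ∀ t ∈ Icc 0 T, 0 ≤ l t ∧ l t ≤ l₀ := by
  intro t ht
  rcases hl₀.eq_or_lt with rfl | hl₀
  · rw [angularMomentum_eq_zero hl h0 t ht]
    exact ⟨le_rfl, le_rfl⟩
  · have hanti : AntitoneOn l (Icc 0 T) := by
      refine antitoneOn_of_hasDerivWithinAt_nonpos (convex_Icc 0 T)
        (fun t ht => (hl t ht).continuousWithinAt) (f' := fun t => -δ * l t ^ 4)
        (fun t ht => (hl t (interior_subset ht)).mono interior_subset) fun t _ => ?_
      have : 0 ≤ δ * l t ^ 4 := by positivity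
      linarith
    have hT : 0 ≤ T := ht.1.trans ht.2
    refine ⟨?_, (hanti ⟨le_rfl, hT⟩ ht ht.1).trans h0.le⟩
    rw [angularMomentum_eq hδ hl₀ hl h0 t ht]
    have := ht.1
    positivity

/-- The derivative of the limiting Hamiltonian along solutions. -/
theorem hasDerivWithinAt_hamiltonian {r v l : ℝ → ℝ} {S : Set ℝ} {t : ℝ} (hr0 : 0 < r t)
    (hr : HasDerivWithinAt r (v t + 2 * δ * r t * l t ^ 3) S t)
    (hv : HasDerivWithinAt v (-((r t - 1) / r t ^ 3) - 2 * δ * v t * l t ^ 3) S t) :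
    HasDerivWithinAt (fun t => hamiltonian (r t) (v t))
      (2 * δ * l t ^ 3 * ((r t - 1) / r t ^ 2 - v t ^ 2)) S t := by
  unfold hamiltonian
  have h := ((hv.fun_pow 2).div_const 2).fun_add
    (((hr.sub_const 1).fun_pow 2).fun_div ((hr.fun_pow 2).const_mul 2) (by positivity))
  refine h.congr_deriv ?_
  push_cast
  field_simp
  ring

theorem hamiltonian_nonneg (r v : ℝ) : 0 ≤ hamiltonian r v := by
  unfold hamiltonian; positivity

/-- A bound on the Hamiltonian bounds the velocity and keeps `r` away from `0`. -/
theorem bounds_of_hamiltonian_le {r v B : ℝ} (hr : 0 < r) (h : hamiltonian r v ≤ B) :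
    |v| ≤ √(2 * B) ∧ 1 / (1 + √(2 * B)) ≤ r := by
  have e : (r - 1) ^ 2 / (2 * r ^ 2) = (1 / r - 1) ^ 2 / 2 := by field_simp; ring
  unfold hamiltonian at h
  rw [e] at h
  refine ⟨Real.abs_le_sqrt (by nlinarith [sq_nonneg (1 / r - 1)]), ?_⟩
  have h2 : |1 / r - 1| ≤ √(2 * B) := Real.abs_le_sqrt (by nlinarith [sq_nonneg v])
  rw [div_le_iff₀ (by positivity)]
  have h3 := (abs_le.1 h2).2
  rw [sub_le_iff_le_add, div_le_iff₀ hr] at h3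
  linarith

/-- On a bounded time interval the Hamiltonian grows at most linearly, as `(r - 1) / r² ≤ 1 / 4`,
and `r` at most exponentially; hence solutions are confined to a compact subset of `{r > 0}`. -/
theorem exists_compact_confinement (hδ : 0 < δ) {p : Space} (hp : p ∈ phaseSpace) (T : ℝ) :
    ∃ K ⊆ {p : Space | 0 < p.1}, IsCompact K ∧ ∀ τ ∈ Icc 0 T, ∀ γ : ℝ → Space, γ 0 = p →
      IsSolutionOn (vectorField δ) {p | 0 < p.1} τ γ → γ τ ∈ K := by
  set B := hamiltonian p.1 p.2.1 + δ * p.2.2 ^ 3 / 2 * T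
  set ρ := gronwallBound |p.1| (2 * δ * p.2.2 ^ 3) (√(2 * B)) T
  refine ⟨Icc (1 / (1 + √(2 * B))) ρ ×ˢ Icc (-√(2 * B)) (√(2 * B)) ×ˢ Icc 0 p.2.2, ?_,
    isCompact_Icc.prod (isCompact_Icc.prod isCompact_Icc), ?_⟩
  · rintro ⟨r, v, l⟩ ⟨h, -⟩
    exact lt_of_lt_of_le (by positivity) h.1
  intro τ hτ γ h0 hγ
  set r := fun t => (γ t).1
  set v := fun t => (γ t).2.1
  set l := fun t => (γ t).2.2
  have hr0 : ∀ t ∈ Icc 0 τ, 0 < r t := fun t ht => (hγ t ht).1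
  have hr : ∀ t ∈ Icc 0 τ, HasDerivWithinAt r (v t + 2 * δ * r t * l t ^ 3) (Icc 0 τ) t :=
    fun t ht => (hasDerivWithinAt_components (hγ t ht).2).1
  have hv : ∀ t ∈ Icc 0 τ,
      HasDerivWithinAt v (-((r t - 1) / r t ^ 3) - 2 * δ * v t * l t ^ 3) (Icc 0 τ) t :=
    fun t ht => (hasDerivWithinAt_components (hγ t ht).2).2.1
  have hl : ∀ t ∈ Icc 0 τ, HasDerivWithinAt l (-δ * l t ^ 4) (Icc 0 τ) t :=
    fun t ht => (hasDerivWithinAt_components (hγ t ht).2).2.2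
  have hr_zero : r 0 = p.1 := by rw [← h0]
  have hv_zero : v 0 = p.2.1 := by rw [← h0]
  have hl_zero : l 0 = p.2.2 := by rw [← h0]
  have hl₀ : 0 ≤ p.2.2 := hp.2
  have hlb := angularMomentum_bounds hδ hl₀ hl hl_zero
  have hHd : ∀ t ∈ Icc 0 τ, HasDerivWithinAt (fun t => hamiltonian (r t) (v t))
      (2 * δ * l t ^ 3 * ((r t - 1) / r t ^ 2 - v t ^ 2)) (Icc 0 τ) t :=
    fun t ht => hasDerivWithinAt_hamiltonian (hr0 t ht) (hr t ht) (hv t ht)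
  have hH : ∀ t ∈ Icc 0 τ, hamiltonian (r t) (v t) ≤ B := by
    intro t ht
    have hd : ∀ u ∈ Icc 0 τ, 2 * δ * l u ^ 3 * ((r u - 1) / r u ^ 2 - v u ^ 2)
        ≤ δ * p.2.2 ^ 3 / 2 := by
      intro u hu
      have hru := hr0 u hu
      have h1 : (r u - 1) / r u ^ 2 ≤ 1 / 4 := by
        rw [div_le_div_iff₀ (by positivity) (by norm_num)]
        nlinarith [sq_nonneg (r u - 2)]
      have h2 : l u ^ 3 ≤ p.2.2 ^ 3 := pow_le_pow_left₀ (hlb u hu).1 (hlb u hu).2 3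
      have h3 : 0 ≤ l u ^ 3 := pow_nonneg (hlb u hu).1 3
      calc _ ≤ 2 * δ * l u ^ 3 * (1 / 4) := by
            refine mul_le_mul_of_nonneg_left ?_ (by positivity)
            linarith [sq_nonneg (v u)]
        _ ≤ 2 * δ * p.2.2 ^ 3 * (1 / 4) := by gcongr
        _ = _ := by ring
    have := image_le_of_deriv_right_le_deriv_boundary (a := 0) (b := τ)
      (f := fun t => hamiltonian (r t) (v t))
      (B := fun t => hamiltonian p.1 p.2.1 + δ * p.2.2 ^ 3 / 2 * t)
      (B' := fun _ => δ * p.2.2 ^ 3 / 2) (fun u hu => (hHd u hu).continuousWithinAt)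
      (fun u hu => (hHd u (Ico_subset_Icc_self hu)).mono_of_mem_nhdsWithin
          (Icc_mem_nhdsGE_of_mem hu))
      (by simp [hr_zero, hv_zero]) (by fun_prop)
      (fun u _ => by
        simpa using (((hasDerivAt_id u).const_mul (δ * p.2.2 ^ 3 / 2)).const_add
          (hamiltonian p.1 p.2.1)).hasDerivWithinAt)
      (fun u hu => hd u (Ico_subset_Icc_self hu)) ht
    refine this.trans ?_
    have : t ≤ T := ht.2.trans hτ.2
    simp only [B]
    gcongr
  have hb := fun t ht => bounds_of_hamiltonian_le (hr0 t ht) (hH t ht)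
  have hτ' : τ ∈ Icc 0 τ := ⟨hτ.1, le_rfl⟩
  have hrb := norm_le_gronwallBound_of_norm_deriv_right_le (f := r) (δ := |p.1|)
    (K := 2 * δ * p.2.2 ^ 3) (ε := √(2 * B)) (fun u hu => (hr u hu).continuousWithinAt)
    (fun t ht => (hr t (Ico_subset_Icc_self ht)).mono_of_mem_nhdsWithin (Icc_mem_nhdsGE_of_mem ht))
    (by simp [hr_zero]) (fun t ht => by
      have ht' := Ico_subset_Icc_self ht
      have h3 : |l t ^ 3| ≤ p.2.2 ^ 3 := by
        rw [abs_of_nonneg (pow_nonneg (hlb t ht').1 3)]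
        exact pow_le_pow_left₀ (hlb t ht').1 (hlb t ht').2 3
      have h1 := (hb t ht').1
      rw [Real.norm_eq_abs, Real.norm_eq_abs]
      calc _ ≤ |v t| + |2 * δ * r t * l t ^ 3| := abs_add_le _ _
        _ = |v t| + 2 * δ * |r t| * |l t ^ 3| := by
          rw [abs_mul, abs_mul, abs_of_pos (by positivity : 0 < 2 * δ)]
        _ ≤ √(2 * B) + 2 * δ * |r t| * p.2.2 ^ 3 := by gcongr
        _ = _ := by ring) τ hτ'
  refine ⟨⟨(hb τ hτ').2, (le_abs_self _).trans (hrb.trans ?_)⟩, abs_le.1 (hb τ hτ').1, hlb τ hτ'⟩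
  refine gronwallBound_mono (abs_nonneg _) (by positivity) (by positivity) ?_
  linarith [hτ.2]

theorem exists_isForwardSolution (hδ : 0 < δ) {p : Space} (hp : p ∈ phaseSpace) :
    ∃ γ : ℝ → Space, IsForwardSolution δ p γ := by
  obtain ⟨γ, h0, hγ⟩ := exists_isGlobalSolution isOpen_fst_pos (contDiffOn_vectorField δ 1)
    (p := p) hp.1 (fun T _ => exists_compact_confinement hδ hp T)
  refine ⟨γ, h0, fun t ht => ⟨⟨(hγ t ht).1, ?_⟩, (hγ t ht).2⟩⟩
  exact (angularMomentum_bounds hδ hp.2 (T := t) (l := fun t => (γ t).2.2)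
    (fun u hu => (hasDerivWithinAt_components (hγ.isSolutionOn t u hu).2).2.2) (by rw [h0]) t
      ⟨ht, le_rfl⟩).1

theorem IsForwardSolution.isGlobalSolution {p : Space} {γ : ℝ → Space}
    (h : IsForwardSolution δ p γ) : IsGlobalSolution (vectorField δ) {p | 0 < p.1} γ :=
  fun t ht => ⟨(h.2 t ht).1.1, (h.2 t ht).2⟩

theorem IsForwardSolution.eq_of_nonneg {p : Space} {γ γ' : ℝ → Space}
    (h : IsForwardSolution δ p γ) (h' : IsForwardSolution δ p γ') {t : ℝ} (ht : 0 ≤ t) :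
    γ t = γ' t :=
  (h.isGlobalSolution.isSolutionOn t).eqOn isOpen_fst_pos (contDiffOn_vectorField δ 1)
    (h'.isGlobalSolution.isSolutionOn t) (h.1.trans h'.1.symm) ⟨ht, le_rfl⟩

theorem isForwardSolution_flow (hδ : 0 < δ) {p : Space} (hp : p ∈ phaseSpace) :
    IsForwardSolution δ p (fun t => flow δ t p) := by
  have hex := exists_isForwardSolution hδ hp
  have : (fun t => flow δ t p) = Classical.choose hex := by
    ext1 t
    rw [flow, dif_pos hex]
  rw [this]
  exact Classical.choose_spec hex

/-- The angular momentum tends to `0` along every solution. -/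
theorem IsForwardSolution.tendsto_angularMomentum (hδ : 0 < δ) {p : Space} {γ : ℝ → Space}
    (h : IsForwardSolution δ p γ) : Tendsto (fun t => (γ t).2.2) atTop (𝓝 0) := by
  have hl := fun T => fun t ht =>
    (hasDerivWithinAt_components (h.isGlobalSolution.isSolutionOn T t ht).2).2.2
  have hp : p ∈ phaseSpace := h.1 ▸ (h.2 0 le_rfl).1
  rcases hp.2.eq_or_lt with h0 | h0
  · refine tendsto_const_nhds.congr' ?_
    filter_upwards [eventually_ge_atTop 0] with t ht
    exact (angularMomentum_eq_zero (hl t) (by rw [h.1, h0]) t ⟨ht, le_rfl⟩).symm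
  · have h1 : Tendsto (fun t : ℝ => 1 / p.2.2 ^ 3 + 3 * δ * t) atTop atTop :=
      tendsto_atTop_add_const_left _ _ (tendsto_id.const_mul_atTop (by positivity))
    refine ((tendsto_rpow_neg_atTop (by norm_num : (0 : ℝ) < 1 / 3)).comp h1).congr' ?_
    filter_upwards [eventually_ge_atTop 0] with t ht
    exact (angularMomentum_eq hδ h0 (hl t) (by rw [h.1]) t ⟨ht, le_rfl⟩).symm

/-- A function with nonpositive derivative on `[0, ∞)` that is bounded below converges. -/
theorem exists_tendsto_of_deriv_nonpos {f f' : ℝ → ℝ} {m : ℝ}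
    (hf : ∀ t, 0 ≤ t → HasDerivWithinAt f (f' t) (Ici 0) t) (hf' : ∀ t, 0 ≤ t → f' t ≤ 0)
    (hm : ∀ t, 0 ≤ t → m ≤ f t) : ∃ L, Tendsto f atTop (𝓝 L) := by
  have hanti : AntitoneOn f (Ici 0) :=
    antitoneOn_of_hasDerivWithinAt_nonpos (convex_Ici 0)
      (fun t ht => (hf t ht).continuousWithinAt)
      (fun t ht => (hf t (interior_subset ht)).mono interior_subset)
      (fun t ht => hf' t (interior_subset ht))
  have hg : Antitone (fun t => f (max t 0)) := fun s t hst =>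
    hanti (le_max_right s 0) (le_max_right t 0) (max_le_max_right 0 hst)
  refine ⟨_, (tendsto_atTop_ciInf hg ⟨m, ?_⟩).congr' ?_⟩
  · rintro _ ⟨t, rfl⟩
    exact hm _ (le_max_right _ _)
  · filter_upwards [eventually_ge_atTop 0] with t ht
    rw [max_eq_left ht]

/-- Nonincreasing quantities along solutions. -/
theorem le_of_deriv_nonpos {f f' : ℝ → ℝ}
    (hf : ∀ t, 0 ≤ t → HasDerivWithinAt f (f' t) (Ici 0) t) (hf' : ∀ t, 0 ≤ t → f' t ≤ 0)
    {t : ℝ} (ht : 0 ≤ t) : f t ≤ f 0 :=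
  antitoneOn_of_hasDerivWithinAt_nonpos (convex_Ici 0)
    (fun t ht => (hf t ht).continuousWithinAt)
    (fun t ht => (hf t (interior_subset ht)).mono interior_subset)
    (fun t ht => hf' t (interior_subset ht)) self_mem_Ici ht ht

/-- The Hamiltonian converges along every solution. The corrected Hamiltonian
`H + 2 δ l³ r v` has derivative `-6 δ² l⁶ r v`, and `l² r v` is bounded because the Kepler energy
`(H - 1/2) / l²` is nonincreasing. -/
theorem IsForwardSolution.exists_tendsto_hamiltonian (hδ : 0 < δ) {p : Space} {γ : ℝ → Space}
    (h : IsForwardSolution δ p γ) :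
    ∃ L, Tendsto (fun t => hamiltonian (γ t).1 (γ t).2.1) atTop (𝓝 L) := by
  have hp : p ∈ phaseSpace := h.1 ▸ (h.2 0 le_rfl).1
  have hlT := fun T => fun t ht =>
    (hasDerivWithinAt_components (h.isGlobalSolution.isSolutionOn T t ht).2).2.2
  set r := fun t => (γ t).1 with hrdef
  set v := fun t => (γ t).2.1 with hvdef
  set l := fun t => (γ t).2.2 with hldef
  have hr0 : ∀ t, 0 ≤ t → 0 < r t := fun t ht => (h.2 t ht).1.1
  have hr : ∀ t, 0 ≤ t → HasDerivWithinAt r (v t + 2 * δ * r t * l t ^ 3) (Ici 0) t :=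
    fun t ht => (hasDerivWithinAt_components (h.2 t ht).2).1
  have hv : ∀ t, 0 ≤ t →
      HasDerivWithinAt v (-((r t - 1) / r t ^ 3) - 2 * δ * v t * l t ^ 3) (Ici 0) t :=
    fun t ht => (hasDerivWithinAt_components (h.2 t ht).2).2.1
  have hl : ∀ t, 0 ≤ t → HasDerivWithinAt l (-δ * l t ^ 4) (Ici 0) t :=
    fun t ht => (hasDerivWithinAt_components (h.2 t ht).2).2.2
  have hH : ∀ t, 0 ≤ t → HasDerivWithinAt (fun t => hamiltonian (r t) (v t))
      (2 * δ * l t ^ 3 * ((r t - 1) / r t ^ 2 - v t ^ 2)) (Ici 0) t :=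
    fun t ht => hasDerivWithinAt_hamiltonian (hr0 t ht) (hr t ht) (hv t ht)
  change ∃ L, Tendsto (fun t => hamiltonian (r t) (v t)) atTop (𝓝 L)
  have hl00 : l 0 = p.2.2 := by rw [← h.1]
  rcases hp.2.eq_or_lt with h0 | h0
  · have hl0 : ∀ t, 0 ≤ t → l t = 0 := fun t ht =>
      angularMomentum_eq_zero (hlT t) (hl00.trans h0.symm) t ⟨ht, le_rfl⟩
    refine exists_tendsto_of_deriv_nonpos (m := 0) hH (fun t ht => ?_)
      (fun t _ => hamiltonian_nonneg _ _)
    simp [hl0 t ht]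
  have hlpos : ∀ t, 0 ≤ t → 0 < l t := fun t ht => by
    have e : l t = _ := angularMomentum_eq hδ h0 (hlT t) hl00 t ⟨ht, le_rfl⟩
    rw [e]
    positivity
  have hlle : ∀ t, 0 ≤ t → l t ≤ l 0 := fun t ht =>
    (angularMomentum_bounds hδ hp.2 (hlT t) hl00 t ⟨ht, le_rfl⟩).2.trans hl00.ge
  have hl0pos : 0 < l 0 := hlpos 0 le_rfl
  -- the Kepler energy is nonincreasing
  set E₀ := (hamiltonian (r 0) (v 0) - 1 / 2) / l 0 ^ 2 with hE₀
  have hE : ∀ t, 0 ≤ t → hamiltonian (r t) (v t) ≤ 1 / 2 + |E₀| * l t ^ 2 := by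
    intro t ht
    have h1 := le_of_deriv_nonpos (f := fun t => (hamiltonian (r t) (v t) - 1 / 2) / l t ^ 2)
      (f' := fun t => -δ * l t * (v t ^ 2 + 1 / r t ^ 2)) (fun t ht => ?_) (fun t ht => ?_) ht
    · have h2 : (hamiltonian (r t) (v t) - 1 / 2) / l t ^ 2 ≤ |E₀| := h1.trans (le_abs_self _)
      rw [div_le_iff₀ (pow_pos (hlpos t ht) 2)] at h2
      linarith
    · have hd := ((hH t ht).sub_const (1 / 2)).fun_div ((hl t ht).fun_pow 2)
        (pow_ne_zero 2 (hlpos t ht).ne')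
      refine hd.congr_deriv ?_
      have := hr0 t ht
      have := hlpos t ht
      unfold hamiltonian
      push_cast
      field_simp
      ring
    · have := hr0 t ht
      have := hlpos t ht
      have : 0 ≤ δ * l t * (v t ^ 2 + 1 / r t ^ 2) := by positivity
      linarith
  have hvsq : ∀ t, 0 ≤ t → v t ^ 2 ≤ 2 / r t + 2 * |E₀| * l t ^ 2 := by
    intro t ht
    have h1 := hE t ht
    have hrt := hr0 t ht
    have e : hamiltonian (r t) (v t) = v t ^ 2 / 2 + 1 / 2 - 1 / r t + (1 / r t) ^ 2 / 2 := by
      unfold hamiltonian; field_simp; ring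
    have e2 : 2 / r t = 2 * (1 / r t) := by ring
    rw [e] at h1
    rw [e2]
    nlinarith [sq_nonneg (1 / r t)]
  set v₀ := 1 + 2 * |E₀| * l 0 ^ 2 with hv₀
  have hvle : ∀ t, 0 ≤ t → v t ≤ v₀ := by
    intro t ht
    have h1 := hE t ht
    have h2 : l t ^ 2 ≤ l 0 ^ 2 := pow_le_pow_left₀ (hlpos t ht).le (hlle t ht) 2
    have h3 : v t ^ 2 ≤ 2 * hamiltonian (r t) (v t) := by
      have : 0 ≤ (r t - 1) ^ 2 / (2 * r t ^ 2) := by positivity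
      unfold hamiltonian; linarith
    have h4 : |E₀| * l t ^ 2 ≤ |E₀| * l 0 ^ 2 := by gcongr
    have h5 : 1 ≤ v₀ := by rw [hv₀]; linarith [show 0 ≤ 2 * |E₀| * l 0 ^ 2 by positivity]
    have h6 : v t ^ 2 ≤ v₀ ^ 2 := by nlinarith
    exact le_of_abs_le (abs_le_of_sq_le_sq h6 (by linarith))
  -- as `(1 / l)' = δ l²` and `v ≤ v₀`, the quantity `l² r - (v₀ / δ) / l` is nonincreasing
  set A := l 0 ^ 3 * r 0 + v₀ / δ with hA
  have hv₀pos : 0 < v₀ := by positivity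
  have hApos : 0 < A := by
    have := hr0 0 le_rfl
    positivity
  have hlr : ∀ t, 0 ≤ t → l t ^ 3 * r t ≤ A := by
    intro t ht
    have h1 := le_of_deriv_nonpos (f := fun t => l t ^ 2 * r t - v₀ / δ * (1 / l t))
      (f' := fun t => l t ^ 2 * (v t - v₀)) (fun t ht => ?_) (fun t ht => ?_) ht
    · have hlt := hlpos t ht
      have h2 : l t ^ 2 * r t ≤ l 0 ^ 2 * r 0 + v₀ / δ * (1 / l t) := by
        have : 0 ≤ v₀ / δ * (1 / l 0) := by positivity
        linarith
      have h3 := mul_le_mul_of_nonneg_left h2 hlt.le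
      have h4 : l t * (l 0 ^ 2 * r 0) ≤ l 0 * (l 0 ^ 2 * r 0) := by
        have := hr0 0 le_rfl
        exact mul_le_mul_of_nonneg_right (hlle t ht) (by positivity)
      have h5 : l t * (v₀ / δ * (1 / l t)) = v₀ / δ := by field_simp
      rw [hA]
      nlinarith
    · have hlt := hlpos t ht
      have hd := (((hl t ht).fun_pow 2).fun_mul (hr t ht)).fun_sub
        ((((hasDerivWithinAt_const t (Ici 0) (1 : ℝ)).fun_div (hl t ht) hlt.ne')).const_mul (v₀ / δ))
      refine hd.congr_deriv ?_
      push_cast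
      field_simp
      ring
    · exact mul_nonpos_of_nonneg_of_nonpos (by positivity) (by linarith [hvle t ht])
  set B := 1 + (2 * l 0 * A + 2 * |E₀| * A ^ 2) with hB
  have hBpos : 0 < B := by positivity
  have hrv : ∀ t, 0 ≤ t → |l t ^ 2 * r t * v t| ≤ B := by
    intro t ht
    have hlt := hlpos t ht
    have hrt := hr0 t ht
    refine abs_le_of_sq_le_sq ?_ hBpos.le
    have h1 : (l t ^ 2 * r t * v t) ^ 2 ≤ 2 * l 0 * A + 2 * |E₀| * A ^ 2 := by
      calc (l t ^ 2 * r t * v t) ^ 2 = (l t ^ 2 * r t) ^ 2 * v t ^ 2 := by ring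
        _ ≤ (l t ^ 2 * r t) ^ 2 * (2 / r t + 2 * |E₀| * l t ^ 2) := by gcongr; exact hvsq t ht
        _ = 2 * l t * (l t ^ 3 * r t) + 2 * |E₀| * (l t ^ 3 * r t) ^ 2 := by
          field_simp
        _ ≤ 2 * l 0 * A + 2 * |E₀| * A ^ 2 := by
          have := hlr t ht
          have := hlle t ht
          gcongr
    nlinarith [show 0 ≤ 2 * l 0 * A + 2 * |E₀| * A ^ 2 by positivity]
  -- since `l' = -δ l⁴`, the term `6 δ B l` outweighs the derivative `-6 δ² l⁶ r v`
  have hlim := exists_tendsto_of_deriv_nonpos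
    (f := fun t => hamiltonian (r t) (v t) + 2 * δ * (l t ^ 3 * r t * v t) + 6 * δ * B * l t)
    (f' := fun t => -(6 * δ ^ 2 * l t ^ 4 * (l t ^ 2 * r t * v t + B))) (m := -(2 * δ * l 0 * B))
    (fun t ht => ?_) (fun t ht => ?_) (fun t ht => ?_)
  · obtain ⟨L, hL⟩ := hlim
    refine ⟨L, ?_⟩
    have hl0 : Tendsto l atTop (𝓝 0) := h.tendsto_angularMomentum hδ
    have h2 : Tendsto (fun t => 2 * δ * (l t ^ 3 * r t * v t)) atTop (𝓝 0) := by
      refine squeeze_zero_norm' (a := fun t => 2 * δ * B * l t) ?_ (by simpa using hl0.const_mul _)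
      filter_upwards [eventually_ge_atTop 0] with t ht
      have e : 2 * δ * (l t ^ 3 * r t * v t) = 2 * δ * l t * (l t ^ 2 * r t * v t) := by ring
      have := hlpos t ht
      rw [e, Real.norm_eq_abs, abs_mul, abs_of_pos (by positivity : 0 < 2 * δ * l t)]
      calc _ ≤ 2 * δ * l t * B := by gcongr; exact hrv t ht
        _ = _ := by ring
    have h3 : Tendsto (fun t => 6 * δ * B * l t) atTop (𝓝 0) := by simpa using hl0.const_mul _
    simpa using (hL.sub h3).sub h2
  · have hrt := hr0 t ht
    have hd := ((hH t ht).fun_add (((((hl t ht).fun_pow 3).fun_mul (hr t ht)).fun_mul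
      (hv t ht)).const_mul (2 * δ))).fun_add ((hl t ht).const_mul (6 * δ * B))
    refine hd.congr_deriv ?_
    push_cast
    field_simp
    ring
  · have h1 := (abs_le.1 (hrv t ht)).1
    have : 0 ≤ 6 * δ ^ 2 * l t ^ 4 * (l t ^ 2 * r t * v t + B) :=
      mul_nonneg (by positivity) (by linarith)
    linarith
  · have h1 := (abs_le.1 (hrv t ht)).1
    have hlt := hlpos t ht
    have h2 : -(2 * δ * l t * B) ≤ 2 * δ * (l t ^ 3 * r t * v t) := by
      have : 2 * δ * (l t ^ 3 * r t * v t) = 2 * δ * l t * (l t ^ 2 * r t * v t) := by ring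
      rw [this]
      nlinarith [show 0 < 2 * δ * l t by positivity]
    have h3 : 2 * δ * l t * B ≤ 2 * δ * l 0 * B := by
      have := hlle t ht
      gcongr
    have h4 := hamiltonian_nonneg (r t) (v t)
    have h5 : 0 ≤ 6 * δ * B * l t := by positivity
    linarith

theorem tendsto_hamiltonianLimit (hδ : 0 < δ) {p : Space} (hp : p ∈ phaseSpace) :
    Tendsto (fun t : ℝ => hamiltonian (flow δ t p).1 (flow δ t p).2.1) atTop
      (𝓝 (hamiltonianLimit δ p)) := by
  obtain ⟨L, hL⟩ := (isForwardSolution_flow hδ hp).exists_tendsto_hamiltonian hδ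
  exact tendsto_nhds_limUnder ⟨L, hL⟩

/-- On `{l = 0}` the limiting Hamiltonian is a first integral. -/
theorem hamiltonianLimit_of_angularMomentum_eq_zero (hδ : 0 < δ) {p : Space}
    (hp : p ∈ phaseSpace) (h0 : p.2.2 = 0) :
    hamiltonianLimit δ p = hamiltonian p.1 p.2.1 := by
  have h := isForwardSolution_flow hδ hp
  refine tendsto_nhds_unique (tendsto_hamiltonianLimit hδ hp) (tendsto_const_nhds.congr' ?_)
  filter_upwards [eventually_ge_atTop 0] with t ht
  have e0 : flow δ 0 p = p := h.1
  have hl0 : ∀ u, 0 ≤ u → (flow δ u p).2.2 = 0 := fun u hu =>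
    angularMomentum_eq_zero (δ := δ) (l := fun t => (flow δ t p).2.2) (T := u) (fun s hs =>
      (hasDerivWithinAt_components (h.isGlobalSolution.isSolutionOn u s hs).2).2.2)
      (by rw [e0, h0]) u ⟨hu, le_rfl⟩
  have hd : ∀ u, 0 ≤ u →
      HasDerivWithinAt (fun t => hamiltonian (flow δ t p).1 (flow δ t p).2.1) 0 (Ici 0) u := by
    intro u hu
    have := hasDerivWithinAt_hamiltonian (r := fun t => (flow δ t p).1)
      (v := fun t => (flow δ t p).2.1) (l := fun t => (flow δ t p).2.2) (h.2 u hu).1.1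
      (hasDerivWithinAt_components (h.2 u hu).2).1 (hasDerivWithinAt_components (h.2 u hu).2).2.1
    simpa [hl0 u hu] using this
  have h1 := le_of_deriv_nonpos hd (fun _ _ => le_rfl) ht
  have h2 := le_of_deriv_nonpos (fun u hu => (hd u hu).neg) (fun _ _ => by simp) ht
  rw [e0] at h1
  simp only [Pi.neg_apply, e0] at h2
  linarith

end RealFlow

/-! ### The stable set as a level set -/

section StableSet

variable {δ h : ℝ}

theorem hamiltonian_eq_of_pos {r : ℝ} (hr : 0 < r) (v : ℝ) :
    hamiltonian r v = ((1 - 1 / r) ^ 2 + v ^ 2) / 2 := by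
  unfold hamiltonian
  field_simp
  ring

/-- In the coordinates `w = 1 - 1 / r` and `v` the periodic orbit is a circle. -/
theorem periodicOrbit_eq_image (hh : h < 1 / 2) :
    periodicOrbit h = (fun x : ℝ × ℝ => ((1 / (1 - x.1), x.2, 0) : Space)) ''
      {x : ℝ × ℝ | x.1 ^ 2 + x.2 ^ 2 = 2 * h} := by
  ext ⟨r, v, l⟩
  constructor
  · rintro ⟨hp, hl, hH⟩
    have hr : 0 < r := hp.1
    simp only at hl hH
    rw [hamiltonian_eq_of_pos hr] at hH
    refine ⟨(1 - 1 / r, v), ?_, ?_⟩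
    · simp only [mem_ofPred_eq]; linarith
    · simp [hl]
  · rintro ⟨⟨w, u⟩, hx, he⟩
    simp only [mem_ofPred_eq] at hx
    have hw : w < 1 := by nlinarith [sq_nonneg u]
    simp only [Prod.mk.injEq] at he
    obtain ⟨rfl, rfl, rfl⟩ := he
    have hr : 0 < 1 / (1 - w) := by
      have : 0 < 1 - w := by linarith
      positivity
    refine ⟨⟨hr, le_rfl⟩, rfl, ?_⟩
    simp only
    rw [hamiltonian_eq_of_pos hr, one_div_one_div]
    linarith

theorem isCompact_periodicOrbit (hh : h < 1 / 2) : IsCompact (periodicOrbit h) := by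
  rw [periodicOrbit_eq_image hh]
  refine IsCompact.image_of_continuousOn ?_ ?_
  · refine Metric.isCompact_of_isClosed_isBounded
      (isClosed_eq (by fun_prop) continuous_const) ?_
    refine (Metric.isBounded_closedBall (x := (0 : ℝ × ℝ)) (r := 1)).subset ?_
    rintro ⟨w, v⟩ hx
    simp only [mem_ofPred_eq] at hx
    rw [mem_closedBall_zero_iff, Prod.norm_mk, Real.norm_eq_abs, Real.norm_eq_abs]
    exact max_le (abs_le_one_iff_mul_self_le_one.2 (by nlinarith [sq_nonneg v]))
      (abs_le_one_iff_mul_self_le_one.2 (by nlinarith [sq_nonneg w]))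
  · refine ContinuousOn.prodMk (ContinuousOn.div continuousOn_const (by fun_prop) ?_) (by fun_prop)
    rintro ⟨w, v⟩ hx
    simp only [mem_ofPred_eq] at hx
    have : w < 1 := by nlinarith [sq_nonneg v]
    simp only
    linarith

theorem periodicOrbit_nonempty (h0 : 0 < h) (hh : h < 1 / 2) : (periodicOrbit h).Nonempty := by
  rw [periodicOrbit_eq_image hh]
  refine Nonempty.image _ ⟨(√(2 * h), 0), ?_⟩
  simp only [mem_ofPred_eq]
  rw [Real.sq_sqrt (by positivity)]
  ring

theorem continuousAt_hamiltonian {p : Space} (hp : 0 < p.1) :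
    ContinuousAt (fun p : Space => hamiltonian p.1 p.2.1) p := by
  unfold hamiltonian
  exact ContinuousAt.add (by fun_prop) (ContinuousAt.div (by fun_prop) (by fun_prop) (by positivity))

/-- The distance of a point to a periodic orbit, by rescaling the coordinates `w = 1 - 1 / r`
and `v`. -/
theorem infDist_periodicOrbit_le (h0 : 0 < h) {h₁ : ℝ} (hhh : h < h₁) (hh : h₁ < 1 / 2) {p : Space}
    (hp : p ∈ phaseSpace) (hpos : 0 < hamiltonian p.1 p.2.1) (hle : hamiltonian p.1 p.2.1 ≤ h₁) :
    infDist p (periodicOrbit h) ≤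
      |1 - √(h / hamiltonian p.1 p.2.1)| * (1 / (1 - √(2 * h₁)) ^ 2) + p.2.2 := by
  obtain ⟨r, v, l⟩ := p
  have hr : 0 < r := hp.1
  have hl : 0 ≤ l := hp.2
  simp only at *
  set H := hamiltonian r v with hHdef
  have hH : H = ((1 - 1 / r) ^ 2 + v ^ 2) / 2 := hamiltonian_eq_of_pos hr v
  set μ := √(h / H) with hμ
  set ρ := √(2 * h₁) with hρ
  have hρ0 : 0 ≤ ρ := Real.sqrt_nonneg _
  have hρ1 : ρ < 1 := by
    rw [hρ, Real.sqrt_lt' one_pos]; linarith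
  have hρsq : ρ ^ 2 = 2 * h₁ := Real.sq_sqrt (by linarith)
  have hμsq : μ ^ 2 = h / H := Real.sq_sqrt (by positivity)
  set w := 1 - 1 / r with hw
  have hμw : (μ * w) ^ 2 + (μ * v) ^ 2 = 2 * h := by
    have : (μ * w) ^ 2 + (μ * v) ^ 2 = μ ^ 2 * (2 * H) := by rw [hH]; ring
    rw [this, hμsq]; field_simp
  have hwρ : |w| ≤ ρ := abs_le_of_sq_le_sq (by nlinarith [sq_nonneg v]) hρ0
  have hvρ : |v| ≤ 1 := (abs_le_of_sq_le_sq (b := ρ) (by nlinarith [sq_nonneg w]) hρ0).trans hρ1.le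
  have hμwρ : |μ * w| ≤ ρ := abs_le_of_sq_le_sq (by nlinarith [sq_nonneg (μ * v)]) hρ0
  have h1w : 1 - ρ ≤ 1 - w := by linarith [(abs_le.1 hwρ).2]
  have h1mw : 1 - ρ ≤ 1 - μ * w := by linarith [(abs_le.1 hμwρ).2]
  have h1ρ : 0 < 1 - ρ := by linarith
  have hmem : ((1 / (1 - μ * w), μ * v, 0) : Space) ∈ periodicOrbit h := by
    rw [periodicOrbit_eq_image (hhh.trans hh)]
    exact ⟨(μ * w, μ * v), hμw, rfl⟩
  refine (infDist_le_dist_of_mem hmem).trans ?_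
  have hC : 1 ≤ 1 / (1 - ρ) ^ 2 := by
    rw [le_div_iff₀ (by positivity), one_mul]
    exact pow_le_one₀ h1ρ.le (by linarith)
  have hC0 : 0 ≤ |1 - μ| * (1 / (1 - ρ) ^ 2) := by positivity
  rw [Prod.dist_eq, Prod.dist_eq, Real.dist_eq, Real.dist_eq, Real.dist_eq]
  refine max_le ?_ (max_le ?_ ?_)
  · have hrw : r = 1 / (1 - w) := by rw [hw]; field_simp; ring
    have e : r - 1 / (1 - μ * w) = w * (1 - μ) / ((1 - w) * (1 - μ * w)) := by
      have h1 : 1 - w ≠ 0 := by linarith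
      have h2 : 1 - μ * w ≠ 0 := by linarith
      rw [hrw, div_sub_div _ _ h1 h2]
      congr 1
      ring
    simp only
    rw [e, abs_div, abs_mul, abs_of_pos (by nlinarith : 0 < (1 - w) * (1 - μ * w)), div_le_iff₀
      (by nlinarith)]
    have h2 : (1 - ρ) ^ 2 ≤ (1 - w) * (1 - μ * w) := by
      rw [sq]; exact mul_le_mul h1w h1mw h1ρ.le (h1ρ.le.trans h1w)
    calc |w| * |1 - μ| ≤ 1 * |1 - μ| := by gcongr; linarith
      _ = |1 - μ| * (1 / (1 - ρ) ^ 2) * (1 - ρ) ^ 2 := by field_simp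
      _ ≤ (|1 - μ| * (1 / (1 - ρ) ^ 2) + l) * ((1 - w) * (1 - μ * w)) := by
        gcongr
        linarith
  · simp only
    have e : v - μ * v = v * (1 - μ) := by ring
    rw [e, abs_mul]
    calc |v| * |1 - μ| ≤ 1 * |1 - μ| := by gcongr
      _ = |1 - μ| * 1 := by ring
      _ ≤ |1 - μ| * (1 / (1 - ρ) ^ 2) := by gcongr
      _ ≤ _ := by linarith
  · simp only [sub_zero]
    rw [abs_of_nonneg hl]
    linarith

/-- The stable set of the periodic orbit is a level set of the limiting Hamiltonian. -/
theorem stableSet_periodicOrbit (hδ : 0 < δ) (h0 : 0 < h) (hh : h < 1 / 2) :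
    stableSet δ (periodicOrbit h) = {p | p ∈ phaseSpace ∧ hamiltonianLimit δ p = h} := by
  ext p
  refine and_congr_right fun hp => ?_
  have hlim := tendsto_hamiltonianLimit hδ hp
  have hflow := isForwardSolution_flow hδ hp
  constructor
  · intro hd
    -- a subsequence of the nearest points on the compact orbit converges
    have hex : ∀ n : ℕ, ∃ y ∈ periodicOrbit h,
        infDist (flow δ n p) (periodicOrbit h) = dist (flow δ n p) y := fun n =>
      (isCompact_periodicOrbit hh).exists_infDist_eq_dist (periodicOrbit_nonempty h0 hh) _
    choose y hy hdist using hex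
    obtain ⟨y₀, hy₀, φ, hφ, hlimy⟩ := (isCompact_periodicOrbit hh).tendsto_subseq hy
    have hφt : Tendsto (fun n => (φ n : ℝ)) atTop atTop :=
      tendsto_natCast_atTop_atTop.comp hφ.tendsto_atTop
    have hflowy : Tendsto (fun n => flow δ (φ n) p) atTop (𝓝 y₀) := by
      refine (tendsto_iff_of_dist ?_).2 hlimy
      refine (hd.comp hφt).congr fun n => ?_
      exact hdist (φ n)
    have h1 := (continuousAt_hamiltonian hy₀.1.1).tendsto.comp hflowy
    have h2 := hlim.comp hφt
    exact (tendsto_nhds_unique h2 h1).trans hy₀.2.2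
  · intro hH
    rw [hH] at hlim
    set h₁ := (h + 1 / 2) / 2
    have h3 : h < h₁ := by simp only [h₁]; linarith
    have h4 : h₁ < 1 / 2 := by simp only [h₁]; linarith
    have hl := hflow.tendsto_angularMomentum hδ
    have hbound : Tendsto (fun t => |1 - √(h / hamiltonian (flow δ t p).1 (flow δ t p).2.1)| *
        (1 / (1 - √(2 * h₁)) ^ 2) + (flow δ t p).2.2) atTop (𝓝 0) := by
      have h5 : Tendsto (fun t => √(h / hamiltonian (flow δ t p).1 (flow δ t p).2.1)) atTop
          (𝓝 1) := by
        have := (Real.continuous_sqrt.tendsto _).comp ((tendsto_const_nhds (x := h)).div hlim h0.ne')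
        rwa [div_self h0.ne', Real.sqrt_one] at this
      have h6 := ((tendsto_const_nhds (x := (1 : ℝ))).sub h5).abs
      have h9 := (h6.mul_const (1 / (1 - √(2 * h₁)) ^ 2)).add hl
      rwa [sub_self, abs_zero, zero_mul, add_zero] at h9
    refine squeeze_zero' (Eventually.of_forall fun _ => infDist_nonneg) ?_ hbound
    filter_upwards [eventually_ge_atTop 0, hlim.eventually (lt_mem_nhds h0),
      hlim.eventually (gt_mem_nhds h3)] with t ht h7 h8
    exact infDist_periodicOrbit_le h0 h3 h4 (hflow.2 t ht).1 h7 h8.le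

end StableSet

/-! ### Averaging over the rotations -/

section Averaging

/-- The rotation by the angle `s`, the flow of the unperturbed system in the complex coordinates
`a = w + i v`, `b = w - i v`. -/
def rot (s : ℝ) (x : ℂ × ℂ) : ℂ × ℂ :=
  (Complex.exp (-(s * Complex.I)) * x.1, Complex.exp (s * Complex.I) * x.2)

/-- The function `q = 1 - (a + b) / 2`, which is `1 / r₁` at real points. -/
def qfun (x : ℂ × ℂ) : ℂ := 1 - (x.1 + x.2) / 2

/-- The mean of `g` over the orbit of `x` under the rotations. -/
def orbitMean (g : ℂ × ℂ → ℂ) (x : ℂ × ℂ) : ℂ :=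
  ∫ s in (0 : ℝ)..(2 * Real.pi), (1 / (2 * Real.pi) : ℂ) * g (rot s x)

/-- A solution operator for the homological equation: the derivative of `orbitPrimitive g` along
the rotations is `g` minus its mean. -/
def orbitPrimitive (g : ℂ × ℂ → ℂ) (x : ℂ × ℂ) : ℂ :=
  ∫ s in (0 : ℝ)..(2 * Real.pi), (s / (2 * Real.pi) : ℂ) * g (rot s x)

/-- The derivative of `f` along the rotations. -/
def lieDeriv (f : ℂ × ℂ → ℂ) (x : ℂ × ℂ) : ℂ :=
  fderiv ℂ f x (-(Complex.I * x.1), Complex.I * x.2)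

/-- The coefficient of `n⁻¹ ^ (j + 1)` which the term `n⁻¹ ^ j * f` contributes to the derivative
along the perturbed system. -/
def dragTerm (δ : ℝ) (j : ℕ) (f : ℂ × ℂ → ℂ) (x : ℂ × ℂ) : ℂ :=
  2 * δ / qfun x ^ 2 * fderiv ℂ f x (1 - x.1, 1 - x.2) - 3 * δ * j * f x / qfun x ^ 2

/-- Domains on which the averaging procedure works: open, invariant under rotations, and away from
the zeros of the denominators. -/
structure IsAveragingDomain (Ω : Set (ℂ × ℂ)) : Prop where
  isOpen : IsOpen Ω
  rot_mem : ∀ x ∈ Ω, ∀ s, rot s x ∈ Ω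
  fst_ne_zero : ∀ x ∈ Ω, x.1 ≠ 0
  snd_ne_zero : ∀ x ∈ Ω, x.2 ≠ 0
  re_pos : ∀ x ∈ Ω, 0 < (1 / qfun x ^ 2).re

theorem rot_rot (s t : ℝ) (x : ℂ × ℂ) : rot s (rot t x) = rot (s + t) x := by
  ext
  · simp only [rot]
    rw [← mul_assoc, ← Complex.exp_add]
    push_cast
    ring_nf
  · simp only [rot]
    rw [← mul_assoc, ← Complex.exp_add]
    push_cast
    ring_nf

theorem rot_zero (x : ℂ × ℂ) : rot 0 x = x := by simp [rot]

theorem rot_add_two_pi (s : ℝ) (x : ℂ × ℂ) : rot (s + 2 * Real.pi) x = rot s x := by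
  have h1 : Complex.exp (2 * Real.pi * Complex.I) = 1 := Complex.exp_two_pi_mul_I
  ext
  · simp only [rot]
    push_cast
    rw [show -((s + 2 * Real.pi) * Complex.I) = -(s * Complex.I) - 2 * Real.pi * Complex.I by ring,
      Complex.exp_sub, h1, div_one]
  · simp only [rot]
    push_cast
    rw [add_mul, Complex.exp_add, h1, mul_one]

theorem dist_rot (s : ℝ) (x y : ℂ × ℂ) : dist (rot s x) (rot s y) = dist x y := by
  have h1 : ‖Complex.exp (-(s * Complex.I))‖ = 1 := by
    rw [← neg_mul, ← Complex.ofReal_neg, Complex.norm_exp_ofReal_mul_I]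
  have h2 : ‖Complex.exp (s * Complex.I)‖ = 1 := Complex.norm_exp_ofReal_mul_I s
  rw [Prod.dist_eq, Prod.dist_eq]
  simp only [rot, dist_eq_norm, ← mul_sub, norm_mul, h1, h2, one_mul]

theorem hasDerivAt_rot (s : ℝ) (x : ℂ × ℂ) :
    HasDerivAt (fun s => rot s x)
      (-(Complex.I * (rot s x).1), Complex.I * (rot s x).2) s := by
  have h0 : HasDerivAt (fun s : ℝ => (s : ℂ) * Complex.I) Complex.I s := by
    simpa using (Complex.ofRealCLM.hasDerivAt (x := s)).mul_const Complex.I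
  refine HasDerivAt.prodMk ?_ ?_
  · refine (h0.fun_neg.cexp.mul_const x.1).congr_deriv ?_
    simp only [rot]; ring
  · refine (h0.cexp.mul_const x.2).congr_deriv ?_
    simp only [rot]; ring

theorem continuous_rot (x : ℂ × ℂ) : Continuous fun s => rot s x := by
  unfold rot
  fun_prop

/-- The rotation `rot s` as a complex continuous linear map. -/
def rotL (s : ℝ) : ℂ × ℂ →L[ℂ] ℂ × ℂ :=
  (Complex.exp (-(s * Complex.I)) • ContinuousLinearMap.fst ℂ ℂ ℂ).prod
    (Complex.exp (s * Complex.I) • ContinuousLinearMap.snd ℂ ℂ ℂ)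

theorem rotL_apply (s : ℝ) (x : ℂ × ℂ) : rotL s x = rot s x := by
  simp [rotL, rot]

theorem differentiable_qfun : Differentiable ℂ qfun := by
  unfold qfun
  fun_prop

variable {Ω : Set (ℂ × ℂ)} {f g C : ℂ × ℂ → ℂ} {x : ℂ × ℂ}

namespace IsAveragingDomain

theorem qfun_ne_zero (hΩ : IsAveragingDomain Ω) (hx : x ∈ Ω) : qfun x ≠ 0 := by
  intro h
  have := hΩ.re_pos x hx
  simp [h] at this

theorem continuous_comp_rot (hΩ : IsAveragingDomain Ω) (hg : ContinuousOn g Ω) (hx : x ∈ Ω) :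
    Continuous fun s => g (rot s x) :=
  hg.comp_continuous (continuous_rot x) fun s => hΩ.rot_mem x hx s

theorem differentiableOn_orbitIntegral (hΩ : IsAveragingDomain Ω) (hg : DifferentiableOn ℂ g Ω)
    {φ : ℝ → ℂ} (hφ : Continuous φ) :
    DifferentiableOn ℂ (fun x => ∫ s in (0 : ℝ)..(2 * Real.pi), φ s * g (rot s x)) Ω := by
  intro x hx
  have hK : IsCompact ((fun s => rot s x) '' Icc 0 (2 * Real.pi)) :=
    isCompact_Icc.image (continuous_rot x)
  obtain ⟨R, hR, hRΩ⟩ := hK.exists_cthickening_subset_open hΩ.isOpen (by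
    rintro _ ⟨s, -, rfl⟩
    exact hΩ.rot_mem x hx s)
  have hK' : IsCompact (cthickening R ((fun s => rot s x) '' Icc 0 (2 * Real.pi))) :=
    hK.cthickening
  obtain ⟨M, hM⟩ := hK'.exists_bound_of_continuousOn (hg.continuousOn.mono hRΩ)
  obtain ⟨M', hM'⟩ := (isCompact_Icc (a := (0 : ℝ)) (b := 2 * Real.pi)).exists_bound_of_continuousOn
    hφ.continuousOn
  have hmem : ∀ s ∈ Icc 0 (2 * Real.pi), ∀ y ∈ ball x R,
      rot s y ∈ cthickening R ((fun s => rot s x) '' Icc 0 (2 * Real.pi)) := by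
    intro s hs y hy
    refine mem_cthickening_of_dist_le _ (rot s x) _ _ (mem_image_of_mem _ hs) ?_
    rw [dist_rot]
    exact (mem_ball.1 hy).le
  refine (differentiableAt_intervalIntegral (M := M' * M) (by positivity) hR ?_ ?_
    ?_).differentiableWithinAt
  · intro s hs
    refine DifferentiableOn.const_mul ?_ _
    have : DifferentiableOn ℂ (g ∘ rotL s) (ball x R) :=
      hg.comp (rotL s).differentiableOn fun y hy => by
        rw [rotL_apply]; exact hRΩ (hmem s hs y hy)
    simpa only [Function.comp_def, rotL_apply] using this
  · intro s hs y hy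
    rw [norm_mul]
    exact mul_le_mul (hM' s hs) (hM _ (hmem s hs y hy)) (norm_nonneg _)
      ((norm_nonneg _).trans (hM' s hs))
  · intro y hy
    refine hφ.continuousOn.mul ?_
    exact (hg.continuousOn.mono hRΩ).comp (continuous_rot y).continuousOn fun s hs => hmem s hs y hy

theorem differentiableOn_orbitMean (hΩ : IsAveragingDomain Ω) (hg : DifferentiableOn ℂ g Ω) :
    DifferentiableOn ℂ (orbitMean g) Ω :=
  hΩ.differentiableOn_orbitIntegral hg continuous_const

theorem differentiableOn_orbitPrimitive (hΩ : IsAveragingDomain Ω) (hg : DifferentiableOn ℂ g Ω) :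
    DifferentiableOn ℂ (orbitPrimitive g) Ω :=
  hΩ.differentiableOn_orbitIntegral hg (φ := fun s => (s / (2 * Real.pi) : ℂ)) (by fun_prop)

theorem differentiableOn_inv_sq (hΩ : IsAveragingDomain Ω) :
    DifferentiableOn ℂ (fun y => 1 / qfun y ^ 2) Ω := by
  simp only [one_div]
  exact (differentiable_qfun.differentiableOn.pow 2).fun_inv
    fun y hy => pow_ne_zero 2 (hΩ.qfun_ne_zero hy)

theorem differentiableOn_dragTerm (hΩ : IsAveragingDomain Ω) (hf : DifferentiableOn ℂ f Ω) (δ : ℝ)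
    (j : ℕ) : DifferentiableOn ℂ (dragTerm δ j f) Ω := by
  have hq := hΩ.differentiableOn_inv_sq
  have hf' : DifferentiableOn ℂ (fun x => fderiv ℂ f x (1 - x.1, 1 - x.2)) Ω :=
    (DifferentiableOn.fderiv_complex hΩ.isOpen hf).clm_apply (by fun_prop)
  refine (((hq.const_mul (2 * δ : ℂ)).mul hf').sub ((hf.const_mul (3 * δ * j : ℂ)).mul hq)).congr
    fun x _ => ?_
  simp only [dragTerm, Pi.sub_apply, Pi.mul_apply]
  ring

theorem hasDerivAt_comp_rot (hΩ : IsAveragingDomain Ω) (hf : DifferentiableOn ℂ f Ω) (hx : x ∈ Ω)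
    (s : ℝ) : HasDerivAt (fun s => f (rot s x)) (lieDeriv f (rot s x)) s := by
  have h1 : HasFDerivAt f (fderiv ℂ f (rot s x)) (rot s x) :=
    (hf.differentiableAt (hΩ.isOpen.mem_nhds (hΩ.rot_mem x hx s))).hasFDerivAt
  exact (h1.restrictScalars ℝ).comp_hasDerivAt s (hasDerivAt_rot s x)

end IsAveragingDomain

theorem periodic_comp_rot (g : ℂ × ℂ → ℂ) (x : ℂ × ℂ) :
    Function.Periodic (fun s => g (rot s x)) (2 * Real.pi) := fun s => by
  simp only [rot_add_two_pi]

theorem orbitMean_rot (g : ℂ × ℂ → ℂ) (t : ℝ) (x : ℂ × ℂ) :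
    orbitMean g (rot t x) = orbitMean g x := by
  unfold orbitMean
  simp only [rot_rot, intervalIntegral.integral_const_mul]
  congr 1
  rw [intervalIntegral.integral_comp_add_right (fun s => g (rot s x)), zero_add, add_comm _ t,
    (periodic_comp_rot g x).intervalIntegral_add_eq t 0, zero_add]

/-- The homological equation. -/
theorem IsAveragingDomain.lieDeriv_orbitPrimitive (hΩ : IsAveragingDomain Ω)
    (hg : DifferentiableOn ℂ g Ω) (hx : x ∈ Ω) :
    lieDeriv (orbitPrimitive g) x = g x - orbitMean g x := by
  have h1 := hΩ.hasDerivAt_comp_rot (hΩ.differentiableOn_orbitPrimitive hg) hx 0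
  rw [rot_zero] at h1
  refine h1.unique ?_
  set φ : ℝ → ℂ := fun s => g (rot s x) with hφ
  have hφc : Continuous φ := hΩ.continuous_comp_rot hg.continuousOn hx
  have hφp : Function.Periodic φ (2 * Real.pi) := periodic_comp_rot g x
  have hpi : (Real.pi : ℂ) ≠ 0 := Complex.ofReal_ne_zero.2 Real.pi_ne_zero
  -- in the variable `u = s + t` the primitive at the rotated point is an integral over
  -- a moving window
  have h2 : ∀ t : ℝ, orbitPrimitive g (rot t x) =
      1 / (2 * Real.pi) * ((∫ u in t..(t + 2 * Real.pi), (u : ℂ) * φ u) -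
        t * ∫ u in (0 : ℝ)..(2 * Real.pi), φ u) := by
    intro t
    have e1 : orbitPrimitive g (rot t x) =
        ∫ s in (0 : ℝ)..(2 * Real.pi),
          (fun u : ℝ => ((u : ℂ) - t) / (2 * Real.pi) * φ u) (s + t) := by
      unfold orbitPrimitive
      refine intervalIntegral.integral_congr fun s _ => ?_
      simp only [rot_rot, hφ]
      push_cast
      ring
    rw [e1, intervalIntegral.integral_comp_add_right
      (fun u : ℝ => ((u : ℂ) - t) / (2 * Real.pi) * φ u), zero_add, add_comm _ t]
    have e2 : ∫ u in (0 : ℝ)..(2 * Real.pi), φ u = ∫ u in t..(t + 2 * Real.pi), φ u := by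
      rw [hφp.intervalIntegral_add_eq t 0, zero_add]
    rw [e2, ← intervalIntegral.integral_const_mul (t : ℂ), ← intervalIntegral.integral_sub
      (Continuous.intervalIntegrable (by fun_prop) _ _)
      (Continuous.intervalIntegrable (by fun_prop) _ _), ← intervalIntegral.integral_const_mul]
    refine intervalIntegral.integral_congr fun u _ => ?_
    ring
  have h3 : HasDerivAt (fun t : ℝ => ∫ u in t..(t + 2 * Real.pi), (u : ℂ) * φ u)
      (2 * Real.pi * φ 0) 0 := by
    have hc : Continuous fun u : ℝ => (u : ℂ) * φ u := by fun_prop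
    have e : (fun t : ℝ => ∫ u in t..(t + 2 * Real.pi), (u : ℂ) * φ u) =
        fun t : ℝ => (∫ u in (0 : ℝ)..(t + 2 * Real.pi), (u : ℂ) * φ u) -
          ∫ u in (0 : ℝ)..t, (u : ℂ) * φ u := by
      funext t
      rw [intervalIntegral.integral_interval_sub_left] <;> exact hc.intervalIntegrable _ _
    rw [e]
    have a1 : HasDerivAt (fun t : ℝ => ∫ u in (0 : ℝ)..(t + 2 * Real.pi), (u : ℂ) * φ u)
        (((0 + 2 * Real.pi : ℝ) : ℂ) * φ (0 + 2 * Real.pi)) 0 := by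
      have := (hc.integral_hasStrictDerivAt 0 (0 + 2 * Real.pi)).hasDerivAt
      exact HasDerivAt.comp_add_const (0 : ℝ) (2 * Real.pi) this
    have a2 := (hc.integral_hasStrictDerivAt 0 0).hasDerivAt
    refine (a1.fun_sub a2).congr_deriv ?_
    have := hφp 0
    rw [this]
    push_cast
    ring
  have h4 : HasDerivAt (fun t : ℝ => (t : ℂ) * ∫ u in (0 : ℝ)..(2 * Real.pi), φ u)
      (∫ u in (0 : ℝ)..(2 * Real.pi), φ u) 0 := by
    simpa using (Complex.ofRealCLM.hasDerivAt (x := (0 : ℝ))).mul_const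
      (∫ u in (0 : ℝ)..(2 * Real.pi), φ u)
  have h5 := (h3.fun_sub h4).const_mul (1 / (2 * Real.pi) : ℂ)
  rw [show (fun s : ℝ => orbitPrimitive g (rot s x)) = _ from funext h2]
  refine h5.congr_deriv ?_
  unfold orbitMean
  rw [intervalIntegral.integral_const_mul]
  have : φ 0 = g x := by simp [hφ, rot_zero]
  rw [this]
  simp only [hφ]
  field_simp

/-- The mean of the drag term of an invariant function only involves the decay of `n⁻¹`: the
remaining part is the derivative of `(a - b) / q` along the rotations. -/
theorem IsAveragingDomain.orbitMean_fderiv_eq_zero (hΩ : IsAveragingDomain Ω)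
    (hC : DifferentiableOn ℂ C Ω) (hinv : ∀ x ∈ Ω, ∀ s, C (rot s x) = C x) (hx : x ∈ Ω) :
    orbitMean (fun y => 1 / qfun y ^ 2 * fderiv ℂ C y (1 - y.1, 1 - y.2)) x = 0 := by
  have hLie : ∀ y ∈ Ω, lieDeriv C y = 0 := by
    intro y hy
    have h1 := hΩ.hasDerivAt_comp_rot hC hy 0
    rw [rot_zero, show (fun s => C (rot s y)) = fun _ => C y from funext (hinv y hy)] at h1
    exact h1.unique (hasDerivAt_const _ _)
  have hlin : ∀ y u v, fderiv ℂ C y (u, v) = u * fderiv ℂ C y (1, 0) + v * fderiv ℂ C y (0, 1) := by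
    intro y u v
    have : ((u, v) : ℂ × ℂ) = u • ((1, 0) : ℂ × ℂ) + v • ((0, 1) : ℂ × ℂ) := by simp
    rw [this, map_add, map_smul, map_smul]
    rfl
  have hab : ∀ y ∈ Ω, y.1 * fderiv ℂ C y (1, 0) = y.2 * fderiv ℂ C y (0, 1) := by
    intro y hy
    have := hLie y hy
    unfold lieDeriv at this
    rw [hlin] at this
    have h2 : Complex.I * (y.2 * fderiv ℂ C y (0, 1) - y.1 * fderiv ℂ C y (1, 0)) = 0 := by
      linear_combination this
    rcases mul_eq_zero.1 h2 with h | h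
    · exact absurd h Complex.I_ne_zero
    · exact (sub_eq_zero.1 h).symm
  -- the common value `a ∂C/∂a = b ∂C/∂b` is itself invariant
  set D := x.1 * fderiv ℂ C x (1, 0) with hD
  have hDinv : ∀ s, (rot s x).1 * fderiv ℂ C (rot s x) (1, 0) = D := by
    intro s
    have h1 : HasFDerivAt C (fderiv ℂ C (rot s x)) (rotL s x) := by
      rw [rotL_apply]
      exact (hC.differentiableAt (hΩ.isOpen.mem_nhds (hΩ.rot_mem x hx s))).hasFDerivAt
    have h2 := h1.comp x (rotL s).hasFDerivAt
    have h3 : HasFDerivAt C ((fderiv ℂ C (rot s x)).comp (rotL s)) x := by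
      refine h2.congr_of_eventuallyEq ?_
      filter_upwards [hΩ.isOpen.mem_nhds hx] with y hy
      rw [Function.comp_apply, rotL_apply, hinv y hy s]
    have h4 := congrArg (fun L => L (x.1, 0)) h3.fderiv
    simp only [ContinuousLinearMap.comp_apply, rotL_apply] at h4
    rw [hlin, zero_mul, add_zero, ← hD] at h4
    rw [h4]
    have h5 : rot s (x.1, 0) = ((rot s x).1, 0) := by simp [rot]
    rw [h5, hlin (rot s x) (rot s x).1 0, zero_mul, add_zero]
  have hprod : ∀ s, (rot s x).1 * (rot s x).2 = x.1 * x.2 := by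
    intro s
    simp only [rot]
    rw [Complex.exp_neg]
    have := Complex.exp_ne_zero (s * Complex.I)
    field_simp
  -- `i (a - b) / q` is periodic, so the integral of its derivative vanishes
  have hu : ∀ s, HasDerivAt (fun s => Complex.I * (((rot s x).1 - (rot s x).2) / qfun (rot s x)))
      (((rot s x).1 + (rot s x).2 - 2 * (x.1 * x.2)) / qfun (rot s x) ^ 2) s := by
    intro s
    have hr := hasDerivAt_rot s x
    have h1 : HasDerivAt (fun s => (rot s x).1) (-(Complex.I * (rot s x).1)) s := hr.fst
    have h2 : HasDerivAt (fun s => (rot s x).2) (Complex.I * (rot s x).2) s := hr.snd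
    have hq0 : qfun (rot s x) ≠ 0 := hΩ.qfun_ne_zero (hΩ.rot_mem x hx s)
    have hq : HasDerivAt (fun s => qfun (rot s x))
        (-((-(Complex.I * (rot s x).1) + Complex.I * (rot s x).2) / 2)) s := by
      unfold qfun
      exact ((h1.fun_add h2).div_const 2).const_sub 1
    refine (((h1.fun_sub h2).fun_div hq hq0).const_mul Complex.I).congr_deriv ?_
    rw [← hprod s, ← mul_div_assoc]
    congr 1
    rw [qfun]
    linear_combination (-(rot s x).1 - (rot s x).2 + 2 * (rot s x).1 * (rot s x).2) * Complex.I_sq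
  have heq : ∀ s : ℝ, (fun y => 1 / qfun y ^ 2 * fderiv ℂ C y (1 - y.1, 1 - y.2)) (rot s x) =
      D / (x.1 * x.2) *
        (((rot s x).1 + (rot s x).2 - 2 * (x.1 * x.2)) / qfun (rot s x) ^ 2) := by
    intro s
    have hy := hΩ.rot_mem x hx s
    have ha := hΩ.fst_ne_zero _ hy
    have hb := hΩ.snd_ne_zero _ hy
    have hq0 : qfun (rot s x) ≠ 0 := hΩ.qfun_ne_zero hy
    have h1 := hDinv s
    have h2 := hab _ hy
    simp only
    rw [hlin, ← hprod s, ← h1]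
    have h3 : fderiv ℂ C (rot s x) (0, 1) =
        (rot s x).1 * fderiv ℂ C (rot s x) (1, 0) / (rot s x).2 := by
      rw [h2]; field_simp
    rw [h3]
    field_simp
    ring
  unfold orbitMean
  rw [intervalIntegral.integral_const_mul, intervalIntegral.integral_congr (fun s _ => heq s),
    intervalIntegral.integral_const_mul]
  rw [intervalIntegral.integral_eq_sub_of_hasDerivAt (fun s _ => hu s)]
  · have : rot (2 * Real.pi) x = rot 0 x := by simpa using rot_add_two_pi 0 x
    rw [this]
    simp
  · refine Continuous.intervalIntegrable ?_ _ _
    have h1 := continuous_rot x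
    refine Continuous.div (by fun_prop) ((differentiable_qfun.continuous.comp h1).pow 2) fun s => ?_
    exact pow_ne_zero 2 (hΩ.qfun_ne_zero (hΩ.rot_mem x hx s))

theorem IsAveragingDomain.orbitMean_inv_sq_ne_zero (hΩ : IsAveragingDomain Ω) (hx : x ∈ Ω) :
    orbitMean (fun y => 1 / qfun y ^ 2) x ≠ 0 := by
  have hc : Continuous fun s => 1 / qfun (rot s x) ^ 2 := by
    refine Continuous.div continuous_const
      ((differentiable_qfun.continuous.comp (continuous_rot x)).pow 2) fun s => ?_
    exact pow_ne_zero 2 (hΩ.qfun_ne_zero (hΩ.rot_mem x hx s))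
  unfold orbitMean
  rw [intervalIntegral.integral_const_mul]
  refine mul_ne_zero (by simp [Real.pi_ne_zero]) fun h => ?_
  have h1 : ∫ s in (0 : ℝ)..(2 * Real.pi), (1 / qfun (rot s x) ^ 2).re = 0 := by
    have := Complex.reCLM.intervalIntegral_comp_comm (μ := volume)
      (hc.intervalIntegrable 0 (2 * Real.pi))
    rw [h] at this
    simpa using this
  have h2 : 0 < ∫ s in (0 : ℝ)..(2 * Real.pi), (1 / qfun (rot s x) ^ 2).re :=
    intervalIntegral.intervalIntegral_pos_of_pos
      ((Complex.continuous_re.comp hc).intervalIntegrable _ _)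
      (fun s => hΩ.re_pos _ (hΩ.rot_mem x hx s)) (by positivity)
  exact h2.ne' h1

theorem IsAveragingDomain.intervalIntegrable_comp_rot (hΩ : IsAveragingDomain Ω)
    (hg : ContinuousOn g Ω) (hx : x ∈ Ω) (c : ℂ) :
    IntervalIntegrable (fun s => c * g (rot s x)) volume 0 (2 * Real.pi) :=
  ((hΩ.continuous_comp_rot hg hx).const_mul c).intervalIntegrable _ _

theorem IsAveragingDomain.orbitMean_congr (hΩ : IsAveragingDomain Ω) (h : EqOn f g Ω)
    (hx : x ∈ Ω) : orbitMean f x = orbitMean g x :=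
  intervalIntegral.integral_congr fun s _ => by
    simp only [h (hΩ.rot_mem x hx s)]

theorem IsAveragingDomain.orbitMean_add (hΩ : IsAveragingDomain Ω) (hf : ContinuousOn f Ω)
    (hg : ContinuousOn g Ω) (hx : x ∈ Ω) :
    orbitMean (fun y => f y + g y) x = orbitMean f x + orbitMean g x := by
  unfold orbitMean
  simp only [mul_add]
  exact intervalIntegral.integral_add (hΩ.intervalIntegrable_comp_rot hf hx _)
    (hΩ.intervalIntegrable_comp_rot hg hx _)

theorem orbitMean_const_mul (c : ℂ) (g : ℂ × ℂ → ℂ) (x : ℂ × ℂ) :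
    orbitMean (fun y => c * g y) x = c * orbitMean g x := by
  unfold orbitMean
  rw [← intervalIntegral.integral_const_mul]
  refine intervalIntegral.integral_congr fun s _ => ?_
  simp only
  ring

theorem IsAveragingDomain.orbitMean_dragTerm_of_invariant (hΩ : IsAveragingDomain Ω) (δ : ℝ) (j : ℕ)
    (hC : DifferentiableOn ℂ C Ω) (hinv : ∀ x ∈ Ω, ∀ s, C (rot s x) = C x) (hx : x ∈ Ω) :
    orbitMean (dragTerm δ j C) x = -(3 * δ * j * C x) * orbitMean (fun y => 1 / qfun y ^ 2) x := by
  have hq := hΩ.differentiableOn_inv_sq.continuousOn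
  have hd : ContinuousOn (fun y => 1 / qfun y ^ 2 * fderiv ℂ C y (1 - y.1, 1 - y.2)) Ω :=
    hq.mul ((DifferentiableOn.fderiv_complex hΩ.isOpen hC).continuousOn.clm_apply (by fun_prop))
  have h1 : orbitMean (dragTerm δ j C) x =
      orbitMean (fun y => 2 * δ * (1 / qfun y ^ 2 * fderiv ℂ C y (1 - y.1, 1 - y.2)) +
        -(3 * δ * j * C x) * (1 / qfun y ^ 2)) x := by
    refine intervalIntegral.integral_congr fun s _ => ?_
    simp only [dragTerm, hinv x hx s]
    ring
  rw [h1, hΩ.orbitMean_add (hd.const_mul _) (hq.const_mul _) hx, orbitMean_const_mul,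
    orbitMean_const_mul, hΩ.orbitMean_fderiv_eq_zero hC hinv hx]
  ring

theorem IsAveragingDomain.dragTerm_add (hΩ : IsAveragingDomain Ω) (δ : ℝ) (j : ℕ)
    (hf : DifferentiableOn ℂ f Ω) (hg : DifferentiableOn ℂ g Ω) (hx : x ∈ Ω) :
    dragTerm δ j (fun y => f y + g y) x = dragTerm δ j f x + dragTerm δ j g x := by
  have hn := hΩ.isOpen.mem_nhds hx
  unfold dragTerm
  rw [fderiv_fun_add (hf.differentiableAt hn) (hg.differentiableAt hn), add_apply]
  ring

/-- One step of the averaging procedure. The invariant part of the new coefficient is chosen such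
that the homological equation of the next step is solvable. -/
theorem IsAveragingDomain.exists_next_coefficient (hΩ : IsAveragingDomain Ω) {δ : ℝ} (hδ : 0 < δ)
    (j : ℕ) (hf : DifferentiableOn ℂ f Ω) (hmean : ∀ x ∈ Ω, orbitMean (dragTerm δ j f) x = 0) :
    ∃ g : ℂ × ℂ → ℂ, DifferentiableOn ℂ g Ω ∧ (∀ x ∈ Ω, lieDeriv g x = -dragTerm δ j f x) ∧
      ∀ x ∈ Ω, orbitMean (dragTerm δ (j + 1) g) x = 0 := by
  have hT := hΩ.differentiableOn_dragTerm hf δ j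
  set g₀ : ℂ × ℂ → ℂ := fun x => -orbitPrimitive (dragTerm δ j f) x with hg₀
  have hg₀d : DifferentiableOn ℂ g₀ Ω := (hΩ.differentiableOn_orbitPrimitive hT).neg
  have hqd := hΩ.differentiableOn_inv_sq
  -- the drift of `n` contributes `-3 δ (j + 1) Cf` times the mean of `q⁻²`; this determines `Cf`
  set Cf : ℂ × ℂ → ℂ := fun x => orbitMean (dragTerm δ (j + 1) g₀) x /
    (3 * δ * (j + 1 : ℕ) * orbitMean (fun y => 1 / qfun y ^ 2) x) with hCf
  have hδ0 : (δ : ℂ) ≠ 0 := Complex.ofReal_ne_zero.2 hδ.ne'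
  have hj0 : ((j + 1 : ℕ) : ℂ) ≠ 0 := Nat.cast_ne_zero.2 (Nat.succ_ne_zero j)
  have hCd : DifferentiableOn ℂ Cf Ω := by
    have h1 := ((hΩ.differentiableOn_orbitMean hqd).const_mul (3 * δ * (j + 1 : ℕ) : ℂ)).fun_inv
      fun x hx => mul_ne_zero (mul_ne_zero (mul_ne_zero three_ne_zero hδ0) hj0)
        (hΩ.orbitMean_inv_sq_ne_zero hx)
    exact ((hΩ.differentiableOn_orbitMean (hΩ.differentiableOn_dragTerm hg₀d δ _)).mul h1).congr
      fun x _ => div_eq_mul_inv _ _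
  have hCinv : ∀ x ∈ Ω, ∀ s, Cf (rot s x) = Cf x := by
    intro x _ s
    simp only [hCf, orbitMean_rot]
  refine ⟨fun x => g₀ x + Cf x, hg₀d.add hCd, fun x hx => ?_, fun x hx => ?_⟩
  · have hn := hΩ.isOpen.mem_nhds hx
    have h1 : lieDeriv (fun x => g₀ x + Cf x) x = lieDeriv g₀ x + lieDeriv Cf x := by
      unfold lieDeriv
      rw [fderiv_fun_add (hg₀d.differentiableAt hn) (hCd.differentiableAt hn), add_apply]
    have h2 : lieDeriv Cf x = 0 := by
      have h1 := hΩ.hasDerivAt_comp_rot hCd hx 0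
      rw [rot_zero, show (fun s => Cf (rot s x)) = fun _ => Cf x from funext (hCinv x hx)] at h1
      exact h1.unique (hasDerivAt_const _ _)
    have h3 : lieDeriv g₀ x = -lieDeriv (orbitPrimitive (dragTerm δ j f)) x := by
      unfold lieDeriv
      rw [hg₀, fderiv_fun_neg, neg_apply]
    rw [h1, h2, h3, hΩ.lieDeriv_orbitPrimitive hT hx, hmean x hx]
    ring
  · rw [hΩ.orbitMean_congr (fun y hy => hΩ.dragTerm_add δ (j + 1) hg₀d hCd hy) hx,
      hΩ.orbitMean_add (hΩ.differentiableOn_dragTerm hg₀d δ _).continuousOn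
        (hΩ.differentiableOn_dragTerm hCd δ _).continuousOn hx,
      hΩ.orbitMean_dragTerm_of_invariant δ _ hCd hCinv hx, hCf]
    have h4 := hΩ.orbitMean_inv_sq_ne_zero hx
    field_simp
    ring

/-- The coefficients of a formal integral `∑ j, n⁻¹ ^ j * F j` of the perturbed system with leading
term `a b / 2`. -/
theorem IsAveragingDomain.exists_formalIntegral (hΩ : IsAveragingDomain Ω) {δ : ℝ} (hδ : 0 < δ) :
    ∃ F : ℕ → ℂ × ℂ → ℂ, (∀ x, F 0 x = x.1 * x.2 / 2) ∧ (∀ j, DifferentiableOn ℂ (F j) Ω) ∧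
      (∀ x ∈ Ω, lieDeriv (F 0) x = 0) ∧
      ∀ j, ∀ x ∈ Ω, lieDeriv (F (j + 1)) x = -dragTerm δ j (F j) x := by
  set f₀ : ℂ × ℂ → ℂ := fun x => x.1 * x.2 / 2 with hf₀
  have hd₀ : DifferentiableOn ℂ f₀ Ω := by
    simp only [hf₀]; fun_prop
  have hinv : ∀ x ∈ Ω, ∀ s, f₀ (rot s x) = f₀ x := by
    intro x _ s
    simp only [hf₀, rot]
    rw [Complex.exp_neg]
    have := Complex.exp_ne_zero (s * Complex.I)
    field_simp
  have hm₀ : ∀ x ∈ Ω, orbitMean (dragTerm δ 0 f₀) x = 0 := by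
    intro x hx
    rw [hΩ.orbitMean_dragTerm_of_invariant δ 0 hd₀ hinv hx]
    simp
  have step : ∀ (j : ℕ) (f : {f : ℂ × ℂ → ℂ // DifferentiableOn ℂ f Ω ∧
      ∀ x ∈ Ω, orbitMean (dragTerm δ j f) x = 0}), ∃ g : {f : ℂ × ℂ → ℂ // DifferentiableOn ℂ f Ω ∧
      ∀ x ∈ Ω, orbitMean (dragTerm δ (j + 1) f) x = 0},
      ∀ x ∈ Ω, lieDeriv g.1 x = -dragTerm δ j f.1 x := by
    rintro j ⟨f, hf, hm⟩
    obtain ⟨g, h1, h2, h3⟩ := hΩ.exists_next_coefficient hδ j hf hm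
    exact ⟨⟨g, h1, h3⟩, h2⟩
  choose next hnext using step
  set F : ∀ j : ℕ, {f : ℂ × ℂ → ℂ // DifferentiableOn ℂ f Ω ∧
      ∀ x ∈ Ω, orbitMean (dragTerm δ j f) x = 0} :=
    fun j => Nat.rec ⟨f₀, hd₀, hm₀⟩ (fun j f => next j f) j with hF
  refine ⟨fun j => (F j).1, fun x => rfl, fun j => (F j).2.1, fun x hx => ?_,
    fun j x hx => hnext j (F j) x hx⟩
  have h1 := hΩ.hasDerivAt_comp_rot hd₀ hx 0
  rw [rot_zero, show (fun s => f₀ (rot s x)) = fun _ => f₀ x from funext (hinv x hx)] at h1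
  exact h1.unique (hasDerivAt_const _ _)

end Averaging

/-! ### Complex neighbourhoods of the circles -/

section Annulus

open scoped ComplexConjugate

/-- A complex neighbourhood of the circle of radius `ρ` in the totally real plane `b = conj a`. -/
def annulus (ρ η : ℝ) : Set (ℂ × ℂ) :=
  {x | |‖x.1‖ - ρ| < η ∧ ‖x.2 - conj x.1‖ < η}

/-- The closed version of `annulus`. -/
def closedAnnulus (ρ η : ℝ) : Set (ℂ × ℂ) :=
  {x | |‖x.1‖ - ρ| ≤ η ∧ ‖x.2 - conj x.1‖ ≤ η}

variable {ρ η : ℝ} {x : ℂ × ℂ}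

theorem isOpen_annulus (ρ η : ℝ) : IsOpen (annulus ρ η) :=
  IsOpen.and (isOpen_lt (by fun_prop) continuous_const) (isOpen_lt (by fun_prop) continuous_const)

theorem annulus_subset_closedAnnulus (ρ η : ℝ) : annulus ρ η ⊆ closedAnnulus ρ η :=
  fun _ hx => ⟨hx.1.le, hx.2.le⟩

theorem closedAnnulus_subset_annulus {η' : ℝ} (h : η < η') : closedAnnulus ρ η ⊆ annulus ρ η' :=
  fun _ hx => ⟨hx.1.trans_lt h, hx.2.trans_lt h⟩

theorem isCompact_closedAnnulus (ρ η : ℝ) : IsCompact (closedAnnulus ρ η) := by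
  have hcl : IsClosed (closedAnnulus ρ η) := by
    rw [closedAnnulus, ofPred_and]
    exact (isClosed_le (by fun_prop) continuous_const).inter
      (isClosed_le (by fun_prop) continuous_const)
  refine Metric.isCompact_of_isClosed_isBounded hcl ?_
  refine (Metric.isBounded_closedBall (x := (0 : ℂ × ℂ)) (r := ρ + η + η)).subset ?_
  rintro ⟨a, b⟩ ⟨h1, h2⟩
  simp only at h1 h2
  have h3 := (abs_le.1 h1).2
  have h4 : 0 ≤ η := (norm_nonneg _).trans h2
  have h5 : ‖b‖ ≤ ‖b - conj a‖ + ‖conj a‖ := by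
    simpa using norm_add_le (b - conj a) (conj a)
  rw [RCLike.norm_conj] at h5
  rw [mem_closedBall_zero_iff, Prod.norm_mk]
  exact max_le (by linarith) (by linarith)

/-- On a thin annulus `a` and `b` do not vanish, and `q` is close enough to the positive real axis for
`q⁻²` to have real part bounded below. -/
theorem annulus_estimates (hη : 0 < η) (h1 : 2 * η ≤ ρ) (h2 : ρ + 4 * η ≤ 1)
    (hx : x ∈ annulus ρ η) :
    0 < ‖x.1‖ ∧ 0 < ‖x.2‖ ∧ 2 * η ≤ ‖qfun x‖ ∧ η ^ 2 / 16 ≤ (1 / qfun x ^ 2).re := by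
  obtain ⟨a, b⟩ := x
  obtain ⟨ha, hb⟩ := hx
  simp only at ha hb
  have ha' := abs_lt.1 ha
  have h5 : ‖conj a‖ ≤ ‖b - conj a‖ + ‖b‖ := by
    rw [norm_sub_rev]
    simpa using norm_add_le (conj a - b) b
  rw [RCLike.norm_conj] at h5
  have hre := abs_le.1 ((Complex.abs_re_le_norm (b - conj a)).trans hb.le)
  have him := abs_le.1 ((Complex.abs_im_le_norm (b - conj a)).trans hb.le)
  have har := abs_le.1 (Complex.abs_re_le_norm a)
  simp only [Complex.sub_re, Complex.sub_im, Complex.conj_re, Complex.conj_im] at hre him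
  have hqre : (qfun (a, b)).re = 1 - (a.re + b.re) / 2 := by
    simp [qfun]
  have hqim : (qfun (a, b)).im = -((a.im + b.im) / 2) := by
    simp [qfun]
  have b1 : 5 / 2 * η ≤ (qfun (a, b)).re := by rw [hqre]; linarith
  have b2 : (qfun (a, b)).re ≤ 9 / 4 := by rw [hqre]; linarith
  have b3 : |(qfun (a, b)).im| ≤ η / 2 := by
    rw [hqim, abs_le]; constructor <;> linarith
  refine ⟨by simp only; linarith, by simp only; linarith,
    by linarith [Complex.re_le_norm (qfun (a, b))], ?_⟩
  set X := (qfun (a, b)).re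
  set Y := (qfun (a, b)).im
  have hY : Y ^ 2 ≤ (η / 2) ^ 2 := by rw [← sq_abs]; gcongr
  have hX : (5 / 2 * η) ^ 2 ≤ X ^ 2 := by gcongr
  have hX' : X ^ 2 ≤ (9 / 4) ^ 2 := by
    have : 0 ≤ X := le_trans (by positivity) b1
    gcongr
  have hη1 : η ≤ 1 / 4 := by linarith
  have e : (1 / qfun (a, b) ^ 2).re = (X ^ 2 - Y ^ 2) / (X ^ 2 + Y ^ 2) ^ 2 := by
    rw [one_div, Complex.inv_re, map_pow, Complex.normSq_apply, sq (qfun (a, b)), Complex.mul_re]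
    ring
  rw [e, le_div_iff₀ (by nlinarith [sq_nonneg Y, sq_pos_of_pos hη])]
  have hη2 : 0 < η ^ 2 := by positivity
  have hη3 : η ^ 2 ≤ (1 / 4) ^ 2 := by gcongr
  have h6 : (X ^ 2 + Y ^ 2) ^ 2 ≤ 6 ^ 2 := by
    have : X ^ 2 + Y ^ 2 ≤ 6 := by linarith
    gcongr
  calc η ^ 2 / 16 * (X ^ 2 + Y ^ 2) ^ 2 ≤ η ^ 2 / 16 * 6 ^ 2 := by gcongr
    _ ≤ X ^ 2 - Y ^ 2 := by linarith

theorem isAveragingDomain_annulus (hη : 0 < η) (h1 : 2 * η ≤ ρ) (h2 : ρ + 4 * η ≤ 1) :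
    IsAveragingDomain (annulus ρ η) where
  isOpen := isOpen_annulus ρ η
  rot_mem x hx s := by
    have e1 : ‖Complex.exp (-(s * Complex.I))‖ = 1 := by
      rw [← neg_mul, ← Complex.ofReal_neg, Complex.norm_exp_ofReal_mul_I]
    have e2 : conj (Complex.exp (-(s * Complex.I))) = Complex.exp (s * Complex.I) := by
      rw [← Complex.exp_conj]
      simp
    refine ⟨?_, ?_⟩
    · simp only [rot, norm_mul, e1, one_mul]
      exact hx.1
    · simp only [rot, map_mul, e2, ← mul_sub, norm_mul, Complex.norm_exp_ofReal_mul_I, one_mul]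
      exact hx.2
  fst_ne_zero x hx := norm_pos_iff.1 (annulus_estimates hη h1 h2 hx).1
  snd_ne_zero x hx := norm_pos_iff.1 (annulus_estimates hη h1 h2 hx).2.1
  re_pos x hx := lt_of_lt_of_le (by positivity) (annulus_estimates hη h1 h2 hx).2.2.2

end Annulus

/-! ### Functions with decaying derivative -/

section Decay

variable {E : Type*} [NormedAddCommGroup E] [NormedSpace ℝ E]

/-- A function whose derivative decays like `(m + c s) ^ (-N - 1)` varies little. -/
theorem norm_sub_le_of_norm_deriv_le_decay {f f' : ℝ → E} {s t m c C : ℝ} {N : ℕ} (hc : 0 < c)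
    (hm : 0 < m + c * s) (hC : 0 ≤ C) (hN : 1 ≤ N) (hst : s ≤ t)
    (hf : ∀ u ∈ Icc s t, HasDerivWithinAt f (f' u) (Icc s t) u)
    (hb : ∀ u ∈ Icc s t, ‖f' u‖ ≤ C / (m + c * u) ^ (N + 1)) :
    ‖f t - f s‖ ≤ C / (c * (m + c * s) ^ N) := by
  have hpos : ∀ u ∈ Icc s t, 0 < m + c * u := fun u hu => by
    nlinarith [mul_le_mul_of_nonneg_left hu.1 hc.le]
  have hN0 : (0 : ℝ) < N := by exact_mod_cast hN
  set B : ℝ → ℝ := fun u => C / (c * N) * (1 / (m + c * s) ^ N - 1 / (m + c * u) ^ N) with hB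
  have hBd : ∀ u ∈ Icc s t, HasDerivAt B (C / (m + c * u) ^ (N + 1)) u := by
    intro u hu
    have hu0 := (hpos u hu).ne'
    have h1 : HasDerivAt (fun u => m + c * u) c u := by
      simpa using ((hasDerivAt_id u).const_mul c).const_add m
    have h2 := (((h1.fun_pow N).fun_inv (pow_ne_zero N hu0)).const_sub
      (1 / (m + c * s) ^ N)).const_mul (C / (c * N))
    simp only [hB, one_div] at h2 ⊢
    refine h2.congr_deriv ?_
    obtain ⟨n, rfl⟩ : ∃ n, N = n + 1 := ⟨N - 1, by omega⟩
    simp only [Nat.add_sub_cancel]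
    field_simp
    ring
  have hfd : ∀ u ∈ Ico s t, HasDerivWithinAt (fun u => f u - f s) (f' u) (Ici u) u := fun u hu =>
    ((hf u ⟨hu.1, hu.2.le⟩).mono_of_mem_nhdsWithin
      (mem_of_superset (Icc_mem_nhdsGE hu.2) (Icc_subset_Icc_left hu.1))).sub_const _
  have key := image_norm_le_of_norm_deriv_right_le_deriv_boundary' (f := fun u => f u - f s)
    (f' := f') (a := s) (b := t) (B := B) (B' := fun u => C / (m + c * u) ^ (N + 1))
    (fun u hu => ((hf u hu).sub_const (f s)).continuousWithinAt) hfd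
    (by simp [hB]) (fun u hu => (hBd u hu).continuousAt.continuousWithinAt)
    (fun u hu => (hBd u ⟨hu.1, hu.2.le⟩).hasDerivWithinAt)
    (fun u hu => hb u ⟨hu.1, hu.2.le⟩) (x := t) ⟨hst, le_rfl⟩
  refine key.trans ?_
  have h3 := hpos t ⟨hst, le_rfl⟩
  have hN1 : (1 : ℝ) ≤ N := by exact_mod_cast hN
  calc B t ≤ C / (c * N) * (1 / (m + c * s) ^ N) := by
        simp only [hB]
        gcongr
        have : 0 ≤ 1 / (m + c * t) ^ N := by positivity
        linarith
    _ ≤ C / (c * 1) * (1 / (m + c * s) ^ N) := by gcongr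
    _ = C / (c * (m + c * s) ^ N) := by field_simp

end Decay

/-! ### The complexified system -/

section ComplexFlow

open scoped ComplexConjugate

/-- The complexified system in the coordinates `a = w + i v`, `b = w - i v`, `n = l⁻³` where
`w = 1 - 1 / r₁`, with the time rescaled by the factor `r₁⁻²`. -/
def complexField (δ : ℝ) (p : ℂ × ℂ × ℂ) : ℂ × ℂ × ℂ :=
  (-(Complex.I * p.1) + 2 * δ / p.2.2 * ((1 - p.1) / qfun (p.1, p.2.1) ^ 2),
   Complex.I * p.2.1 + 2 * δ / p.2.2 * ((1 - p.2.1) / qfun (p.1, p.2.1) ^ 2),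
   3 * δ / qfun (p.1, p.2.1) ^ 2)

/-- The points over `annulus ρ η` with `Re n > m`. -/
def farRegion (ρ η m : ℝ) : Set (ℂ × ℂ × ℂ) :=
  {p | (p.1, p.2.1) ∈ annulus ρ η ∧ m < p.2.2.re}

theorem isOpen_farRegion (ρ η m : ℝ) : IsOpen (farRegion ρ η m) :=
  IsOpen.and ((isOpen_annulus ρ η).preimage
    (f := fun p : ℂ × ℂ × ℂ => (p.1, p.2.1)) (by fun_prop))
    (isOpen_lt continuous_const (by fun_prop))

theorem differentiableOn_complexField (δ : ℝ) {O : Set (ℂ × ℂ × ℂ)}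
    (hO : ∀ p ∈ O, qfun (p.1, p.2.1) ≠ 0 ∧ p.2.2 ≠ 0) :
    DifferentiableOn ℂ (complexField δ) O := by
  have hq : DifferentiableOn ℂ (fun p : ℂ × ℂ × ℂ => (qfun (p.1, p.2.1) ^ 2)⁻¹) O := by
    refine DifferentiableOn.fun_inv ?_ fun p hp => pow_ne_zero 2 (hO p hp).1
    unfold qfun
    fun_prop
  have hn : DifferentiableOn ℂ (fun p : ℂ × ℂ × ℂ => (p.2.2)⁻¹) O :=
    DifferentiableOn.fun_inv (by fun_prop) fun p hp => (hO p hp).2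
  unfold complexField
  simp only [div_eq_mul_inv]
  fun_prop

variable {δ : ℝ}

theorem hasDerivWithinAt_complex_components {γ : ℝ → ℂ × ℂ × ℂ} {S : Set ℝ} {s : ℝ}
    (h : HasDerivWithinAt γ (complexField δ (γ s)) S s) :
    HasDerivWithinAt (fun s => (γ s).1) (complexField δ (γ s)).1 S s ∧
    HasDerivWithinAt (fun s => (γ s).2.1) (complexField δ (γ s)).2.1 S s ∧
    HasDerivWithinAt (fun s => (γ s).2.2) (complexField δ (γ s)).2.2 S s :=
  ⟨h.fst, h.snd.fst, h.snd.snd⟩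

/-- Up to a correction of order `n⁻¹` the rotating coordinate `exp (u s) z` is constant up to
order `n⁻²`. This applies with `u = i` to `z = a` and with `u = -i` to `z = b`. -/
theorem hasDerivWithinAt_adiabaticInvariant {u : ℂ} (hu : u ^ 2 = -1) {z n q : ℝ → ℂ} {S : Set ℝ}
    {s : ℝ} (hn0 : n s ≠ 0) (hq0 : q s ≠ 0)
    (hz : HasDerivWithinAt z (-(u * z s) + 2 * δ / n s * ((1 - z s) / q s ^ 2)) S s)
    (hn : HasDerivWithinAt n (3 * δ / q s ^ 2) S s)
    (hq : HasDerivWithinAt q (u * (z s - 1 + q s) - 2 * δ / (n s * q s)) S s) :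
    HasDerivWithinAt (fun s : ℝ => Complex.exp (u * s) * (z s + 2 * δ * u / (n s * q s)))
      (Complex.exp (u * s) * (-(2 * δ ^ 2 * u) / (n s ^ 2 * q s ^ 3))) S s := by
  have h0 : HasDerivWithinAt (fun s : ℝ => Complex.exp (u * s)) (Complex.exp (u * s) * u) S s := by
    have : HasDerivAt (fun s : ℝ => u * (s : ℂ)) u s := by
      simpa using (Complex.ofRealCLM.hasDerivAt (x := s)).const_mul u
    exact this.cexp.hasDerivWithinAt
  have h1 := ((hasDerivWithinAt_const s S (2 * δ * u : ℂ)).fun_div (hn.fun_mul hq)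
    (mul_ne_zero hn0 hq0))
  refine (h0.fun_mul (hz.fun_add h1)).congr_deriv ?_
  rw [mul_pow]
  field_simp
  linear_combination (2 * δ * n s * q s * (1 - z s)) * hu

/-- The drift of the rotating coordinates is of order `1 / m`, uniformly in time. -/
theorem norm_rotating_sub_le (hδ : 0 < δ) {u : ℂ} (hu : u ^ 2 = -1) (hu1 : u.re = 0)
    {z n q : ℝ → ℂ} {T m c κ : ℝ} (hm : 0 < m) (hc : 0 < c) (hκ : 0 < κ)
    (hq0 : ∀ s ∈ Icc 0 T, κ ≤ ‖q s‖) (hn0 : ∀ s ∈ Icc 0 T, m + c * s ≤ (n s).re)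
    (hz : ∀ s ∈ Icc 0 T, HasDerivWithinAt z
      (-(u * z s) + 2 * δ / n s * ((1 - z s) / q s ^ 2)) (Icc 0 T) s)
    (hn : ∀ s ∈ Icc 0 T, HasDerivWithinAt n (3 * δ / q s ^ 2) (Icc 0 T) s)
    (hq : ∀ s ∈ Icc 0 T, HasDerivWithinAt q
      (u * (z s - 1 + q s) - 2 * δ / (n s * q s)) (Icc 0 T) s) {s : ℝ} (hs : s ∈ Icc 0 T) :
    ‖Complex.exp (u * s) * z s - z 0‖ ≤ (2 * δ ^ 2 / (κ ^ 3 * c) + 4 * δ / κ) / m := by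
  have hsub : Icc 0 s ⊆ Icc 0 T := Icc_subset_Icc_right hs.2
  have hexp : ∀ t : ℝ, ‖Complex.exp (u * t)‖ = 1 := fun t => by
    rw [Complex.norm_exp]
    simp [hu1]
  have hun : ‖u‖ = 1 := by
    have : ‖u‖ ^ 2 = 1 := by rw [← norm_pow, hu]; simp
    exact (pow_eq_one_iff_of_nonneg (norm_nonneg _) two_ne_zero).1 this
  have hn1 : ∀ t ∈ Icc 0 T, m + c * t ≤ ‖n t‖ := fun t ht =>
    (hn0 t ht).trans (Complex.re_le_norm _)
  have hpos : ∀ t ∈ Icc 0 T, 0 < m + c * t := fun t ht => by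
    have := ht.1
    positivity
  have hn2 : ∀ t ∈ Icc 0 T, n t ≠ 0 := fun t ht =>
    norm_pos_iff.1 ((hpos t ht).trans_le (hn1 t ht))
  have hq2 : ∀ t ∈ Icc 0 T, q t ≠ 0 := fun t ht => norm_pos_iff.1 (hκ.trans_le (hq0 t ht))
  have h1 := norm_sub_le_of_norm_deriv_le_decay (s := 0) (t := s) (m := m) (c := c)
    (C := 2 * δ ^ 2 / κ ^ 3) (N := 1) hc (by simpa using hm) (by positivity) le_rfl hs.1
    (fun t ht => (hasDerivWithinAt_adiabaticInvariant hu (hn2 t (hsub ht)) (hq2 t (hsub ht))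
      (hz t (hsub ht)) (hn t (hsub ht)) (hq t (hsub ht))).mono hsub) (fun t ht => by
      rw [norm_mul, hexp, one_mul, norm_div, norm_neg, norm_mul, norm_mul, norm_mul, hun,
        norm_pow, norm_pow, norm_pow, Complex.norm_real, Real.norm_of_nonneg hδ.le, mul_one,
        div_div, mul_comm (κ ^ 3)]
      simp only [Complex.norm_ofNat, Nat.reduceAdd]
      have := hpos t (hsub ht)
      gcongr
      · exact hn1 t (hsub ht)
      · exact hq0 t (hsub ht))
  have h2 : ∀ t ∈ Icc 0 T, ‖Complex.exp (u * t) * (2 * δ * u / (n t * q t))‖ ≤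
      2 * δ / (m * κ) := fun t ht => by
    rw [norm_mul, hexp, one_mul, norm_div, norm_mul, norm_mul, norm_mul, hun, Complex.norm_real,
      Real.norm_of_nonneg hδ.le, mul_one, Complex.norm_ofNat]
    gcongr
    · have := hn1 t ht
      nlinarith [ht.1]
    · exact hq0 t ht
  have h3 := h2 s hs
  have h4 := h2 0 ⟨le_rfl, hs.1.trans hs.2⟩
  have e : Complex.exp (u * s) * z s - z 0 =
      (Complex.exp (u * s) * (z s + 2 * δ * u / (n s * q s)) -
        Complex.exp (u * (0 : ℝ)) * (z 0 + 2 * δ * u / (n 0 * q 0))) -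
      Complex.exp (u * s) * (2 * δ * u / (n s * q s)) +
      Complex.exp (u * (0 : ℝ)) * (2 * δ * u / (n 0 * q 0)) := by
    simp only [Complex.ofReal_zero, mul_zero, Complex.exp_zero]
    ring
  rw [e]
  refine (norm_add_le _ _).trans ((add_le_add ((norm_sub_le _ _).trans (add_le_add h1 h3))
    h4).trans (le_of_eq ?_))
  field_simp
  ring

variable {ρ η : ℝ}

/-- Orbits starting over a thin annulus far out stay over a wider annulus, and `n` grows at a
linear rate. -/
theorem exists_confinement (hδ : 0 < δ) (hη : 0 < η) (h1 : 6 * η ≤ ρ) (h2 : ρ + 12 * η ≤ 1) :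
    ∃ m₀ c c' : ℝ, 1 ≤ m₀ ∧ 0 < c ∧ ∀ p ∈ farRegion ρ η m₀, ∀ (T : ℝ) (γ : ℝ → ℂ × ℂ × ℂ),
      γ 0 = p → IsSolutionOn (complexField δ) (farRegion ρ (3 * η) 0) T γ → ∀ s ∈ Icc 0 T,
        p.2.2.re + c * s ≤ (γ s).2.2.re ∧ ‖(γ s).2.2‖ ≤ ‖p.2.2‖ + c' * s ∧
        ((γ s).1, (γ s).2.1) ∈ closedAnnulus ρ (2 * η) := by
  set c := 3 * δ * ((3 * η) ^ 2 / 16) with hc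
  have hc0 : 0 < c := by positivity
  set κ := 6 * η with hκ
  have hκ0 : 0 < κ := by positivity
  set C := 2 * δ ^ 2 / (κ ^ 3 * c) + 4 * δ / κ with hC
  have hC0 : 0 < C := by positivity
  -- beyond `4 C / η` the rotating coordinates move by at most `η / 4`
  refine ⟨1 + C * 4 / η, c, 3 * δ / κ ^ 2, by linarith [show 0 < C * 4 / η by positivity], hc0, ?_⟩
  rintro p ⟨hp1, hp2⟩ T γ h0 hγ
  have hm : 0 < p.2.2.re := lt_trans (by positivity) hp2
  have hest : ∀ s ∈ Icc 0 T, κ ≤ ‖qfun ((γ s).1, (γ s).2.1)‖ ∧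
      (3 * η) ^ 2 / 16 ≤ (1 / qfun ((γ s).1, (γ s).2.1) ^ 2).re := fun s hs => by
    have := annulus_estimates (by positivity) (by linarith) (by linarith) (hγ s hs).1.1
    exact ⟨by simp only [hκ]; linarith [this.2.2.1], this.2.2.2⟩
  have hd := fun s hs => hasDerivWithinAt_complex_components (hγ s hs).2
  have hn : ∀ s ∈ Icc 0 T, HasDerivWithinAt (fun s => (γ s).2.2)
    (3 * δ / qfun ((γ s).1, (γ s).2.1) ^ 2) (Icc 0 T) s := fun s hs => (hd s hs).2.2
  have hnre : ∀ s ∈ Icc 0 T, p.2.2.re + c * s ≤ (γ s).2.2.re := by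
    have hmono : MonotoneOn (fun s => (γ s).2.2.re - c * s) (Icc 0 T) := by
      have hder : ∀ s ∈ Icc 0 T, HasDerivWithinAt (fun s => (γ s).2.2.re - c * s)
          ((3 * δ / qfun ((γ s).1, (γ s).2.1) ^ 2).re - c) (Icc 0 T) s := fun s hs => by
        have a1 : HasDerivWithinAt (fun s => (γ s).2.2.re) _ _ s :=
          Complex.reCLM.hasFDerivAt.comp_hasDerivWithinAt s (hn s hs)
        have a2 := ((hasDerivAt_id s).const_mul c).hasDerivWithinAt (s := Icc 0 T)
        refine (a1.fun_sub a2).congr_deriv ?_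
        simp
      refine monotoneOn_of_hasDerivWithinAt_nonneg (convex_Icc 0 T)
        (fun s hs => (hder s hs).continuousWithinAt)
        (fun s hs => (hder s (interior_subset hs)).mono interior_subset) fun s hs => ?_
      have h3 := (hest s (interior_subset hs)).2
      have e : (3 * δ / qfun ((γ s).1, (γ s).2.1) ^ 2 : ℂ).re =
          3 * δ * (1 / qfun ((γ s).1, (γ s).2.1) ^ 2).re := by
        rw [show (3 * δ / qfun ((γ s).1, (γ s).2.1) ^ 2 : ℂ) =
          ((3 * δ : ℝ) : ℂ) * (1 / qfun ((γ s).1, (γ s).2.1) ^ 2) by push_cast; ring,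
          Complex.re_ofReal_mul]
      rw [e, hc, sub_nonneg]
      gcongr
    intro s hs
    have := hmono ⟨le_rfl, hs.1.trans hs.2⟩ hs hs.1
    simp only [h0, mul_zero, sub_zero] at this
    linarith
  have hq : ∀ u z : ℂ, ∀ s ∈ Icc 0 T, u = Complex.I ∧ z = (γ s).1 ∨ u = -Complex.I ∧ z = (γ s).2.1 →
      HasDerivWithinAt (fun s => qfun ((γ s).1, (γ s).2.1))
        (u * (z - 1 + qfun ((γ s).1, (γ s).2.1)) -
          2 * δ / ((γ s).2.2 * qfun ((γ s).1, (γ s).2.1))) (Icc 0 T) s := by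
    intro u z s hs huz
    have hq0 : qfun ((γ s).1, (γ s).2.1) ≠ 0 :=
      norm_pos_iff.1 (hκ0.trans_le (hest s hs).1)
    have hn0 : (γ s).2.2 ≠ 0 := by
      intro h
      have := (hγ s hs).1.2
      simp [h] at this
    have := (((hd s hs).1.fun_add (hd s hs).2.1).div_const 2).const_sub 1
    refine HasDerivWithinAt.congr_deriv this ?_
    simp only [complexField]
    have e : (1 - (γ s).1) / qfun ((γ s).1, (γ s).2.1) ^ 2 +
        (1 - (γ s).2.1) / qfun ((γ s).1, (γ s).2.1) ^ 2 = 2 / qfun ((γ s).1, (γ s).2.1) := by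
      field_simp
      rw [qfun]
      ring
    have e' : (γ s).2.2 ≠ 0 := hn0
    rcases huz with ⟨rfl, rfl⟩ | ⟨rfl, rfl⟩
    · rw [show ∀ x y z A B : ℂ, -((-(Complex.I * x) + z * A + (Complex.I * y + z * B)) / 2) =
        Complex.I * (x - y) / 2 - z / 2 * (A + B) by intros; ring, e]
      rw [← div_div, qfun]
      ring
    · rw [show ∀ x y z A B : ℂ, -((-(Complex.I * x) + z * A + (Complex.I * y + z * B)) / 2) =
        Complex.I * (x - y) / 2 - z / 2 * (A + B) by intros; ring, e]
      rw [← div_div, qfun]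
      ring
  intro s hs
  refine ⟨hnre s hs, ?_, ?_⟩
  · have h3 := norm_image_sub_le_of_norm_deriv_le_segment' (C := 3 * δ / κ ^ 2) hn (fun t ht => by
      rw [norm_div, norm_mul, norm_pow, Complex.norm_real, Real.norm_of_nonneg hδ.le,
        Complex.norm_ofNat]
      gcongr
      exact (hest t ⟨ht.1, ht.2.le⟩).1) s hs
    simp only [h0, sub_zero] at h3
    linarith [norm_sub_norm_le (γ s).2.2 p.2.2]
  · have hI : (Complex.I) ^ 2 = -1 := Complex.I_sq
    have hI' : (-Complex.I) ^ 2 = -1 := by rw [neg_sq, Complex.I_sq]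
    have r1 := norm_rotating_sub_le hδ hI (by simp) hm hc0 hκ0 (fun s hs => (hest s hs).1) hnre
      (fun s hs => (hd s hs).1) hn (fun s hs => hq _ _ s hs (Or.inl ⟨rfl, rfl⟩)) hs
    have r2 := norm_rotating_sub_le hδ hI' (by simp) hm hc0 hκ0 (fun s hs => (hest s hs).1) hnre
      (fun s hs => (hd s hs).2.1.congr_deriv (by simp [complexField])) hn
      (fun s hs => hq _ _ s hs (Or.inr ⟨rfl, rfl⟩)) hs
    have hCm : C / p.2.2.re ≤ η / 4 := by
      rw [div_le_iff₀ hm]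
      have : C * 4 / η ≤ p.2.2.re := by linarith
      rw [div_le_iff₀ hη] at this
      linarith
    rw [← hC, h0] at r1 r2
    have n1 : ‖Complex.exp (Complex.I * s) * (γ s).1‖ = ‖(γ s).1‖ := by
      rw [norm_mul, mul_comm Complex.I, Complex.norm_exp_ofReal_mul_I, one_mul]
    refine ⟨?_, ?_⟩
    · simp only
      rw [← n1]
      have h3 := abs_norm_sub_norm_le (Complex.exp (Complex.I * s) * (γ s).1) p.1
      have h4 := hp1.1
      simp only at h4
      calc |‖Complex.exp (Complex.I * s) * (γ s).1‖ - ρ|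
          ≤ |‖Complex.exp (Complex.I * s) * (γ s).1‖ - ‖p.1‖| + |‖p.1‖ - ρ| := abs_sub_le _ _ _
        _ ≤ 2 * η := by linarith
    -- `exp (-i s) b - conj (exp (i s) a)` is compared with its initial value
    · have e1 : conj (Complex.exp (Complex.I * s)) = Complex.exp (-Complex.I * s) := by
        rw [← Complex.exp_conj]
        simp
      have n2 : ‖Complex.exp (-Complex.I * s)‖ = 1 := by
        rw [neg_mul, mul_comm, ← neg_mul, ← Complex.ofReal_neg, Complex.norm_exp_ofReal_mul_I]
      have e2 : Complex.exp (-Complex.I * s) * ((γ s).2.1 - conj (γ s).1) =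
          (Complex.exp (-Complex.I * s) * (γ s).2.1 - p.2.1) + (p.2.1 - conj p.1) -
            conj (Complex.exp (Complex.I * s) * (γ s).1 - p.1) := by
        rw [map_sub, map_mul, e1]
        ring
      simp only
      rw [← one_mul ‖(γ s).2.1 - conj (γ s).1‖, ← n2, ← norm_mul, e2]
      refine (norm_sub_le _ _).trans ((add_le_add_left (norm_add_le _ _) _).trans ?_)
      rw [RCLike.norm_conj]
      have h4 := hp1.2
      simp only at h4
      linarith

end ComplexFlow

/-! ### Asymptotic expansion of the limiting Hamiltonian -/

section HolomorphicLimit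

variable {δ ρ η : ℝ}

theorem qfun_ne_zero_of_mem_farRegion (hη : 0 < η) (h1 : 6 * η ≤ ρ) (h2 : ρ + 12 * η ≤ 1)
    {p : ℂ × ℂ × ℂ} (hp : p ∈ farRegion ρ (3 * η) 0) :
    qfun (p.1, p.2.1) ≠ 0 ∧ p.2.2 ≠ 0 := by
  refine ⟨(isAveragingDomain_annulus (by positivity) (by linarith) (by linarith)).qfun_ne_zero hp.1,
    fun h => ?_⟩
  have := hp.2
  simp [h] at this

/-- The complex system has global solutions far out. -/
theorem exists_complexFlow (hδ : 0 < δ) (hη : 0 < η) (h1 : 6 * η ≤ ρ) (h2 : ρ + 12 * η ≤ 1) :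
    ∃ (m₀ c : ℝ) (ψ : ℂ × ℂ × ℂ → ℝ → ℂ × ℂ × ℂ), 1 ≤ m₀ ∧ 0 < c ∧ ∀ p ∈ farRegion ρ η m₀,
      ψ p 0 = p ∧ IsGlobalSolution (complexField δ) (farRegion ρ (3 * η) 0) (ψ p) ∧
      ∀ s, 0 ≤ s → p.2.2.re + c * s ≤ (ψ p s).2.2.re ∧
        ((ψ p s).1, (ψ p s).2.1) ∈ closedAnnulus ρ (2 * η) := by
  obtain ⟨m₀, c, c', hm₀, hc, hconf⟩ := exists_confinement hδ hη h1 h2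
  have hO := isOpen_farRegion ρ (3 * η) 0
  have hV := differentiableOn_complexField δ (O := farRegion ρ (3 * η) 0)
    fun p hp => qfun_ne_zero_of_mem_farRegion hη h1 h2 hp
  have hV1 : ContDiffOn ℝ 1 (complexField δ) (farRegion ρ (3 * η) 0) :=
    (DifferentiableOn.contDiffOn_complex hO hV 1).restrict_scalars ℝ
  have hex : ∀ p ∈ farRegion ρ η m₀, ∃ γ : ℝ → ℂ × ℂ × ℂ, γ 0 = p ∧
      IsGlobalSolution (complexField δ) (farRegion ρ (3 * η) 0) γ := by
    intro p hp
    have hpre : 0 < p.2.2.re := lt_of_lt_of_le (by linarith) hp.2.le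
    refine exists_isGlobalSolution hO hV1
      ⟨closedAnnulus_subset_annulus (η := η) (by linarith) (annulus_subset_closedAnnulus _ _ hp.1),
        hpre⟩ fun T hT => ?_
    refine ⟨(fun y : (ℂ × ℂ) × ℂ => (y.1.1, y.1.2, y.2)) ''
      (closedAnnulus ρ (2 * η) ×ˢ (closedBall 0 (‖p.2.2‖ + |c'| * T) ∩ {n | p.2.2.re ≤ n.re})),
      ?_, ?_, ?_⟩
    · rintro _ ⟨⟨x, n⟩, ⟨hx, -, hn⟩, rfl⟩
      exact ⟨closedAnnulus_subset_annulus (by linarith) hx, hpre.trans_le hn⟩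
    · refine IsCompact.image ((isCompact_closedAnnulus _ _).prod
        ((isCompact_closedBall _ _).inter_right
          (isClosed_le continuous_const Complex.continuous_re))) (by fun_prop)
    · intro τ hτ γ h0 hγ
      obtain ⟨a1, a2, a3⟩ := hconf p hp τ γ h0 hγ τ ⟨hτ.1, le_rfl⟩
      refine ⟨(((γ τ).1, (γ τ).2.1), (γ τ).2.2), ⟨a3, ?_, ?_⟩, rfl⟩
      · rw [mem_closedBall_zero_iff]
        refine a2.trans ?_
        gcongr
        · exact hτ.1
        · exact le_abs_self c'
        · exact hτ.2
      · have := mul_nonneg hc.le hτ.1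
        show p.2.2.re ≤ (γ τ).2.2.re
        linarith
  classical
  refine ⟨m₀, c, fun p => if hp : p ∈ farRegion ρ η m₀ then Classical.choose (hex p hp) else
    fun _ => p, hm₀, hc, fun p hp => ?_⟩
  simp only [dif_pos hp]
  obtain ⟨b1, b2⟩ := Classical.choose_spec (hex p hp)
  exact ⟨b1, b2, fun s hs =>
    have := hconf p hp s _ b1 (b2.isSolutionOn s) s ⟨hs, le_rfl⟩
    ⟨this.1, this.2.2⟩⟩

/-- The partial sum of order `N` of the formal integral with the coefficients `F j`. -/
def partialIntegral (F : ℕ → ℂ × ℂ → ℂ) (N : ℕ) (p : ℂ × ℂ × ℂ) : ℂ :=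
  ∑ j ∈ Finset.range (N + 1), (p.2.2)⁻¹ ^ j * F j (p.1, p.2.1)

theorem hasDerivWithinAt_inv_pow_mul {Ω : Set (ℂ × ℂ)} (hΩ : IsAveragingDomain Ω)
    {f : ℂ × ℂ → ℂ} (hf : DifferentiableOn ℂ f Ω) (j : ℕ) {γ : ℝ → ℂ × ℂ × ℂ} {S : Set ℝ} {s : ℝ}
    (hx : ((γ s).1, (γ s).2.1) ∈ Ω) (hn : (γ s).2.2 ≠ 0)
    (hγ : HasDerivWithinAt γ (complexField δ (γ s)) S s) :
    HasDerivWithinAt (fun s => ((γ s).2.2)⁻¹ ^ j * f ((γ s).1, (γ s).2.1))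
      (((γ s).2.2)⁻¹ ^ j * lieDeriv f ((γ s).1, (γ s).2.1) +
        ((γ s).2.2)⁻¹ ^ (j + 1) * dragTerm δ j f ((γ s).1, (γ s).2.1)) S s := by
  obtain ⟨h1, h2, h3⟩ := hasDerivWithinAt_complex_components hγ
  have hq := hΩ.qfun_ne_zero hx
  have hfd : HasFDerivAt f (fderiv ℂ f ((γ s).1, (γ s).2.1)) ((γ s).1, (γ s).2.1) :=
    (hf.differentiableAt (hΩ.isOpen.mem_nhds hx)).hasFDerivAt
  have h4 : HasDerivWithinAt (fun s => f ((γ s).1, (γ s).2.1))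
      (fderiv ℂ f ((γ s).1, (γ s).2.1) ((complexField δ (γ s)).1, (complexField δ (γ s)).2.1)) S s :=
    HasFDerivAt.comp_hasDerivWithinAt (f := fun s => ((γ s).1, (γ s).2.1)) s
      (hfd.restrictScalars ℝ) (h1.prodMk h2)
  have h5 : fderiv ℂ f ((γ s).1, (γ s).2.1)
      ((complexField δ (γ s)).1, (complexField δ (γ s)).2.1) =
      lieDeriv f ((γ s).1, (γ s).2.1) + 2 * δ / (γ s).2.2 / qfun ((γ s).1, (γ s).2.1) ^ 2 *
        fderiv ℂ f ((γ s).1, (γ s).2.1) (1 - (γ s).1, 1 - (γ s).2.1) := by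
    have e : (((complexField δ (γ s)).1, (complexField δ (γ s)).2.1) : ℂ × ℂ) =
        (-(Complex.I * (γ s).1), Complex.I * (γ s).2.1) +
        (2 * δ / (γ s).2.2 / qfun ((γ s).1, (γ s).2.1) ^ 2) •
          ((1 - (γ s).1, 1 - (γ s).2.1) : ℂ × ℂ) := by
      simp only [complexField, Prod.smul_mk, Prod.mk_add_mk, smul_eq_mul]
      refine Prod.ext ?_ ?_ <;> · simp only; ring
    rw [e, map_add, map_smul, smul_eq_mul]
    rfl
  rw [h5] at h4
  refine (((h3.fun_inv hn).fun_pow j).fun_mul h4).congr_deriv ?_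
  simp only [dragTerm, complexField]
  rcases j with _ | j
  · simp only [Nat.cast_zero, pow_zero, zero_add, pow_one]
    field_simp
    ring
  · simp only [Nat.add_sub_cancel, inv_pow]
    field_simp
    ring

/-- Along solutions the partial sum of order `N` only varies at the order `n⁻¹ ^ (N + 1)`. -/
theorem hasDerivWithinAt_partialIntegral {Ω : Set (ℂ × ℂ)} (hΩ : IsAveragingDomain Ω)
    {F : ℕ → ℂ × ℂ → ℂ} (hF : ∀ j, DifferentiableOn ℂ (F j) Ω)
    (hF0 : ∀ x ∈ Ω, lieDeriv (F 0) x = 0)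
    (hFs : ∀ j, ∀ x ∈ Ω, lieDeriv (F (j + 1)) x = -dragTerm δ j (F j) x)
    {γ : ℝ → ℂ × ℂ × ℂ} {S : Set ℝ} {s : ℝ} (hx : ((γ s).1, (γ s).2.1) ∈ Ω) (hn : (γ s).2.2 ≠ 0)
    (hγ : HasDerivWithinAt γ (complexField δ (γ s)) S s) (N : ℕ) :
    HasDerivWithinAt (fun s => partialIntegral F N (γ s))
      (((γ s).2.2)⁻¹ ^ (N + 1) * dragTerm δ N (F N) ((γ s).1, (γ s).2.1)) S s := by
  induction N with
  | zero =>
    have := hasDerivWithinAt_inv_pow_mul hΩ (hF 0) 0 hx hn hγ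
    rw [hF0 _ hx] at this
    simpa [partialIntegral] using this
  | succ N ih =>
    have h := hasDerivWithinAt_inv_pow_mul hΩ (hF (N + 1)) (N + 1) hx hn hγ
    rw [hFs N _ hx] at h
    have e : (fun s => partialIntegral F (N + 1) (γ s)) = fun s => partialIntegral F N (γ s) +
        ((γ s).2.2)⁻¹ ^ (N + 1) * F (N + 1) ((γ s).1, (γ s).2.1) := by
      funext s
      rw [partialIntegral, Finset.sum_range_succ, ← partialIntegral]
    rw [e]
    refine (ih.fun_add h).congr_deriv ?_
    ring

/-- The complexified limiting Hamiltonian is holomorphic, and the formal integral is its asymptotic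
expansion in powers of `n⁻¹`, uniformly over a thin complex annulus. -/
theorem exists_holomorphic_limit (hδ : 0 < δ) (hη : 0 < η) (h1 : 6 * η ≤ ρ)
    (h2 : ρ + 12 * η ≤ 1) :
    ∃ (m₀ : ℝ) (HH : ℂ × ℂ × ℂ → ℂ) (F : ℕ → ℂ × ℂ → ℂ), 1 ≤ m₀ ∧
      DifferentiableOn ℂ HH (farRegion ρ η m₀) ∧ (∀ x, F 0 x = x.1 * x.2 / 2) ∧
      (∀ j, DifferentiableOn ℂ (F j) (annulus ρ (3 * η))) ∧
      (∀ p ∈ farRegion ρ η m₀, ∃ γ : ℝ → ℂ × ℂ × ℂ, γ 0 = p ∧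
        IsGlobalSolution (complexField δ) (farRegion ρ (3 * η) 0) γ ∧
        Tendsto (fun s => (γ s).1 * (γ s).2.1 / 2) atTop (𝓝 (HH p))) ∧
      ∀ N, 1 ≤ N → ∃ C, 0 ≤ C ∧ ∀ p ∈ farRegion ρ η m₀,
        ‖HH p - partialIntegral F N p‖ ≤ C / p.2.2.re ^ N := by
  have hΩ : IsAveragingDomain (annulus ρ (3 * η)) :=
    isAveragingDomain_annulus (by positivity) (by linarith) (by linarith)
  obtain ⟨F, hF00, hF, hF0, hFs⟩ := hΩ.exists_formalIntegral hδ
  obtain ⟨m₀, c, ψ, hm₀, hc, hψ⟩ := exists_complexFlow hδ hη h1 h2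
  have hcomp : IsCompact (closedAnnulus ρ (2 * η)) := isCompact_closedAnnulus _ _
  have hsubs : closedAnnulus ρ (2 * η) ⊆ annulus ρ (3 * η) :=
    closedAnnulus_subset_annulus (by linarith)
  have hTb : ∀ N, ∃ C, 0 ≤ C ∧ ∀ x ∈ closedAnnulus ρ (2 * η), ‖dragTerm δ N (F N) x‖ ≤ C := by
    intro N
    obtain ⟨C, hC⟩ := hcomp.exists_bound_of_continuousOn
      ((hΩ.differentiableOn_dragTerm (hF N) δ N).continuousOn.mono hsubs)
    exact ⟨max C 0, le_max_right _ _, fun x hx => (hC x hx).trans (le_max_left _ _)⟩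
  have hFb : ∀ N, ∃ C, 0 ≤ C ∧ ∀ x ∈ closedAnnulus ρ (2 * η), ‖F N x‖ ≤ C := by
    intro N
    obtain ⟨C, hC⟩ := hcomp.exists_bound_of_continuousOn ((hF N).continuousOn.mono hsubs)
    exact ⟨max C 0, le_max_right _ _, fun x hx => (hC x hx).trans (le_max_left _ _)⟩
  choose A hA0 hA using hTb
  choose B hB0 hB using hFb
  have hpos : ∀ p ∈ farRegion ρ η m₀, ∀ s, 0 ≤ s → 1 ≤ p.2.2.re + c * s := fun p hp s hs => by
    have := hp.2
    have := mul_nonneg hc.le hs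
    linarith
  have hinv : ∀ p ∈ farRegion ρ η m₀, ∀ s, 0 ≤ s →
      ‖((ψ p s).2.2)⁻¹‖ ≤ 1 / (p.2.2.re + c * s) := fun p hp s hs => by
    rw [norm_inv, ← one_div]
    have := hpos p hp s hs
    exact one_div_le_one_div_of_le (by linarith)
      (((hψ p hp).2.2 s hs).1.trans (Complex.re_le_norm _))
  have hvar : ∀ N, 1 ≤ N → ∀ p ∈ farRegion ρ η m₀, ∀ s t, 0 ≤ s → s ≤ t →
      ‖partialIntegral F N (ψ p t) - partialIntegral F N (ψ p s)‖ ≤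
        A N / (c * (p.2.2.re + c * s) ^ N) := by
    intro N hN p hp s t hs hst
    refine norm_sub_le_of_norm_deriv_le_decay (f := fun s => partialIntegral F N (ψ p s)) hc
      (by linarith [hpos p hp s hs]) (hA0 N) hN hst
      (fun u hu => hasDerivWithinAt_partialIntegral hΩ hF hF0 hFs
        (hsubs ((hψ p hp).2.2 u (hs.trans hu.1)).2)
        (qfun_ne_zero_of_mem_farRegion hη h1 h2 ((hψ p hp).2.1 u (hs.trans hu.1)).1).2
        (((hψ p hp).2.1 u (hs.trans hu.1)).2.mono (fun y hy => hs.trans hy.1)) N)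
      fun u hu => ?_
    have hu0 := hs.trans hu.1
    rw [norm_mul, norm_pow]
    have h3 := hinv p hp u hu0
    have h4 := hA N _ ((hψ p hp).2.2 u hu0).2
    calc ‖((ψ p u).2.2)⁻¹‖ ^ (N + 1) * ‖dragTerm δ N (F N) ((ψ p u).1, (ψ p u).2.1)‖
        ≤ (1 / (p.2.2.re + c * u)) ^ (N + 1) * A N := by
          have := hpos p hp u hu0
          gcongr
      _ = A N / (p.2.2.re + c * u) ^ (N + 1) := by rw [one_div, inv_pow]; ring
  -- along solutions the terms of positive order tend to zero
  have hhead : ∀ N, ∀ p ∈ farRegion ρ η m₀, ∀ s, 0 ≤ s →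
      ‖partialIntegral F N (ψ p s) - (ψ p s).1 * (ψ p s).2.1 / 2‖ ≤
        (∑ j ∈ Finset.range N, B (j + 1)) / (p.2.2.re + c * s) := by
    intro N p hp s hs
    rw [partialIntegral, Finset.sum_range_succ', hF00, pow_zero, one_mul, add_sub_cancel_right,
      Finset.sum_div]
    refine norm_sum_le_of_le _ fun j _ => ?_
    rw [norm_mul, norm_pow]
    have h3 := hinv p hp s hs
    have h4 := hB (j + 1) _ ((hψ p hp).2.2 s hs).2
    have h5 := hpos p hp s hs
    have h6 : 1 / (p.2.2.re + c * s) ≤ 1 := by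
      rw [div_le_one (by linarith)]; exact h5
    calc ‖((ψ p s).2.2)⁻¹‖ ^ (j + 1) * ‖F (j + 1) ((ψ p s).1, (ψ p s).2.1)‖
        ≤ (1 / (p.2.2.re + c * s)) ^ (j + 1) * B (j + 1) := by gcongr
      _ ≤ (1 / (p.2.2.re + c * s)) ^ 1 * B (j + 1) := by
        gcongr ?_ * _
        · exact hB0 _
        · exact pow_le_pow_of_le_one (by positivity) h6 (by omega)
      _ = B (j + 1) / (p.2.2.re + c * s) := by rw [pow_one]; ring
  -- the partial sum of order `1` gives a Cauchy estimate for `a b / 2` that is uniform in `p`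
  set D := A 1 / c + 2 * B 1 with hD
  have hD0 : 0 ≤ D := by
    have := hA0 1
    have := hB0 1
    positivity
  have hcauchy : ∀ p ∈ farRegion ρ η m₀, ∀ s t, 0 ≤ s → s ≤ t →
      ‖(ψ p t).1 * (ψ p t).2.1 / 2 - (ψ p s).1 * (ψ p s).2.1 / 2‖ ≤ D / (p.2.2.re + c * s) := by
    intro p hp s t hs hst
    have h3 := hvar 1 le_rfl p hp s t hs hst
    have h4 := hhead 1 p hp s hs
    have h5 := hhead 1 p hp t (hs.trans hst)
    have h6 := hpos p hp s hs
    simp only [Finset.sum_range_one, zero_add] at h4 h5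
    have h7 : B 1 / (p.2.2.re + c * t) ≤ B 1 / (p.2.2.re + c * s) := by
      have := hB0 1
      gcongr
    rw [norm_sub_rev] at h5
    have e : (ψ p t).1 * (ψ p t).2.1 / 2 - (ψ p s).1 * (ψ p s).2.1 / 2 =
        ((ψ p t).1 * (ψ p t).2.1 / 2 - partialIntegral F 1 (ψ p t)) +
        (partialIntegral F 1 (ψ p t) - partialIntegral F 1 (ψ p s)) +
        (partialIntegral F 1 (ψ p s) - (ψ p s).1 * (ψ p s).2.1 / 2) := by ring
    rw [e]
    refine (norm_add₃_le).trans ((add_le_add (add_le_add (h5.trans h7) h3) h4).trans ?_)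
    rw [hD, pow_one]
    apply le_of_eq
    field_simp
    ring
  have hlin : ∀ p : ℂ × ℂ × ℂ, Tendsto (fun s => p.2.2.re + c * s) atTop atTop := fun p =>
    tendsto_atTop_add_const_left _ _ (tendsto_id.const_mul_atTop hc)
  have hzero : ∀ (p : ℂ × ℂ × ℂ) (K : ℝ), Tendsto (fun s => K / (p.2.2.re + c * s)) atTop (𝓝 0) :=
    fun p K => tendsto_const_nhds.div_atTop (hlin p)
  have hlim : ∀ p ∈ farRegion ρ η m₀,
      ∃ L, Tendsto (fun s => (ψ p s).1 * (ψ p s).2.1 / 2) atTop (𝓝 L) := by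
    intro p hp
    refine cauchySeq_tendsto_of_complete (Metric.cauchySeq_iff'.2 fun ε hε => ?_)
    obtain ⟨s, hs, hs'⟩ := (((hzero p D).eventually (gt_mem_nhds hε)).and
      (eventually_ge_atTop 0)).exists
    refine ⟨s, fun t ht => ?_⟩
    rw [dist_eq_norm]
    exact (hcauchy p hp s t hs' ht).trans_lt hs
  classical
  set HH : ℂ × ℂ × ℂ → ℂ := fun p => if hp : p ∈ farRegion ρ η m₀ then
    Classical.choose (hlim p hp) else 0 with hHH
  have hHHlim : ∀ p ∈ farRegion ρ η m₀,
      Tendsto (fun s => (ψ p s).1 * (ψ p s).2.1 / 2) atTop (𝓝 (HH p)) := by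
    intro p hp
    simp only [hHH, dif_pos hp]
    exact Classical.choose_spec (hlim p hp)
  refine ⟨m₀, HH, F, hm₀, ?_, hF00, hF, fun p hp => ⟨ψ p, (hψ p hp).1, (hψ p hp).2.1,
    hHHlim p hp⟩, ?_⟩
  · have hV := differentiableOn_complexField δ (O := farRegion ρ (3 * η) 0)
      fun p hp => qfun_ne_zero_of_mem_farRegion hη h1 h2 hp
    intro p hp
    obtain ⟨R, hR, hball⟩ := Metric.isOpen_iff.1 (isOpen_farRegion ρ η m₀) p hp
    refine (differentiableAt_of_norm_sub_le (R := R)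
      (f := fun (i : ℕ) p => (ψ p i).1 * (ψ p i).2.1 / 2) (u := fun i => D / (1 + c * i)) hR ?_ ?_
      ?_).differentiableWithinAt
    · exact tendsto_const_nhds.div_atTop (tendsto_atTop_add_const_left _ _
        (tendsto_natCast_atTop_atTop.const_mul_atTop hc))
    · intro i
      have hfl := (differentiableOn_flow (isOpen_farRegion ρ (3 * η) 0) hV
        (isOpen_farRegion ρ η m₀) (fun p hp => (hψ p hp).1) (fun p hp => (hψ p hp).2.1)
        (Nat.cast_nonneg i)).mono hball
      simp only [div_eq_mul_inv]
      exact (hfl.fst.fun_mul hfl.snd.fst).mul_const _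
    · intro i y hy
      have hyD := hball hy
      refine (le_of_tendsto' (x := atTop)
        (f := fun T : ℝ => ‖(ψ y i).1 * (ψ y i).2.1 / 2 -
          (ψ y (i + |T|)).1 * (ψ y (i + |T|)).2.1 / 2‖) ?_
        (fun T => ?_) : _ ≤ D / (y.2.2.re + c * i)).trans ?_
      · have ht : Tendsto (fun T : ℝ => (i : ℝ) + |T|) atTop atTop :=
          tendsto_atTop_add_const_left _ _ tendsto_abs_atTop_atTop
        exact (((hHHlim y hyD).comp ht).const_sub _).norm
      · rw [norm_sub_rev]
        exact hcauchy y hyD i _ (Nat.cast_nonneg i) (by simp)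
      · have := hyD.2
        gcongr
        linarith
  · intro N hN
    refine ⟨A N / c, div_nonneg (hA0 N) hc.le, fun p hp => ?_⟩
    have h3 : Tendsto (fun s => partialIntegral F N (ψ p s)) atTop (𝓝 (HH p)) := by
      have h4 : Tendsto (fun s => partialIntegral F N (ψ p s) - (ψ p s).1 * (ψ p s).2.1 / 2) atTop
          (𝓝 0) := by
        refine squeeze_zero_norm' ?_ (hzero p (∑ j ∈ Finset.range N, B (j + 1)))
        filter_upwards [eventually_ge_atTop 0] with s hs
        exact hhead N p hp s hs
      have := h4.add (hHHlim p hp)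
      simpa using this
    have h5 : Tendsto (fun s => ‖partialIntegral F N (ψ p s) - partialIntegral F N p‖) atTop
        (𝓝 ‖HH p - partialIntegral F N p‖) := (h3.sub_const _).norm
    refine le_of_tendsto h5 ?_
    filter_upwards [eventually_ge_atTop 0] with s hs
    have h6 := hvar N hN p hp 0 s le_rfl hs
    rw [(hψ p hp).1, mul_zero, add_zero] at h6
    refine h6.trans (le_of_eq ?_)
    rw [div_div]

end HolomorphicLimit

/-! ### From the complex to the real flow -/

section Link

variable {δ : ℝ}

/-- The coordinates `(a, b, n)` of the complex system, as functions of the complexified `(r, v, l)`. -/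
def averagingChart (y : ℂ × ℂ × ℂ) : ℂ × ℂ × ℂ :=
  (1 - (y.1)⁻¹ + Complex.I * y.2.1, 1 - (y.1)⁻¹ - Complex.I * y.2.1, (y.2.2 ^ 3)⁻¹)

/-- The inclusion of the real space into its complexification. -/
def complexify : Space →L[ℝ] ℂ × ℂ × ℂ :=
  (Complex.ofRealCLM.comp (ContinuousLinearMap.fst ℝ ℝ (ℝ × ℝ))).prod
    ((Complex.ofRealCLM.comp ((ContinuousLinearMap.fst ℝ ℝ ℝ).comp
      (ContinuousLinearMap.snd ℝ ℝ (ℝ × ℝ)))).prod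
    (Complex.ofRealCLM.comp ((ContinuousLinearMap.snd ℝ ℝ ℝ).comp
      (ContinuousLinearMap.snd ℝ ℝ (ℝ × ℝ)))))

theorem complexify_apply (p : Space) : complexify p = ((p.1 : ℂ), (p.2.1 : ℂ), (p.2.2 : ℂ)) := rfl

theorem qfun_averagingChart (y : ℂ × ℂ × ℂ) :
    qfun ((averagingChart y).1, (averagingChart y).2.1) = (y.1)⁻¹ := by
  simp only [qfun, averagingChart]
  ring

theorem averagingChart_mul (y : ℂ × ℂ × ℂ) :
    (averagingChart y).1 * (averagingChart y).2.1 / 2 = ((1 - (y.1)⁻¹) ^ 2 + y.2.1 ^ 2) / 2 := by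
  simp only [averagingChart]
  linear_combination (-(y.2.1 ^ 2) / 2) * Complex.I_sq

theorem averagingChart_complexify_mul {p : Space} (hp : 0 < p.1) :
    (averagingChart (complexify p)).1 * (averagingChart (complexify p)).2.1 / 2 =
      (hamiltonian p.1 p.2.1 : ℝ) := by
  rw [averagingChart_mul, hamiltonian_eq_of_pos hp, complexify_apply]
  push_cast
  ring

/-- In the coordinates `(a, b, n)` the real system is the complex system with the time rescaled
by `r⁻²`. -/
theorem hasDerivWithinAt_averagingChart {γ : ℝ → Space} {S : Set ℝ} {t : ℝ} (hr : 0 < (γ t).1)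
    (hl : 0 < (γ t).2.2) (h : HasDerivWithinAt γ (vectorField δ (γ t)) S t) :
    HasDerivWithinAt (fun t => averagingChart (complexify (γ t)))
      ((1 / (γ t).1 ^ 2) • complexField δ (averagingChart (complexify (γ t)))) S t := by
  obtain ⟨h1, h2, h3⟩ := hasDerivWithinAt_components h
  have hr0 : ((γ t).1 : ℂ) ≠ 0 := Complex.ofReal_ne_zero.2 hr.ne'
  have hl0 : ((γ t).2.2 : ℂ) ≠ 0 := Complex.ofReal_ne_zero.2 hl.ne'
  have c1 := h1.ofReal_comp
  have c2 := h2.ofReal_comp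
  have c3 := h3.ofReal_comp
  have w := (c1.fun_inv hr0).const_sub 1
  have v := c2.const_mul Complex.I
  have hq := qfun_averagingChart (complexify (γ t))
  have key := (w.fun_add v).prodMk ((w.fun_sub v).prodMk
    ((c3.fun_pow 3).fun_inv (pow_ne_zero 3 hl0)))
  refine HasDerivWithinAt.congr_deriv key ?_
  simp only [complexField, hq]
  simp only [averagingChart, complexify_apply, Prod.smul_mk]
  refine Prod.ext ?_ (Prod.ext ?_ ?_)
  · simp only [Complex.real_smul]
    push_cast
    field_simp
    linear_combination (((γ t).1 : ℂ) * (γ t).2.1) * Complex.I_sq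
  · simp only [Complex.real_smul]
    push_cast
    field_simp
    linear_combination (((γ t).1 : ℂ) * (γ t).2.1) * Complex.I_sq
  · simp only [Complex.real_smul]
    push_cast
    field_simp

/-- The real flow is the complex flow with rescaled time, so both give the same limit of the
Hamiltonian. -/
theorem hamiltonianLimit_eq_of_complexSolution (hδ : 0 < δ) {p : Space} (hp : p ∈ phaseSpace)
    (hl : 0 < p.2.2) {O : Set (ℂ × ℂ × ℂ)} (hO : ∀ y ∈ O, qfun (y.1, y.2.1) ≠ 0 ∧ y.2.2 ≠ 0)
    {γ : ℝ → ℂ × ℂ × ℂ} (h0 : γ 0 = averagingChart (complexify p))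
    (hγ : IsGlobalSolution (complexField δ) O γ) {L : ℂ}
    (hL : Tendsto (fun s => (γ s).1 * (γ s).2.1 / 2) atTop (𝓝 L)) :
    (hamiltonianLimit δ p : ℂ) = L := by
  have hφ := isForwardSolution_flow hδ hp
  set φ : ℝ → Space := fun t => flow δ t p with hφdef
  have hφ0 : φ 0 = p := hφ.1
  have hφr : ∀ t, 0 ≤ t → 0 < (φ t).1 := fun t ht => (hφ.2 t ht).1.1
  have hφl : ∀ t, 0 ≤ t → 0 < (φ t).2.2 := by
    intro t ht
    have := angularMomentum_eq hδ hl (T := t) (l := fun t => (φ t).2.2)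
      (fun u hu => (hasDerivWithinAt_components (hφ.isGlobalSolution.isSolutionOn t u hu).2).2.2)
      (by simp only [hφ0]) t ⟨ht, le_rfl⟩
    rw [this]
    positivity
  have hφc : Continuous fun t => φ (max t 0) := by
    have : ContinuousOn φ (Ici 0) := fun t ht => (hφ.2 t ht).2.continuousWithinAt
    exact this.comp_continuous (by fun_prop) fun t => le_max_right t 0
  -- the flow is only controlled for `t ≥ 0`, whence `max t 0`
  set θ : ℝ → ℝ := fun t => 1 / (φ (max t 0)).1 ^ 2 with hθ
  have hθc : Continuous θ := by
    refine continuous_const.div (hφc.fst.pow 2) fun t => ?_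
    exact pow_ne_zero 2 (hφr _ (le_max_right t 0)).ne'
  have hθ0 : ∀ t, 0 ≤ θ t := fun t => by positivity
  set σ : ℝ → ℝ := fun t => ∫ u in (0 : ℝ)..t, θ u with hσ
  have hσ0 : ∀ t, 0 ≤ t → 0 ≤ σ t := fun t ht =>
    intervalIntegral.integral_nonneg ht fun u _ => hθ0 u
  have hσd : ∀ t, HasDerivAt σ (θ t) t := fun t => (hθc.integral_hasStrictDerivAt 0 t).hasDerivAt
  set U : Set (ℂ × ℂ × ℂ) := {y | qfun (y.1, y.2.1) ≠ 0 ∧ y.2.2 ≠ 0} with hU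
  have hUo : IsOpen U := by
    refine IsOpen.and (isOpen_ne_fun ?_ continuous_const) (isOpen_ne_fun (by fun_prop) (by fun_prop))
    unfold qfun
    fun_prop
  have hV : ContDiffOn ℝ 1 (complexField δ) U :=
    (DifferentiableOn.contDiffOn_complex hUo
      (differentiableOn_complexField δ fun y hy => hy) 1).restrict_scalars ℝ
  have hmem : ∀ t, 0 ≤ t → averagingChart (complexify (φ t)) ∈ U := by
    intro t ht
    refine ⟨?_, ?_⟩
    · rw [qfun_averagingChart, complexify_apply]
      exact inv_ne_zero (Complex.ofReal_ne_zero.2 (hφr t ht).ne')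
    · exact inv_ne_zero (pow_ne_zero 3 (Complex.ofReal_ne_zero.2 (hφl t ht).ne'))
  have heq : ∀ t, 0 ≤ t → averagingChart (complexify (φ t)) = γ (σ t) := by
    intro T hT
    refine eqOn_of_hasDerivWithinAt_smul hUo hV (T := T) (θ := θ)
      (f := fun t => averagingChart (complexify (φ t))) (g := fun t => γ (σ t)) hθc.continuousOn
      (fun t ht => ⟨hmem t ht.1, ?_⟩) (fun t ht => ⟨hO _ (hγ _ (hσ0 t ht.1)).1, ?_⟩) ?_ ⟨hT, le_rfl⟩
    · have h3 := hasDerivWithinAt_averagingChart (hφr t ht.1) (hφl t ht.1)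
        ((hφ.2 t ht.1).2.mono fun u (hu : u ∈ Icc 0 T) => hu.1)
      have e : θ t = 1 / (φ t).1 ^ 2 := by simp only [hθ, max_eq_left ht.1]
      rw [e]
      exact h3
    · exact HasDerivWithinAt.scomp t (hγ _ (hσ0 t ht.1)).2 (hσd t).hasDerivWithinAt
        fun u hu => hσ0 u hu.1
    · simp only [hφ0, hσ, intervalIntegral.integral_same, h0]
  have hγc : ∀ S : ℝ, ContinuousOn γ (Icc 0 S) := fun S s hs =>
    ((hγ s hs.1).2.mono Icc_subset_Ici_self).continuousWithinAt
  -- `l⁻³` is unbounded along the real orbit but bounded along the complex one on bounded time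
  -- intervals, so the new time is unbounded
  have hσt : Tendsto σ atTop atTop := by
    refine tendsto_atTop.2 fun S => ?_
    obtain ⟨M, hM⟩ := (isCompact_Icc (a := (0 : ℝ)) (b := S)).exists_bound_of_continuousOn
      (hγc S).snd.snd
    have h3 : Tendsto (fun t => ((φ t).2.2 ^ 3)⁻¹) atTop atTop := by
      refine Tendsto.comp tendsto_inv_nhdsGT_zero (tendsto_nhdsWithin_iff.2 ⟨?_, ?_⟩)
      · have := (hφ.tendsto_angularMomentum hδ).pow 3
        simpa using this
      · filter_upwards [eventually_ge_atTop 0] with t ht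
        exact pow_pos (hφl t ht) 3
    filter_upwards [h3.eventually_gt_atTop M, eventually_ge_atTop 0] with t ht ht0
    by_contra! hlt
    have h4 := hM (σ t) ⟨hσ0 t ht0, hlt.le⟩
    rw [← heq t ht0] at h4
    have h5 : (averagingChart (complexify (φ t))).2.2 = (((φ t).2.2 ^ 3)⁻¹ : ℝ) := by
      simp [averagingChart, complexify_apply]
    have h6 : 0 < ((φ t).2.2 ^ 3)⁻¹ := inv_pos.2 (pow_pos (hφl t ht0) 3)
    rw [h5, Complex.norm_real, Real.norm_of_nonneg h6.le] at h4
    exact h4.not_gt ht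
  have hlim1 : Tendsto (fun t => ((hamiltonian (φ t).1 (φ t).2.1 : ℝ) : ℂ)) atTop
      (𝓝 (hamiltonianLimit δ p : ℂ)) :=
    (Complex.continuous_ofReal.tendsto _).comp (tendsto_hamiltonianLimit hδ hp)
  refine tendsto_nhds_unique hlim1 ((hL.comp hσt).congr' ?_)
  filter_upwards [eventually_ge_atTop 0] with t ht
  rw [← averagingChart_complexify_mul (hφr t ht), heq t ht]
  rfl

end Link

/-! ### Smooth extension across the boundary -/

section Smoothness

open scoped ComplexConjugate

variable {δ : ℝ}

theorem averagingChart_complexify_mem_annulus {p : Space} {ρ η : ℝ} (hη : 0 < η) (hr : 0 < p.1)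
    (hρ : 0 ≤ ρ) (hH : ρ ^ 2 = 2 * hamiltonian p.1 p.2.1) :
    ((averagingChart (complexify p)).1, (averagingChart (complexify p)).2.1) ∈ annulus ρ η := by
  rw [hamiltonian_eq_of_pos hr] at hH
  have e1 : (averagingChart (complexify p)).1 = ((1 - 1 / p.1 : ℝ) : ℂ) + (p.2.1 : ℝ) * Complex.I := by
    simp only [averagingChart, complexify_apply]
    push_cast
    ring
  have e2 : (averagingChart (complexify p)).2.1 = conj (averagingChart (complexify p)).1 := by
    rw [e1]
    simp only [averagingChart, complexify_apply, map_add, map_mul, Complex.conj_ofReal,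
      Complex.conj_I]
    push_cast
    ring
  have e3 : ‖(averagingChart (complexify p)).1‖ = ρ := by
    rw [e1, Complex.norm_add_mul_I, ← Real.sqrt_sq hρ, hH]
    congr 1
    ring
  refine ⟨?_, ?_⟩
  · simp only [e3, sub_self, abs_zero, hη]
  · simp only [e2, sub_self, norm_zero, hη]

/-- Near `1` the inverse cube has real part at least `1 / 2`. -/
theorem exists_re_inv_cube_ge :
    ∃ θ : ℝ, 0 < θ ∧ ∀ ζ : ℂ, ‖ζ‖ < θ → 1 / 2 ≤ (((1 + ζ) ^ 3)⁻¹).re := by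
  have h : ContinuousAt (fun ζ : ℂ => (((1 + ζ) ^ 3)⁻¹).re) 0 := by
    refine Complex.continuous_re.continuousAt.comp (ContinuousAt.inv₀ (by fun_prop) (by simp))
  have h2 : ∀ᶠ ζ in 𝓝 (0 : ℂ), 1 / 2 < (((1 + ζ) ^ 3)⁻¹).re := by
    refine h.eventually_const_lt ?_
    simp
    norm_num
  obtain ⟨θ, hθ, hb⟩ := Metric.eventually_nhds_iff.1 h2
  exact ⟨θ, hθ, fun ζ hζ => (hb (by simpa using hζ)).le⟩

/-- If `l'` is a complex number close to `l > 0` relative to `l`, the real part of `l' ^ (-3)` is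
comparable to `l ^ (-3)`. -/
theorem re_inv_cube_ge {θ l : ℝ} (hθ : ∀ ζ : ℂ, ‖ζ‖ < θ → 1 / 2 ≤ (((1 + ζ) ^ 3)⁻¹).re)
    (hl : 0 < l) {l' : ℂ} (h : ‖l' - l‖ < θ * l) : (l ^ 3)⁻¹ / 2 ≤ ((l' ^ 3)⁻¹).re := by
  have hl0 : (l : ℂ) ≠ 0 := Complex.ofReal_ne_zero.2 hl.ne'
  have h1 : ‖(l' - l) / l‖ < θ := by
    rw [norm_div, Complex.norm_real, Real.norm_of_nonneg hl.le, div_lt_iff₀ hl]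
    exact h
  have h2 := hθ _ h1
  have e : (l' ^ 3)⁻¹ = (((l ^ 3)⁻¹ : ℝ) : ℂ) * ((1 + (l' - l) / l) ^ 3)⁻¹ := by
    rw [show 1 + (l' - l) / l = l' / l by field_simp; ring, div_pow, inv_div]
    push_cast
    field_simp
  rw [e, Complex.re_ofReal_mul]
  have : 0 < (l ^ 3)⁻¹ := by positivity
  nlinarith

theorem differentiableOn_averagingChart {B : Set (ℂ × ℂ × ℂ)}
    (hB : ∀ y ∈ B, y.1 ≠ 0 ∧ y.2.2 ≠ 0) : DifferentiableOn ℂ averagingChart B := by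
  have h1 : DifferentiableOn ℂ (fun y : ℂ × ℂ × ℂ => (y.1)⁻¹) B :=
    DifferentiableOn.fun_inv (by fun_prop) fun y hy => (hB y hy).1
  have h2 : DifferentiableOn ℂ (fun y : ℂ × ℂ × ℂ => (y.2.2 ^ 3)⁻¹) B :=
    DifferentiableOn.fun_inv (by fun_prop) fun y hy => pow_ne_zero 3 (hB y hy).2
  unfold averagingChart
  fun_prop

theorem differentiableOn_partialIntegral {Ω : Set (ℂ × ℂ)} {F : ℕ → ℂ × ℂ → ℂ}
    (hF : ∀ j, DifferentiableOn ℂ (F j) Ω) (N : ℕ) {O : Set (ℂ × ℂ × ℂ)}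
    (hO : ∀ p ∈ O, (p.1, p.2.1) ∈ Ω ∧ p.2.2 ≠ 0) : DifferentiableOn ℂ (partialIntegral F N) O := by
  have h2 : DifferentiableOn ℂ (fun p : ℂ × ℂ × ℂ => (p.2.2)⁻¹) O :=
    DifferentiableOn.fun_inv (by fun_prop) fun p hp => (hO p hp).2
  refine DifferentiableOn.fun_sum fun j _ => (h2.fun_pow j).fun_mul ?_
  exact (hF j).comp (f := fun p : ℂ × ℂ × ℂ => (p.1, p.2.1)) (by fun_prop) fun p hp => (hO p hp).1

/-- Near a point of `{l = 0}` with energy between `0` and `1 / 2` the limiting Hamiltonian extends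
to a function of class `C^k` across `{l = 0}`: it is the sum of a partial sum of the formal
integral, which is polynomial in `l ^ 3`, and a flat remainder. -/
theorem exists_contDiffAt_extension (hδ : 0 < δ) {p₀ : Space} (hr : 0 < p₀.1) (hl : p₀.2.2 = 0)
    (hH0 : 0 < hamiltonian p₀.1 p₀.2.1) (hH1 : hamiltonian p₀.1 p₀.2.1 < 1 / 2) (k : ℕ) :
    ∃ G : Space → ℝ, ContDiffAt ℝ k G p₀ ∧
      ∀ᶠ p in 𝓝 p₀, 0 ≤ p.2.2 → hamiltonianLimit δ p = G p := by
  set ρ := √(2 * hamiltonian p₀.1 p₀.2.1) with hρ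
  have hρsq : ρ ^ 2 = 2 * hamiltonian p₀.1 p₀.2.1 := Real.sq_sqrt (by positivity)
  have hρ0 : 0 < ρ := Real.sqrt_pos.2 (by positivity)
  have hρ1 : ρ < 1 := by
    rw [hρ, Real.sqrt_lt' one_pos]; linarith
  obtain ⟨η, hη, h1, h2⟩ : ∃ η : ℝ, 0 < η ∧ 6 * η ≤ ρ ∧ ρ + 12 * η ≤ 1 := by
    refine ⟨min (ρ / 6) ((1 - ρ) / 12), lt_min (by positivity) (by linarith), ?_, ?_⟩
    · linarith [min_le_left (ρ / 6) ((1 - ρ) / 12)]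
    · linarith [min_le_right (ρ / 6) ((1 - ρ) / 12)]
  obtain ⟨m₀, HH, F, hm₀, hHH, hF0, hF, hsol, hasy⟩ := exists_holomorphic_limit hδ hη h1 h2
  set N := k + 2 with hN
  obtain ⟨C, hC0, hC⟩ := hasy N (by omega)
  obtain ⟨θ, hθ0, hθ⟩ := exists_re_inv_cube_ge
  -- the point `(a, b)`, as a function of the complexified `(r, v, l)`
  set x : ℂ × ℂ × ℂ → ℂ × ℂ := fun y => ((averagingChart y).1, (averagingChart y).2.1) with hx
  have hr0 : (complexify p₀).1 ≠ 0 := Complex.ofReal_ne_zero.2 hr.ne'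
  have hxp : x (complexify p₀) ∈ annulus ρ η :=
    averagingChart_complexify_mem_annulus hη hr hρ0.le hρsq
  have hxd : ∀ y : ℂ × ℂ × ℂ, y.1 ≠ 0 → ContDiffAt ℝ k x y := by
    intro y hy
    have : ContDiffAt ℝ k (fun y : ℂ × ℂ × ℂ => (y.1)⁻¹) y := ContDiffAt.inv (by fun_prop) hy
    simp only [hx, averagingChart]
    fun_prop
  have hnear : ∀ᶠ y in 𝓝 (complexify p₀), y.1 ≠ 0 ∧ x y ∈ annulus ρ η :=
    (continuous_fst.continuousAt.eventually_ne hr0).and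
      ((hxd _ hr0).continuousAt.eventually_mem ((isOpen_annulus ρ η).mem_nhds hxp))
  obtain ⟨ε, hε, hball⟩ := Metric.eventually_nhds_iff.1 hnear
  have hlarge : ∀ᶠ l : ℝ in 𝓝 0, 0 < l → m₀ < (l ^ 3)⁻¹ / 2 := by
    have : Tendsto (fun l : ℝ => (l ^ 3)⁻¹ / 2) (𝓝[>] 0) atTop := by
      refine Tendsto.atTop_div_const two_pos (Tendsto.comp tendsto_inv_nhdsGT_zero
        (tendsto_nhdsWithin_iff.2 ⟨?_, ?_⟩))
      · exact (Continuous.tendsto' (by fun_prop) _ _ (by simp)).mono_left nhdsWithin_le_nhds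
      · filter_upwards [self_mem_nhdsWithin] with l hl
        exact pow_pos (mem_Ioi.1 hl) 3
    exact eventually_nhdsWithin_iff.1 (this.eventually_gt_atTop m₀)
  have hsmall : ∀ᶠ l : ℝ in 𝓝 0, θ * l < ε / 2 := by
    have : Tendsto (fun l : ℝ => θ * l) (𝓝 0) (𝓝 0) :=
      Continuous.tendsto' (by fun_prop) _ _ (by simp)
    exact this.eventually (gt_mem_nhds (by positivity))
  -- on this neighbourhood complex balls of radius `θ l` stay in the domain of the expansion
  obtain ⟨W, hWsub, hWo, hWp⟩ : ∃ W : Set Space, (∀ p ∈ W, dist (complexify p) (complexify p₀) <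
      ε / 2 ∧ (0 < p.2.2 → m₀ < (p.2.2 ^ 3)⁻¹ / 2) ∧ θ * p.2.2 < ε / 2 ∧ 0 < p.1) ∧
      IsOpen W ∧ p₀ ∈ W := by
    have hlc : Tendsto (fun p : Space => p.2.2) (𝓝 p₀) (𝓝 0) := by
      rw [← hl]; exact Continuous.tendsto (by fun_prop) _
    have := ((complexify.continuous.tendsto p₀).eventually (ball_mem_nhds _ (half_pos hε))).and
      ((hlc.eventually hlarge).and ((hlc.eventually hsmall).and
        (continuous_fst.continuousAt.eventually (lt_mem_nhds hr))))
    obtain ⟨W, h3, h4, h5⟩ := _root_.eventually_nhds_iff.1 this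
    exact ⟨W, fun p hp => h3 p hp, h4, h5⟩
  have hfar : ∀ p ∈ W, 0 < p.2.2 → ∀ y ∈ ball (complexify p) (θ * p.2.2),
      y.1 ≠ 0 ∧ y.2.2 ≠ 0 ∧ averagingChart y ∈ farRegion ρ η m₀ ∧
        (p.2.2 ^ 3)⁻¹ / 2 ≤ (averagingChart y).2.2.re := by
    intro p hp hlp y hy
    obtain ⟨a1, a2, a3, a4⟩ := hWsub p hp
    have h3 : dist y (complexify p₀) < ε := by
      have := dist_triangle y (complexify p) (complexify p₀)
      have := mem_ball.1 hy
      linarith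
    obtain ⟨b1, b2⟩ := hball h3
    have h4 : ‖y.2.2 - p.2.2‖ < θ * p.2.2 := by
      rw [← dist_eq_norm]
      exact lt_of_le_of_lt (le_trans (le_max_right _ _) (le_max_right _ _)) (mem_ball.1 hy)
    have h5 := re_inv_cube_ge hθ hlp h4
    have h6 : m₀ < ((y.2.2 ^ 3)⁻¹).re := (a2 hlp).trans_le h5
    refine ⟨b1, ?_, ⟨b2, h6⟩, h5⟩
    intro h0
    simp [h0] at h6
    linarith
  have hfarn : ∀ p ∈ farRegion ρ η m₀, (p.1, p.2.1) ∈ annulus ρ (3 * η) ∧ p.2.2 ≠ 0 := by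
    intro p hp
    refine ⟨closedAnnulus_subset_annulus (by linarith) (annulus_subset_closedAnnulus _ _ hp.1),
      fun h => ?_⟩
    have := hp.2
    simp [h] at this
    linarith
  set P : ℂ × ℂ × ℂ → ℂ := fun y => HH (averagingChart y) - partialIntegral F N (averagingChart y)
    with hP
  have hflat : ContDiffOn ℝ k (fun p : Space => if 0 < p.2.2 then P (complexify p) else 0) W := by
    refine contDiffOn_zero_extension complexify ((ContinuousLinearMap.snd ℝ ℝ ℝ).comp
      (ContinuousLinearMap.snd ℝ ℝ (ℝ × ℝ))) hWo k P (3 * N) θ (C * 2 ^ N) (by omega) hθ0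
      fun p hp hlp => ⟨?_, fun y hy => ?_⟩
    · have hlp' : 0 < p.2.2 := hlp
      refine ((hHH.sub (differentiableOn_partialIntegral hF N hfarn)).comp
        (differentiableOn_averagingChart fun y hy => ?_) fun y hy => ?_)
      · exact ⟨(hfar p hp hlp' y hy).1, (hfar p hp hlp' y hy).2.1⟩
      · exact (hfar p hp hlp' y hy).2.2.1
    · have hlp' : 0 < p.2.2 := hlp
      obtain ⟨-, -, c3, c4⟩ := hfar p hp hlp' y hy
      have hpos : 0 < (p.2.2 ^ 3)⁻¹ / 2 := by positivity
      calc ‖P y‖ ≤ C / (averagingChart y).2.2.re ^ N := hC _ c3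
        _ ≤ C / ((p.2.2 ^ 3)⁻¹ / 2) ^ N := by gcongr
        _ = C * 2 ^ N * p.2.2 ^ (3 * N) := by
          rw [div_pow, inv_pow, pow_mul]
          field_simp
  set G : Space → ℝ := fun p =>
    (∑ j ∈ Finset.range (N + 1), ((p.2.2 : ℂ) ^ 3) ^ j * F j (x (complexify p))).re +
      (if 0 < p.2.2 then P (complexify p) else 0).re with hG
  refine ⟨G, ?_, ?_⟩
  · refine ContDiffAt.add (Complex.reCLM.contDiff.contDiffAt.comp p₀ ?_)
      (Complex.reCLM.contDiff.contDiffAt.comp p₀ (hflat.contDiffAt (hWo.mem_nhds hWp)))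
    refine ContDiffAt.sum fun j _ => ContDiffAt.mul ?_ ?_
    · have : ContDiffAt ℝ k (fun p : Space => (p.2.2 : ℂ)) p₀ :=
        Complex.ofRealCLM.contDiff.contDiffAt.comp p₀ (by fun_prop)
      exact (this.pow 3).pow j
    · have hFj : ContDiffAt ℝ k (F j) (x (complexify p₀)) :=
        ((DifferentiableOn.contDiffOn_complex (isOpen_annulus _ _) (hF j) k).contDiffAt
          ((isOpen_annulus _ _).mem_nhds (closedAnnulus_subset_annulus (by linarith)
            (annulus_subset_closedAnnulus _ _ hxp)))).restrict_scalars ℝ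
      exact hFj.comp p₀ ((hxd _ hr0).comp p₀ complexify.contDiff.contDiffAt)
  · filter_upwards [hWo.mem_nhds hWp] with p hp hlp
    have hpr := (hWsub p hp).2.2.2
    rcases hlp.eq_or_lt with h0 | hlp'
    · rw [hamiltonianLimit_of_angularMomentum_eq_zero hδ ⟨hpr, hlp⟩ h0.symm]
      simp only [hG, ← h0, lt_irrefl, if_false, Finset.sum_range_succ', hF0]
      have := averagingChart_complexify_mul hpr
      simp only [hx]
      rw [this]
      simp
    · have hmem := mem_ball_self (x := complexify p) (show 0 < θ * p.2.2 by positivity)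
      obtain ⟨-, -, c3, -⟩ := hfar p hp hlp' _ hmem
      obtain ⟨γ, g0, g1, g2⟩ := hsol _ c3
      have hlim := hamiltonianLimit_eq_of_complexSolution hδ ⟨hpr, hlp⟩ hlp'
        (fun y hy => qfun_ne_zero_of_mem_farRegion hη h1 h2 hy) g0 g1 g2
      have e : ∑ j ∈ Finset.range (N + 1), ((p.2.2 : ℂ) ^ 3) ^ j * F j (x (complexify p)) =
          partialIntegral F N (averagingChart (complexify p)) := by
        refine Finset.sum_congr rfl fun j _ => ?_
        simp [hx, averagingChart, complexify_apply]
      simp only [hG, if_pos hlp', hP]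
      rw [e, ← Complex.add_re, add_sub_cancel, ← hlim, Complex.ofReal_re]

end Smoothness

/-! ### Straightening the level sets -/

section Straightening

/-- A form of the inverse function theorem: a map of class `C^k` with injective derivative at a
point restricts to a `C^k` diffeomorphism of open sets, inside any given neighbourhood. -/
theorem exists_ckDiffeo {E : Type*} [NormedAddCommGroup E] [NormedSpace ℝ E] [FiniteDimensional ℝ E]
    {k : ℕ} (hk : 1 ≤ k) {f : E → E} {x : E} (hf : ContDiffAt ℝ k f x)
    (hinj : ∀ u, fderiv ℝ f x u = 0 → u = 0) {U : Set E} (hU : U ∈ 𝓝 x) :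
    ∃ e : OpenPartialHomeomorph E E, x ∈ e.source ∧ e.source ⊆ U ∧ (∀ y, e y = f y) ∧
      ContDiffOn ℝ k e e.source ∧ ContDiffOn ℝ k e.symm e.target := by
  have : CompleteSpace E := FiniteDimensional.complete ℝ E
  have hk0 : (k : WithTop ℕ∞) ≠ 0 := by
    exact_mod_cast (by omega : k ≠ 0)
  obtain ⟨L, hL⟩ : ∃ L : E ≃L[ℝ] E, (L : E →L[ℝ] E) = fderiv ℝ f x := by
    have hi : Function.Injective (fderiv ℝ f x : E →ₗ[ℝ] E) :=
      (injective_iff_map_eq_zero _).2 hinj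
    refine ⟨(LinearEquiv.ofInjectiveEndo _ hi).toContinuousLinearEquiv, ?_⟩
    ext u
    rfl
  have hfd : HasFDerivAt f (L : E →L[ℝ] E) x := by
    rw [hL]; exact (hf.differentiableAt hk0).hasFDerivAt
  set e₀ := hf.toOpenPartialHomeomorph f hfd hk0 with he₀
  have hcont : ContinuousAt (fderiv ℝ f) x :=
    (hf.fderiv_right (m := 0) (by exact_mod_cast hk)).continuousAt
  have hev : ∀ᶠ y in 𝓝 x, ContDiffAt ℝ k f y ∧
      fderiv ℝ f y ∈ range ((↑) : (E ≃L[ℝ] E) → (E →L[ℝ] E)) ∧ y ∈ U :=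
    (hf.eventually (by simp)).and ((hcont.eventually_mem
      ((ContinuousLinearEquiv.isOpen (𝕜 := ℝ) (E := E) (F := E)).mem_nhds ⟨L, hL⟩)).and hU)
  obtain ⟨S, hS, hSo, hxS⟩ := _root_.eventually_nhds_iff.1 hev
  have hsrc : (e₀.restrOpen S hSo).source = e₀.source ∩ S := rfl
  refine ⟨e₀.restrOpen S hSo, ?_, ?_, fun y => rfl, ?_, ?_⟩
  · rw [hsrc]
    exact ⟨hf.mem_toOpenPartialHomeomorph_source hfd hk0, hxS⟩
  · rw [hsrc]
    exact fun y hy => (hS y hy.2).2.2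
  · intro y hy
    rw [hsrc] at hy
    exact (hS y hy.2).1.contDiffWithinAt
  · intro y hy
    have hy' : (e₀.restrOpen S hSo).symm y ∈ S := by
      have := (e₀.restrOpen S hSo).map_target hy
      rw [hsrc] at this
      exact this.2
    obtain ⟨c1, ⟨L', hL'⟩, -⟩ := hS _ hy'
    refine (OpenPartialHomeomorph.contDiffAt_symm (f₀' := L') _ hy ?_ c1).contDiffWithinAt
    rw [hL']
    exact (c1.differentiableAt hk0).hasFDerivAt

variable {δ h : ℝ} {k : ℕ}

/-- The points near which, on the phase space, the limiting Hamiltonian is the restriction of a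
`C^k` function whose derivative does not vanish on the `(r, v)`-plane, so that its level sets are
regular surfaces transverse to the planes `l = const`. -/
def regularPoints (δ : ℝ) (k : ℕ) : Set Space :=
  {p | 0 < p.1 ∧ ∃ G : Space → ℝ, ContDiffAt ℝ k G p ∧
    (∀ᶠ p' in 𝓝 p, 0 ≤ p'.2.2 → hamiltonianLimit δ p' = G p') ∧
    (fderiv ℝ G p (1, 0, 0) ≠ 0 ∨ fderiv ℝ G p (0, 1, 0) ≠ 0)}

theorem isOpen_regularPoints (δ : ℝ) (hk : 1 ≤ k) : IsOpen (regularPoints δ k) := by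
  rw [isOpen_iff_mem_nhds]
  rintro p ⟨hp, G, hG, hH, hd⟩
  have hcont : ContinuousAt (fderiv ℝ G) p :=
    (hG.fderiv_right (m := 0) (by exact_mod_cast hk)).continuousAt
  have h1 : ∀ᶠ p' in 𝓝 p, fderiv ℝ G p' (1, 0, 0) ≠ 0 ∨ fderiv ℝ G p' (0, 1, 0) ≠ 0 := by
    rcases hd with hd | hd
    · filter_upwards [(hcont.clm_apply continuousAt_const).eventually_ne hd] with p' h
      exact Or.inl h
    · filter_upwards [(hcont.clm_apply continuousAt_const).eventually_ne hd] with p' h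
      exact Or.inr h
  filter_upwards [isOpen_fst_pos.mem_nhds hp, hG.eventually (by simp), hH.eventually_nhds, h1]
    with p' a1 a2 a3 a4
  exact ⟨a1, G, a2, a3, a4⟩

theorem periodicOrbit_subset_regularPoints (hδ : 0 < δ) (h0 : 0 < h) (hh : h < 1 / 2)
    (hk : 1 ≤ k) : periodicOrbit h ⊆ regularPoints δ k := by
  rintro p ⟨hp, hl, hH⟩
  have hr : 0 < p.1 := hp.1
  obtain ⟨G, hG, hGH⟩ := exists_contDiffAt_extension hδ hr hl (by rw [hH]; exact h0)
    (by rw [hH]; exact hh) k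
  refine ⟨hr, G, hG, hGH, ?_⟩
  have hGd : HasFDerivAt G (fderiv ℝ G p) p :=
    (hG.differentiableAt (by exact_mod_cast (by omega : k ≠ 0))).hasFDerivAt
  -- on `{l = 0}` the extension is the Hamiltonian
  have hdir : ∀ u : ℝ × ℝ, ∀ D : ℝ,
      HasDerivAt (fun t : ℝ => hamiltonian (p.1 + t * u.1) (p.2.1 + t * u.2)) D 0 →
      fderiv ℝ G p (u.1, u.2, 0) = D := by
    intro u D hD
    have hline : HasDerivAt (fun t : ℝ => p + t • ((u.1, u.2, 0) : Space)) (u.1, u.2, 0) 0 := by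
      simpa using ((hasDerivAt_id (0 : ℝ)).smul_const ((u.1, u.2, 0) : Space)).const_add p
    have e0 : p + (0 : ℝ) • ((u.1, u.2, 0) : Space) = p := by simp
    have h2 : HasDerivAt (fun t : ℝ => G (p + t • ((u.1, u.2, 0) : Space)))
        (fderiv ℝ G p (u.1, u.2, 0)) 0 := by
      refine HasFDerivAt.comp_hasDerivAt (f := fun t : ℝ => p + t • ((u.1, u.2, 0) : Space)) 0 ?_
        hline
      rw [e0]
      exact hGd
    refine h2.unique (hD.congr_of_eventuallyEq ?_)
    have hct : Tendsto (fun t : ℝ => p + t • ((u.1, u.2, 0) : Space)) (𝓝 0) (𝓝 p) := by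
      have := hline.continuousAt.tendsto
      rwa [e0] at this
    filter_upwards [hct.eventually hGH, hct.eventually (isOpen_fst_pos.mem_nhds hr)] with t a1 a2
    have hz : (p + t • ((u.1, u.2, 0) : Space)).2.2 = 0 := by simp [hl]
    rw [← a1 hz.ge, hamiltonianLimit_of_angularMomentum_eq_zero hδ ⟨a2, hz.ge⟩ hz]
    simp
  have hd1 : HasDerivAt (fun t : ℝ => hamiltonian (p.1 + t * 1) (p.2.1 + t * 0))
      ((p.1 - 1) / p.1 ^ 3) 0 := by
    have b1 : HasDerivAt (fun t : ℝ => p.1 + t * 1) 1 0 := by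
      simpa using ((hasDerivAt_id (0 : ℝ)).mul_const 1).const_add p.1
    have b2 := (((b1.sub_const 1).fun_pow 2).fun_div ((b1.fun_pow 2).const_mul 2)
      (by simp [hr.ne'])).const_add ((p.2.1 + 0) ^ 2 / 2)
    unfold hamiltonian
    simp only [mul_zero]
    refine b2.congr_deriv ?_
    simp only [zero_mul, add_zero]
    push_cast
    field_simp
    ring
  have hd2 : HasDerivAt (fun t : ℝ => hamiltonian (p.1 + t * 0) (p.2.1 + t * 1)) p.2.1 0 := by
    have b1 : HasDerivAt (fun t : ℝ => p.2.1 + t * 1) 1 0 := by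
      simpa using ((hasDerivAt_id (0 : ℝ)).mul_const 1).const_add p.2.1
    have b2 := ((b1.fun_pow 2).div_const 2).add_const
      ((p.1 + 0 - 1) ^ 2 / (2 * (p.1 + 0) ^ 2))
    unfold hamiltonian
    simp only [mul_zero]
    refine b2.congr_deriv ?_
    simp
  by_contra! hc
  have e1 := (hdir (1, 0) _ hd1).symm.trans hc.1
  have e2 := (hdir (0, 1) _ hd2).symm.trans hc.2
  have e3 : p.1 = 1 := by
    rcases div_eq_zero_iff.1 e1 with h | h
    · linarith
    · exact absurd h (pow_ne_zero 3 hr.ne')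
  rw [e3, e2, hamiltonian] at hH
  norm_num at hH
  linarith

/-- A linear coordinate in the `(r, v)`-plane that, together with the extension `G` of the limiting
Hamiltonian and with `l`, forms a local coordinate system. -/
theorem exists_transverse_coordinate {L : Space →L[ℝ] ℝ} (h : L (1, 0, 0) ≠ 0 ∨ L (0, 1, 0) ≠ 0) :
    ∃ m : Space →L[ℝ] ℝ, ∀ u : Space, L u = 0 → m u = 0 → u.2.2 = 0 → u = 0 := by
  have hlin : ∀ u : Space, u.2.2 = 0 → L u = u.1 * L (1, 0, 0) + u.2.1 * L (0, 1, 0) := by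
    rintro ⟨a, b, c⟩ hc
    simp only at hc
    have : ((a, b, c) : Space) = a • ((1, 0, 0) : Space) + b • ((0, 1, 0) : Space) := by
      simp [hc]
    rw [this, map_add, map_smul, map_smul]
    simp
  rcases h with h | h
  · refine ⟨(ContinuousLinearMap.fst ℝ ℝ ℝ).comp (ContinuousLinearMap.snd ℝ ℝ (ℝ × ℝ)),
      fun u h1 h2 h3 => ?_⟩
    have h2' : u.2.1 = 0 := h2
    rw [hlin u h3, h2', zero_mul, add_zero] at h1
    exact Prod.ext ((mul_eq_zero.1 h1).resolve_right h) (Prod.ext h2' h3)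
  · refine ⟨ContinuousLinearMap.fst ℝ ℝ (ℝ × ℝ), fun u h1 h2 h3 => ?_⟩
    have h2' : u.1 = 0 := h2
    rw [hlin u h3, h2', zero_mul, zero_add] at h1
    exact Prod.ext h2' (Prod.ext ((mul_eq_zero.1 h1).resolve_right h) h3)

/-- At a regular point, the data for straightening all level sets of the limiting Hamiltonian. -/
theorem exists_straightening_data (hδ : 0 < δ) (hk : 1 ≤ k) {p₀ : Space}
    (hp₀ : p₀ ∈ regularPoints δ k) : ∃ (G : Space → ℝ) (m : Space →L[ℝ] ℝ) (U : Set Space),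
      ContDiffAt ℝ k G p₀ ∧
      (∀ u, fderiv ℝ G p₀ u = 0 → m u = 0 → u.2.2 = 0 → u = 0) ∧ U ∈ 𝓝 p₀ ∧
      ∀ p ∈ U, ∀ h, 0 < h → h < 1 / 2 →
        (p ∈ stableSet δ (periodicOrbit h) ∩ regularPoints δ k ↔ 0 ≤ p.2.2 ∧ G p = h) := by
  have hN := isOpen_regularPoints δ hk
  obtain ⟨hr, G, hG, hH, hd⟩ := id hp₀
  obtain ⟨m, hm⟩ := exists_transverse_coordinate hd
  refine ⟨G, m, _, hG, hm, inter_mem (hN.mem_nhds hp₀) hH, fun p hp h h0 hh => ?_⟩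
  rw [stableSet_periodicOrbit hδ h0 hh]
  constructor
  · rintro ⟨⟨h1, h2⟩, -⟩
    exact ⟨h1.2, (hp.2 h1.2).symm.trans h2⟩
  · rintro ⟨h1, h2⟩
    exact ⟨⟨⟨hp.1.1, h1⟩, (hp.2 h1).trans h2⟩, hp.1⟩

theorem isCkSurface_stableSet (hδ : 0 < δ) (h0 : 0 < h) (hh : h < 1 / 2) (hk : 1 ≤ k) :
    IsCkSurface k (stableSet δ (periodicOrbit h) ∩ regularPoints δ k) := by
  rintro p₀ ⟨-, hp₀⟩
  obtain ⟨G, m, U, hG, hm, hU, hiff⟩ := exists_straightening_data hδ hk hp₀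
  have hGd : HasFDerivAt G (fderiv ℝ G p₀) p₀ :=
    (hG.differentiableAt (by exact_mod_cast (by omega : k ≠ 0))).hasFDerivAt
  have hf : ContDiffAt ℝ k (fun p : Space => ((G p - h, m p, p.2.2) : Space)) p₀ :=
    (hG.sub contDiffAt_const).prodMk (m.contDiff.contDiffAt.prodMk (by fun_prop))
  have hfd := (hGd.sub_const h).prodMk (m.hasFDerivAt.prodMk
    (((ContinuousLinearMap.snd ℝ ℝ ℝ).comp (ContinuousLinearMap.snd ℝ ℝ (ℝ × ℝ))).hasFDerivAt
      (x := p₀)))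
  obtain ⟨e, h1, h2, h3, h4, h5⟩ := exists_ckDiffeo hk hf (fun u hu => by
    replace hu := (congrArg (fun L => L u) (HasFDerivAt.fderiv hfd)).symm.trans hu
    simp only [Prod.ext_iff] at hu
    exact hm u hu.1 hu.2.1 hu.2.2) hU
  refine ⟨e, h1, h4, h5, fun p hp => ?_⟩
  rw [h3 p, hiff p (h2 hp) h h0 hh]
  exact ⟨Iff.rfl, and_congr_right fun _ => sub_eq_zero.symm⟩

theorem isCkFamilyOfSurfaces_stableSet (hδ : 0 < δ) (hk : 1 ≤ k) {J : Set ℝ} (hJ : IsOpen J)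
    (hJ' : J ⊆ Ioo 0 (1 / 2)) :
    IsCkFamilyOfSurfaces k J (fun h => stableSet δ (periodicOrbit h) ∩ regularPoints δ k) := by
  rintro h₀ hh₀ p₀ ⟨-, hp₀⟩
  obtain ⟨G, m, U, hG, hm, hU, hiff⟩ := exists_straightening_data hδ hk hp₀
  have hGd : HasFDerivAt G (fderiv ℝ G p₀) p₀ :=
    (hG.differentiableAt (by exact_mod_cast (by omega : k ≠ 0))).hasFDerivAt
  have hG' : ContDiffAt ℝ k (fun z : ℝ × Space => G z.2) (h₀, p₀) :=
    ContDiffAt.comp (g := G) (f := fun z : ℝ × Space => z.2) (h₀, p₀) hG contDiffAt_snd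
  have hGd' : HasFDerivAt (fun z : ℝ × Space => G z.2)
      ((fderiv ℝ G p₀).comp (ContinuousLinearMap.snd ℝ ℝ Space)) (h₀, p₀) :=
    HasFDerivAt.comp (g := G) (f := fun z : ℝ × Space => z.2) (h₀, p₀) hGd hasFDerivAt_snd
  have hf : ContDiffAt ℝ k
      (fun z : ℝ × Space => ((z.1, G z.2 - z.1, m z.2, z.2.2.2) : ℝ × Space)) (h₀, p₀) :=
    contDiffAt_fst.prodMk ((hG'.sub contDiffAt_fst).prodMk
      ((m.contDiff.contDiffAt.comp _ contDiffAt_snd).prodMk (by fun_prop)))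
  have hfd := (hasFDerivAt_fst (𝕜 := ℝ) (p := (h₀, p₀))).prodMk ((hGd'.fun_sub hasFDerivAt_fst).prodMk
    ((m.comp (ContinuousLinearMap.snd ℝ ℝ Space)).hasFDerivAt.prodMk
    ((((ContinuousLinearMap.snd ℝ ℝ ℝ).comp (ContinuousLinearMap.snd ℝ ℝ (ℝ × ℝ))).comp
      (ContinuousLinearMap.snd ℝ ℝ Space)).hasFDerivAt)))
  obtain ⟨e, h1, h2, h3, h4, h5⟩ := exists_ckDiffeo hk hf (fun u hu => by
    replace hu := (congrArg (fun L => L u) (HasFDerivAt.fderiv hfd)).symm.trans hu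
    simp only [Prod.ext_iff] at hu
    obtain ⟨a1, a2, a3, a4⟩ := hu
    have a1' : u.1 = 0 := a1
    have a2' : fderiv ℝ G p₀ u.2 - u.1 = 0 := a2
    rw [a1', sub_zero] at a2'
    exact Prod.ext a1' (hm u.2 a2' a3 a4)) (prod_mem_nhds (hJ.mem_nhds hh₀) hU)
  refine ⟨e, h1, h4, h5, fun z hz => ?_⟩
  obtain ⟨b1, b2⟩ := h2 hz
  have b3 := hJ' b1
  simp only [h3 z]
  refine ⟨b1, trivial, trivial, ?_⟩
  rw [hiff z.2 b2 z.1 b3.1 b3.2]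
  exact and_congr_right fun _ => sub_eq_zero.symm

end Straightening

end KeplerDrag

end

theorem theorem2p3 (δ : ℝ) (hδ : 0 < δ) :
    -- the forward flow and the limiting Hamiltonian are well defined on the phase space
    (∀ p ∈ KeplerDrag.phaseSpace,
      KeplerDrag.IsForwardSolution δ p (fun t => KeplerDrag.flow δ t p) ∧
      (∀ γ : ℝ → KeplerDrag.Space, KeplerDrag.IsForwardSolution δ p γ →
        ∀ t : ℝ, 0 ≤ t → γ t = KeplerDrag.flow δ t p) ∧
      Tendsto (fun t : ℝ =>
          KeplerDrag.hamiltonian (KeplerDrag.flow δ t p).1 (KeplerDrag.flow δ t p).2.1)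
        atTop (𝓝 (KeplerDrag.hamiltonianLimit δ p))) ∧
    ∀ h : ℝ, 0 < h → h < 1 / 2 →
      -- the stable set of the periodic orbit is a level set of the limiting Hamiltonian
      KeplerDrag.stableSet δ (KeplerDrag.periodicOrbit h) =
        {p | p ∈ KeplerDrag.phaseSpace ∧ KeplerDrag.hamiltonianLimit δ p = h} ∧
      -- near the periodic orbit it is a smooth surface, depending smoothly on the parameter
      ∀ k : ℕ, 1 ≤ k → ∃ N : Set KeplerDrag.Space,
        IsOpen N ∧ KeplerDrag.periodicOrbit h ⊆ N ∧
        KeplerDrag.IsCkSurface k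
          (KeplerDrag.stableSet δ (KeplerDrag.periodicOrbit h) ∩ N) ∧
        ∃ ε : ℝ, 0 < ε ∧ Ioo (h - ε) (h + ε) ⊆ Ioo 0 (1 / 2) ∧
          KeplerDrag.IsCkFamilyOfSurfaces k (Ioo (h - ε) (h + ε))
            (fun h' => KeplerDrag.stableSet δ (KeplerDrag.periodicOrbit h') ∩ N) := by
  refine ⟨fun p hp => ⟨KeplerDrag.isForwardSolution_flow hδ hp, fun γ hγ t ht =>
    hγ.eq_of_nonneg (KeplerDrag.isForwardSolution_flow hδ hp) ht,
    KeplerDrag.tendsto_hamiltonianLimit hδ hp⟩, fun h h0 hh =>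
    ⟨KeplerDrag.stableSet_periodicOrbit hδ h0 hh, fun k hk => ?_⟩⟩
  have hsub : Ioo (h - min h (1 / 2 - h)) (h + min h (1 / 2 - h)) ⊆ Ioo (0 : ℝ) (1 / 2) :=
    Ioo_subset_Ioo (by linarith [min_le_left h (1 / 2 - h)])
      (by linarith [min_le_right h (1 / 2 - h)])
  exact ⟨KeplerDrag.regularPoints δ k, KeplerDrag.isOpen_regularPoints δ hk,
    KeplerDrag.periodicOrbit_subset_regularPoints hδ h0 hh hk,
    KeplerDrag.isCkSurface_stableSet hδ h0 hh hk,
    min h (1 / 2 - h), lt_min h0 (by linarith), hsub,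
    KeplerDrag.isCkFamilyOfSurfaces_stableSet hδ hk isOpen_Ioo hsub⟩
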